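/- Let $G$ be a compact connected semisimple Lie group with Lie algebra $\mathfrak g$ and Killing form $B$, let $\theta\neq\mathrm{Id}$ be an involutive automorphism of $\mathfrak g$ with $+1$ eigenspace $\mathfrak h$ and $-1$ eigenspace $\mathfrak p$, and let $H\subset G$ be the analytic subgroup with Lie algebra $\mathfrak h$. Assume $\operatorname{rank}G=\operatorname{rank}H$ and let $T\subset H$ be a maximal torus of $G$ with Lie algebra $\mathfrak t$. Let $\Delta$, $\Delta_{\mathfrak h}$, $\Delta_{\mathfrak p}$ be the sets of roots with respect to $\mathfrak t_{\mathbb C}$ whose root spaces lie in $\mathfrak g_{\mathbb C}$, $\mathfrak h_{\mathbb C}$, $\mathfrak p_{\mathbb C}$ respectively; let $\Delta^+\subset\Delta$ be a system of positive roots and $\Delta_{\mathfrak h}^+=\Delta^+\cap\Delta_{\mathfrak h}$. Let $W$ be the Weyl group of $G$, acting on $\mathfrak t_{\mathbb C}^*$, and put $$W_1=\{w\in W\mid \Delta_{\mathfrak h}^+\subset w\Delta^+\},\qquad \delta_{\mathfrak p}^{w}=\tfrac12\sum_{\alpha\in w\Delta^+\cap\Delta_{\mathfrak p}}\alpha\quad(w\in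 W_1).$$ Equip $\mathfrak p$ with the inner product $-B$ and assume that $\mathrm{Ad}\colon H\to SO(\mathfrak p)$ lifts to a continuous homomorphism $\bar\rho\colon H\to \mathrm{Spin}(\mathfrak p)$. Let $\sigma$ be the spinor representation of $\mathrm{Spin}(\mathfrak p)$ on $S$, that is, the restriction to $\mathrm{Spin}(\mathfrak p)$ of an irreducible complex representation of the complexified Clifford algebra of $\mathfrak p$, and let $\chi=\sigma\circ\bar\rho$ be the resulting representation of $H$ on $S$. Then for each $w\in W_1$, $\delta_{\mathfrak p}^{w}$ is the highest weight, with respect to $\Delta_{\mathfrak h}^+$, of an irreducible component $\tau_w$ of $\chi$. If $w,w'\in W_1$ and $w\neq w'$, then $\tau_w$ and $\tau_{w'}$ are not equivalent. -/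

import Mathlib

open scoped Manifold ContDiff TensorProduct

noncomputable section

/-! ### Lie groups: Lie algebra, exponential map, adjoint representation -/

section LieGroups

variable {n : ℕ} {G : Type*} [TopologicalSpace G] [ChartedSpace (EuclideanSpace ℝ (Fin n)) G]
  [Group G]

/-- Mathlib defines the Lie bracket on the tangent space at the identity for Lie groups of class
`minSmoothness ℝ 3` (that is, `C^3`); smooth Lie groups are of this class. -/
instance lieGroup_minSmoothness [LieGroup (𝓡 n) ∞ G] : LieGroup (𝓡 n) (minSmoothness ℝ 3) G :=
  LieGroup.of_le (n := ∞) (by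
    rw [minSmoothness_of_isRCLikeNormedField]
    exact ENat.LEInfty.out)

variable (n G) in
/-- The Lie algebra `𝔤` of the `n`-dimensional Lie group `G`: the tangent space at the identity. -/
abbrev LieAlg : Type := GroupLieAlgebra (𝓡 n) G

open Classical in
/-- The exponential map: `exp X = γ 1`, where `γ` is the integral curve through `1` of the
left-invariant vector field defined by `X`. -/
def lieExp (X : LieAlg n G) : G :=
  if h : ∃ γ : ℝ → G, γ 0 = 1 ∧
      IsMIntegralCurve (I := 𝓡 n) γ (mulInvariantVectorField (I := 𝓡 n) (G := G) X)
  then h.choose 1 else 1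

variable (n) in
/-- The adjoint representation: `Ad g` is the differential at `1` of `x ↦ g x g⁻¹`. -/
def lieAd (g : G) : LieAlg n G →L[ℝ] LieAlg n G :=
  mfderiv (𝓡 n) (𝓡 n) (fun x : G => g * x * g⁻¹) 1

/-- The analytic subgroup with Lie algebra `𝔥`: the subgroup generated by `exp 𝔥`. -/
def analyticSubgroup (𝔥 : Submodule ℝ (LieAlg n G)) : Subgroup G :=
  Subgroup.closure (lieExp '' (𝔥 : Set (LieAlg n G)))

variable (n) in
/-- The Lie algebra `{X | exp (t X) ∈ K for all t ∈ ℝ}` of a closed subgroup `K` (this set is a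
linear subspace, so that taking the span adds nothing). -/
def lieAlgebraOf (K : Subgroup G) : Submodule ℝ (LieAlg n G) :=
  Submodule.span ℝ {X | ∀ t : ℝ, lieExp (t • X) ∈ K}

/-- Tori in a Lie group: compact connected abelian subgroups. -/
def IsTorus (T : Subgroup G) : Prop :=
  IsCompact (T : Set G) ∧ IsConnected (T : Set G) ∧ ∀ x ∈ T, ∀ y ∈ T, x * y = y * x

/-- Maximal tori. -/
def IsMaximalTorus (T : Subgroup G) : Prop := Maximal IsTorus T

end LieGroups

/-! ### Roots, positive systems, the Weyl group -/

section Roots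

variable {L : Type*} [LieRing L] [LieAlgebra ℝ L]

/-- The dual `𝔱_ℂ^*` of the complexification of a real vector space `𝔱`, as the space of
real-linear maps `𝔱 → ℂ`. -/
abbrev ComplexDual (𝔱 : Submodule ℝ L) : Type _ := 𝔱 →ₗ[ℝ] ℂ

/-- The roots `α` (with respect to `𝔱`) whose root space
`{ξ ∈ 𝔤_ℂ | [X, ξ] = α(X) ξ for all X ∈ 𝔱}` meets `U_ℂ` in a non-zero vector.
For `U = 𝔤` these are the roots of `𝔤_ℂ`. -/
def rootsIn (𝔱 U : Submodule ℝ L) : Set (ComplexDual 𝔱) :=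
  {α | α ≠ 0 ∧ ∃ ξ ∈ U.baseChange ℂ, ξ ≠ 0 ∧
    ∀ X : 𝔱, ⁅(1 : ℂ) ⊗ₜ[ℝ] (X : L), ξ⁆ = α X • ξ}

/-- `s` is the reflection `s μ = μ - (2⟨μ, α⟩ / ⟨α, α⟩) α` of `𝔱_ℂ^*` in the root `α`.
Here `u` is a non-zero multiple of the vector of `𝔱` dual to `α`, i.e. it spans the orthogonal
complement of `ker α` in `𝔱` for the Killing form, so that
`⟨μ, α⟩ / ⟨α, α⟩ = μ(u) / α(u)`. -/
def IsRootReflection {𝔱 : Submodule ℝ L} (α : ComplexDual 𝔱)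
    (s : ComplexDual 𝔱 ≃ₗ[ℂ] ComplexDual 𝔱) : Prop :=
  ∃ u : 𝔱, α u ≠ 0 ∧ (∀ X : 𝔱, α X = 0 → killingForm ℝ L (u : L) (X : L) = 0) ∧
    ∀ μ : ComplexDual 𝔱, s μ = μ - (2 * μ u / α u) • α

/-- The Weyl group of `(𝔤_ℂ, 𝔱_ℂ)`, acting on `𝔱_ℂ^*`: it is generated by the reflections in the
roots. -/
def lieWeylGroup (𝔱 : Submodule ℝ L) : Subgroup (ComplexDual 𝔱 ≃ₗ[ℂ] ComplexDual 𝔱) :=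
  Subgroup.closure {s | ∃ α ∈ rootsIn 𝔱 ⊤, IsRootReflection α s}

/-- `P` is a system of positive roots of `𝔤_ℂ`: the roots that are positive at some regular
element, i.e. on some open Weyl chamber. (The roots of the Lie algebra of a compact group take
purely imaginary values on `𝔱`, so the sign is that of the imaginary part.) -/
def IsPositiveSystem (𝔱 : Submodule ℝ L) (P : Set (ComplexDual 𝔱)) : Prop :=
  ∃ X₀ : 𝔱, (∀ α ∈ rootsIn 𝔱 ⊤, (α X₀).im ≠ 0) ∧ P = {α ∈ rootsIn 𝔱 ⊤ | 0 < (α X₀).im}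

/-- `W_1 = {w ∈ W | Δ_𝔥^+ ⊆ w Δ^+}`, where `Δ_𝔥^+ = Δ^+ ∩ Δ_𝔥`. -/
def weylW1 (𝔱 𝔥 : Submodule ℝ L) (P : Set (ComplexDual 𝔱)) :
    Set (ComplexDual 𝔱 ≃ₗ[ℂ] ComplexDual 𝔱) :=
  {w | w ∈ lieWeylGroup 𝔱 ∧ P ∩ rootsIn 𝔱 𝔥 ⊆ w '' P}

/-- `δ_𝔭^w`, half the sum of the elements of `Δ_𝔭^w`, where `w Δ^+ = Δ_𝔥^+ ∪ Δ_𝔭^w` (disjoint),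
that is, `Δ_𝔭^w = w Δ^+ ∩ Δ_𝔭`. -/
def deltaP (𝔱 𝔭 : Submodule ℝ L) (P : Set (ComplexDual 𝔱))
    (w : ComplexDual 𝔱 ≃ₗ[ℂ] ComplexDual 𝔱) : ComplexDual 𝔱 :=
  (1 / 2 : ℂ) • ∑ᶠ α ∈ (w '' P) ∩ rootsIn 𝔱 𝔭, α

end Roots

/-! ### Weights and highest weights of representations of a subgroup -/

section Weights

variable {n : ℕ} {G : Type*} [TopologicalSpace G] [ChartedSpace (EuclideanSpace ℝ (Fin n)) G]
  [Group G] [LieGroup (𝓡 n) ∞ G] {V : Type*} [AddCommGroup V] [Module ℂ V]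

/-- `μ ∈ 𝔱_ℂ^*` is a weight of the representation `π` of `H` (where `exp 𝔱 ⊆ H`): there is a
non-zero vector `v` with `π(exp X) v = e^{μ(X)} v` for all `X ∈ 𝔱`. -/
def IsWeightOf {H : Subgroup G} {𝔱 : Submodule ℝ (LieAlg n G)} (π : Representation ℂ H V)
    (μ : ComplexDual 𝔱) : Prop :=
  ∃ v : V, v ≠ 0 ∧ ∀ (X : 𝔱) (h : H), (h : G) = lieExp (X : LieAlg n G) →
    π h v = Complex.exp (μ X) • v

/-- `μ` is the highest weight of `π` with respect to the set `Q` of positive roots of `H`: it is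
a weight, and every weight has the form `μ - ∑ n_β β` with `β ∈ Q` and `n_β ∈ ℕ`. -/
def IsHighestWeightOf {H : Subgroup G} {𝔱 : Submodule ℝ (LieAlg n G)} (π : Representation ℂ H V)
    (Q : Set (ComplexDual 𝔱)) (μ : ComplexDual 𝔱) : Prop :=
  IsWeightOf π μ ∧ ∀ ν : ComplexDual 𝔱, IsWeightOf π ν → μ - ν ∈ AddSubmonoid.closure Q

end Weights

/-! ### The symmetric pair and its spinor representation -/

section Spinor

/-- The complex representation `σ` of the real algebra `A` (i.e. of `A_ℂ = ℂ ⊗ A`) is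
irreducible. -/
def IsIrreducibleAlgRep {A S : Type*} [Ring A] [Algebra ℝ A] [AddCommGroup S] [Module ℂ S]
    (σ : (ℂ ⊗[ℝ] A) →ₐ[ℂ] Module.End ℂ S) : Prop :=
  Nontrivial S ∧ ∀ W : Submodule ℂ S, (∀ a, ∀ v ∈ W, σ a v ∈ W) → W = ⊥ ∨ W = ⊤

variable {L : Type*} [LieRing L] [LieAlgebra ℝ L]

/-- The `c`-eigenspace of an automorphism `θ` of a real Lie algebra: `𝔥` for `c = 1` and `𝔭` for
`c = -1`. -/
def autEigenspace (θ : L ≃ₗ⁅ℝ⁆ L) (c : ℝ) : Submodule ℝ L :=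
  Module.End.eigenspace ((θ : L →ₗ⁅ℝ⁆ L) : L →ₗ[ℝ] L) c

/-- The Killing form `B(ξ, ξ) = -⟨ξ, ξ⟩` as a quadratic form on `𝔭`. Mathlib's Clifford relation
for it is `ξ · ξ = B(ξ, ξ)`, i.e. `ξ · ξ + ⟨ξ, ξ⟩ 1 = 0`, so its Clifford algebra is `Cl(𝔭)` for the
inner product `⟨·,·⟩ = -B`, and its spin group is `Spin(𝔭)`. -/
def killingQuad (𝔭 : Submodule ℝ L) : QuadraticForm ℝ 𝔭 :=
  QuadraticMap.comp (LinearMap.BilinMap.toQuadraticMap (killingForm ℝ L)) 𝔭.subtype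

variable {n : ℕ} {G : Type*} [TopologicalSpace G] [ChartedSpace (EuclideanSpace ℝ (Fin n)) G]
  [Group G] [LieGroup (𝓡 n) ∞ G]

/-- `ρ : H → Spin(𝔭)` is a lift of `Ad : H → SO(𝔭)` through the double cover
`ψ : Spin(𝔭) → SO(𝔭)`, `ψ(x) v = x v x⁻¹`: a continuous homomorphism with `ψ(ρ(h)) = Ad(h)`.
The finite-dimensional space `Cl(𝔭)` carries its canonical real vector space topology. -/
def IsSpinLift {H : Subgroup G} {𝔭 : Submodule ℝ (LieAlg n G)}
    (ρ : H →* spinGroup (killingQuad 𝔭)) : Prop :=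
  (@Continuous H (CliffordAlgebra (killingQuad 𝔭)) _
      (moduleTopology ℝ (CliffordAlgebra (killingQuad 𝔭)))
      (fun h => (ρ h : CliffordAlgebra (killingQuad 𝔭)))) ∧
  ∀ (h : H) (v v' : 𝔭), (v' : LieAlg n G) = lieAd n (h : G) (v : LieAlg n G) →
    (ρ h : CliffordAlgebra (killingQuad 𝔭)) * CliffordAlgebra.ι (killingQuad 𝔭) v *
      ((ρ h)⁻¹ : spinGroup (killingQuad 𝔭)) = CliffordAlgebra.ι (killingQuad 𝔭) v'

/-- The spinor representation `χ = σ ∘ ρ` of `H` on the space of spinors `S`, where `σ` is a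
representation of `ℂ ⊗ Cl(𝔭)`, restricted to `Spin(𝔭)`. -/
def spinorRep {H : Subgroup G} {𝔭 : Submodule ℝ (LieAlg n G)}
    {S : Type*} [AddCommGroup S] [Module ℂ S]
    (σ : (ℂ ⊗[ℝ] CliffordAlgebra (killingQuad 𝔭)) →ₐ[ℂ] Module.End ℂ S)
    (ρ : H →* spinGroup (killingQuad 𝔭)) : Representation ℂ H S where
  toFun h := σ (1 ⊗ₜ[ℝ] (ρ h : CliffordAlgebra (killingQuad 𝔭)))
  map_one' := by
    rw [map_one, Submonoid.coe_one, ← Algebra.TensorProduct.one_def, map_one]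
  map_mul' x y := by
    rw [map_mul, Submonoid.coe_mul, ← map_mul, Algebra.TensorProduct.tmul_mul_tmul, one_mul]

end Spinor

end

noncomputable section

open Set Filter Topology

/-! ### One-parameter subgroups and the exponential map -/

section LieGroupBasics

variable {n : ℕ} {G : Type*} [TopologicalSpace G] [ChartedSpace (EuclideanSpace ℝ (Fin n)) G]
  [Group G] [LieGroup (𝓡 n) ∞ G]

/-! The spinor space is a fermionic Fock space, and `δ_𝔭^w` is the weight of a vacuum vector. For `w
∈ W₁` the set `wΔ⁺` consists of the roots positive at some regular `Y ∈ 𝔱` (`exists_image_eq`). For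
every root `α` of `𝔭` positive at `Y`, take root vectors `e_α`, `f_α` for `α`, `-α` with `2B(e_α,
f_α) = 1`. The Clifford relations make `c(e_α)` and `c(f_α)` annihilation and creation operators.
Since `𝔱 ⊆ 𝔥`, zero is not a weight of `𝔭_ℂ`, so these operators generate the whole Clifford action.

The differential of `χ` at `X ∈ 𝔥` is the Clifford element `spinOf` whose commutator with vectors is
`ad X` (`hasDerivAt_spinCurve`). On `𝔱` Schur's lemma rewrites it as `∑ α(X) (c(e_α) c(f_α) - 1/2)`
(`cartan_apply`). A vector killed by all `c(e_α)` thus has weight `½ ∑ α = δ_𝔭^w`. The creation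
operators generate `S` from it and lower the imaginary part of the eigenvalue of `Y`. The eigenspace
of the vacuum is therefore a line with no eigenvalue above it (`exists_vacuum_eigenspace`), and the
positive root vectors of `𝔥` kill the vacuum. The action of `𝔥` is skew for a Hermitian form, hence
completely reducible, so the `𝔥`-module generated by the vacuum is irreducible with highest weight
`δ_𝔭^w` (`exists_highestWeight`).

For inequivalence, equivalent representations have the same highest weight. The value of `δ_𝔭^w`
determines `wΔ⁺ ∩ Δ_𝔭` (`setOf_eq_of_halfSum_eq`), and `wΔ⁺ ∩ Δ_𝔥 = Δ_𝔥⁺` by the choice of `W₁`. So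
`wΔ⁺` is determined, and `w` with it, because the Weyl group acts freely on positive systems
(`weyl_eq_one`).

The analytic input is that `Ad(exp tX)` has derivative `ad X`, that the Killing form of a compact
semisimple group is negative definite, and that the Lie algebra of a maximal torus is its own
centralizer (`IsMaximalTorus.mem_lieAlgebraOf`). These make `𝔱_ℂ` a Cartan subalgebra, and the
algebraic theory of root systems applies. -/

theorem lieGroup_isTopologicalGroup (n : ℕ) (G : Type*) [TopologicalSpace G]
    [ChartedSpace (EuclideanSpace ℝ (Fin n)) G] [Group G] [LieGroup (𝓡 n) ∞ G] :
    IsTopologicalGroup G :=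
  topologicalGroup_of_lieGroup (𝓡 n) ∞

theorem mdifferentiableAt_leftMul (g h : G) :
    MDifferentiableAt (𝓡 n) (𝓡 n) (fun x : G => g * x) h :=
  (contMDiff_mul_left (I := 𝓡 n) (n := ∞) (a := g)).mdifferentiable (by simp) h

theorem mdifferentiableAt_conj (g h : G) :
    MDifferentiableAt (𝓡 n) (𝓡 n) (fun x : G => g * x * g⁻¹) h :=
  ((contMDiff_mul_right (I := 𝓡 n) (n := ∞) (a := g⁻¹)).comp
    (contMDiff_mul_left (I := 𝓡 n) (n := ∞) (a := g))).mdifferentiable (by simp) h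

theorem contMDiff_mulInvariantVectorField_one (X : LieAlg n G) :
    ContMDiff (𝓡 n) ((𝓡 n).tangent) 1
      (fun g : G => (⟨g, mulInvariantVectorField X g⟩ : TangentBundle (𝓡 n) G)) :=
  (contMDiff_mulInvariantVectorField (I := 𝓡 n) (G := G) X).of_le
    (by rw [minSmoothness_of_isRCLikeNormedField]; norm_num)

theorem mfderiv_mul_left_mulInvariantVectorField (X : LieAlg n G) (g h : G) :
    mfderiv (𝓡 n) (𝓡 n) (fun x : G => g * x) h (mulInvariantVectorField (I := 𝓡 n) X h) =
      mulInvariantVectorField (I := 𝓡 n) X (g * h) := by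
  have e : (fun x : G => g * h * x) = (fun x => g * x) ∘ (fun x => h * x) := by
    ext x; simp [mul_assoc]
  have h1 : MDifferentiableAt (𝓡 n) (𝓡 n) (fun x : G => g * x) (h * 1) :=
    mdifferentiableAt_leftMul _ _
  have := mfderiv_comp (I := 𝓡 n) (I' := 𝓡 n) (I'' := 𝓡 n) (1 : G) h1
    (mdifferentiableAt_leftMul h 1)
  unfold mulInvariantVectorField
  rw [e, this, mul_one]
  rfl

theorem mfderiv_conj_mulInvariantVectorField (X : LieAlg n G) (g h : G) :
    mfderiv (𝓡 n) (𝓡 n) (fun x : G => g * x * g⁻¹) h (mulInvariantVectorField (I := 𝓡 n) X h) =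
      mulInvariantVectorField (I := 𝓡 n) (lieAd n g X) (g * h * g⁻¹) := by
  have e : (fun x : G => g * x * g⁻¹) ∘ (fun x : G => h * x) =
      (fun x => (g * h * g⁻¹) * x) ∘ (fun x : G => g * x * g⁻¹) := by
    ext x; simp [mul_assoc]
  have h1 : MDifferentiableAt (𝓡 n) (𝓡 n) (fun x : G => g * x * g⁻¹) (h * 1) :=
    mdifferentiableAt_conj _ _
  have h2 : MDifferentiableAt (𝓡 n) (𝓡 n) (fun x : G => (g * h * g⁻¹) * x) (g * 1 * g⁻¹) :=
    mdifferentiableAt_leftMul _ _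
  have e1 := mfderiv_comp (I := 𝓡 n) (I' := 𝓡 n) (I'' := 𝓡 n) (1 : G) h1
    (mdifferentiableAt_leftMul h 1)
  have e2 := mfderiv_comp (I := 𝓡 n) (I' := 𝓡 n) (I'' := 𝓡 n) (1 : G) h2
    (mdifferentiableAt_conj g 1)
  rw [e, e2, mul_one, mul_one, mul_inv_cancel] at e1
  have := congrArg (fun f => f X) e1
  exact this.symm

theorem isMIntegralCurve_mul_left {X : LieAlg n G} {γ : ℝ → G} {s : Set ℝ} (g : G)
    (h : IsMIntegralCurveOn (I := 𝓡 n) γ (mulInvariantVectorField X) s) :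
    IsMIntegralCurveOn (I := 𝓡 n) (fun t => g * γ t) (mulInvariantVectorField X) s := by
  intro t ht
  have h1 := (mdifferentiableAt_leftMul (n := n) g (γ t)).hasMFDerivAt.comp_hasMFDerivWithinAt t
    (h t ht)
  have e : (mfderiv (𝓡 n) (𝓡 n) (fun x : G => g * x) (γ t)).comp
      ((1 : ℝ →L[ℝ] ℝ).smulRight (mulInvariantVectorField (I := 𝓡 n) X (γ t))) =
      (1 : ℝ →L[ℝ] ℝ).smulRight (mulInvariantVectorField (I := 𝓡 n) X (g * γ t)) := by
    rw [← mfderiv_mul_left_mulInvariantVectorField]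
    ext
    simp
  exact e ▸ h1

theorem isMIntegralCurve_conj {X : LieAlg n G} {γ : ℝ → G} (g : G)
    (h : IsMIntegralCurve (I := 𝓡 n) γ (mulInvariantVectorField X)) :
    IsMIntegralCurve (I := 𝓡 n) (fun t => g * γ t * g⁻¹)
      (mulInvariantVectorField (lieAd n g X)) := by
  intro t
  have h1 := (mdifferentiableAt_conj (n := n) g (γ t)).hasMFDerivAt.comp t (h t)
  have e : (mfderiv (𝓡 n) (𝓡 n) (fun x : G => g * x * g⁻¹) (γ t)).comp
      ((1 : ℝ →L[ℝ] ℝ).smulRight (mulInvariantVectorField (I := 𝓡 n) X (γ t))) =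
      (1 : ℝ →L[ℝ] ℝ).smulRight
        (mulInvariantVectorField (I := 𝓡 n) (lieAd n g X) (g * γ t * g⁻¹)) := by
    rw [← mfderiv_conj_mulInvariantVectorField]
    ext
    simp
  exact e ▸ h1

variable [T2Space G]

/-- Left translation carries a local integral curve at `1` to every other point with the same
interval of existence, and a uniform existence time gives a global curve. -/
theorem exists_isMIntegralCurve_mulInvariantVectorField (X : LieAlg n G) :
    ∃ γ : ℝ → G, γ 0 = 1 ∧
      IsMIntegralCurve (I := 𝓡 n) γ (mulInvariantVectorField (I := 𝓡 n) (G := G) X) := by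
  obtain ⟨γ, h0, hγ⟩ := exists_isMIntegralCurveAt_of_contMDiffAt_boundaryless (I := 𝓡 n) 0
    ((contMDiff_mulInvariantVectorField_one X) (1 : G))
  rw [isMIntegralCurveAt_iff'] at hγ
  obtain ⟨ε, hε, hγ⟩ := hγ
  have : IsManifold (𝓡 n) 1 G := IsManifold.of_le (n := ∞) (by simp)
  refine exists_isMIntegralCurve_of_isMIntegralCurveOn (contMDiff_mulInvariantVectorField_one X)
    hε (fun x => ⟨fun t => x * γ t, by simp [h0], ?_⟩) 1
  rw [Real.ball_eq_Ioo, zero_sub, zero_add] at hγ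
  exact isMIntegralCurve_mul_left x hγ

theorem eq_of_isMIntegralCurve {X : LieAlg n G} {γ γ' : ℝ → G}
    (h : IsMIntegralCurve (I := 𝓡 n) γ (mulInvariantVectorField X))
    (h' : IsMIntegralCurve (I := 𝓡 n) γ' (mulInvariantVectorField X)) (t : ℝ)
    (e : γ t = γ' t) : γ = γ' :=
  have : IsManifold (𝓡 n) 1 G := IsManifold.of_le (n := ∞) (by simp)
  isMIntegralCurve_Ioo_eq_of_contMDiff_boundaryless (contMDiff_mulInvariantVectorField_one X) h h' e

/-- Uniqueness of integral curves makes the choice in `lieExp` immaterial. -/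
theorem lieExp_eq {X : LieAlg n G} {γ : ℝ → G} (h0 : γ 0 = 1)
    (h : IsMIntegralCurve (I := 𝓡 n) γ (mulInvariantVectorField X)) : lieExp X = γ 1 := by
  have hex := exists_isMIntegralCurve_mulInvariantVectorField X
  rw [lieExp, dif_pos hex]
  exact congrFun (eq_of_isMIntegralCurve hex.choose_spec.2 h 0
    (hex.choose_spec.1.trans h0.symm)) 1

theorem lieExp_smul_eq {X : LieAlg n G} {γ : ℝ → G} (h0 : γ 0 = 1)
    (h : IsMIntegralCurve (I := 𝓡 n) γ (mulInvariantVectorField X)) (t : ℝ) :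
    lieExp (t • X) = γ t := by
  have h1 := h.comp_mul t
  rw [← mulInvariantVectorField_smul] at h1
  rw [lieExp_eq (γ := γ ∘ (· * t)) (by simp [h0]) h1]
  simp

theorem isMIntegralCurve_lieExp (X : LieAlg n G) :
    IsMIntegralCurve (I := 𝓡 n) (fun t : ℝ => lieExp (t • X)) (mulInvariantVectorField X) := by
  obtain ⟨γ, h0, h⟩ := exists_isMIntegralCurve_mulInvariantVectorField X
  convert! h using 1
  ext t
  exact lieExp_smul_eq h0 h t

@[simp]
theorem lieExp_zero : lieExp (0 : LieAlg n G) = 1 := by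
  obtain ⟨γ, h0, h⟩ := exists_isMIntegralCurve_mulInvariantVectorField (0 : LieAlg n G)
  simpa [h0] using lieExp_smul_eq h0 h 0

theorem lieExp_add_smul (X : LieAlg n G) (s t : ℝ) :
    lieExp ((s + t) • X) = lieExp (s • X) * lieExp (t • X) := by
  have h1 := (isMIntegralCurve_lieExp X).comp_add s
  have h2 := isMIntegralCurve_mul_left (lieExp (s • X))
    ((isMIntegralCurve_lieExp X).isMIntegralCurveOn univ)
  rw [← isMIntegralCurve_iff_isMIntegralCurveOn] at h2
  have := congrFun (eq_of_isMIntegralCurve h1 h2 0 (by simp)) t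
  simpa [add_comm] using this

theorem lieExp_neg (X : LieAlg n G) : lieExp (-X) = (lieExp X)⁻¹ := by
  rw [eq_inv_iff_mul_eq_one]
  simpa using (lieExp_add_smul X (-1) 1).symm

theorem continuous_lieExp_smul (X : LieAlg n G) : Continuous (fun t : ℝ => lieExp (t • X)) :=
  continuous_iff_continuousAt.2 fun t => (isMIntegralCurve_lieExp X t).continuousAt

theorem conj_lieExp (g : G) (X : LieAlg n G) : g * lieExp X * g⁻¹ = lieExp (lieAd n g X) := by
  have := lieExp_eq (by simp) (isMIntegralCurve_conj g (isMIntegralCurve_lieExp X))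
  simpa using this.symm

end LieGroupBasics

/-! ### A second-derivative identity for multiplication and conjugation -/

section SecondDerivative

variable {E : Type*} [NormedAddCommGroup E] [NormedSpace ℝ E]

theorem hasFDerivAt_fderiv_apply_comp {F : Type*} [NormedAddCommGroup F] [NormedSpace ℝ F]
    {m : F → E} {j : E → F} {j' : E →L[ℝ] F} {o : E} (hm : ContDiffAt ℝ 2 m (j o))
    (hj : HasFDerivAt j j' o) (v : F) :
    HasFDerivAt (fun x => fderiv ℝ m (j x) v)
      (((fderiv ℝ (fderiv ℝ m) (j o)).comp j').flip v) o := by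
  have h1 : HasFDerivAt (fderiv ℝ m) (fderiv ℝ (fderiv ℝ m) (j o)) (j o) :=
    ((hm.fderiv_right (m := 1) (by norm_num)).differentiableAt (by norm_num)).hasFDerivAt
  have h2 := (h1.comp o hj).clm_apply (hasFDerivAt_const v o)
  convert! h2 using 1
  ext
  simp

/-- The relation `(x y x⁻¹) x = x y`, that is `m (c (x, y), x) = m (x, y)`, is differentiated in `y`
and then in `x`, which avoids derivatives of the inversion. The mixed second derivative of `m` that
appears becomes the subtracted term by symmetry. -/
theorem fderiv_conj_eq {m c : E × E → E} {o : E} (hm : ContDiffAt ℝ 2 m (o, o))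
    (hc : ContDiffAt ℝ 2 c (o, o)) (hmx : ∀ᶠ x in 𝓝 o, m (x, o) = x)
    (hcy : ∀ᶠ y in 𝓝 o, c (o, y) = y) (hcx : ∀ᶠ x in 𝓝 o, c (x, o) = o)
    (hcm : ∀ᶠ p in 𝓝 (o, o), m (c p, p.1) = m p) (X Y : E) :
    fderiv ℝ (fun x => fderiv ℝ c (x, o) (0, Y)) o X =
      fderiv ℝ (fun x => fderiv ℝ m (x, o) (0, Y)) o X -
        fderiv ℝ (fun x => fderiv ℝ m (x, o) (0, X)) o Y := by
  have hl : HasFDerivAt (fun x : E => (x, o)) (ContinuousLinearMap.inl ℝ E E) o :=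
    hasFDerivAt_prodMk_left o o
  have hr : HasFDerivAt (fun x : E => (o, x)) (ContinuousLinearMap.inr ℝ E E) o :=
    hasFDerivAt_prodMk_right o o
  have hA := hasFDerivAt_fderiv_apply_comp (j := fun x : E => (x, o)) hc hl (0, Y)
  have hM := fun Z => hasFDerivAt_fderiv_apply_comp (j := fun x : E => (x, o)) hm hl (0, Z)
  have hsymm : IsSymmSndFDerivAt ℝ m (o, o) := hm.isSymmSndFDerivAt (by simp)
  have hm1 : ∀ᶠ p in 𝓝 (o, o), DifferentiableAt ℝ m p :=
    (hm.eventually (by simp)).mono fun p hp => hp.differentiableAt (by norm_num)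
  have hc1 : ∀ᶠ p in 𝓝 (o, o), DifferentiableAt ℝ c p :=
    (hc.eventually (by simp)).mono fun p hp => hp.differentiableAt (by norm_num)
  have tl : Tendsto (fun x : E => (x, o)) (𝓝 o) (𝓝 (o, o)) := hl.continuousAt
  have tr : Tendsto (fun x : E => (o, x)) (𝓝 o) (𝓝 (o, o)) := hr.continuousAt
  -- differentiating `m (c (x, y), x) = m (x, y)` in `y`
  have key : ∀ᶠ x in 𝓝 o, fderiv ℝ m (o, x) (fderiv ℝ c (x, o) (0, Y), 0) =
      fderiv ℝ m (x, o) (0, Y) := by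
    filter_upwards [tl.eventually hc1, tl.eventually hm1, tr.eventually hm1,
      tl.eventually hcm.eventually_nhds, hcx] with x h1 h2 h3 h4 h5
    have hin : HasFDerivAt (fun y : E => (x, y)) (ContinuousLinearMap.inr ℝ E E) o :=
      hasFDerivAt_prodMk_right x o
    have e1 : HasFDerivAt (fun y => m (x, y)) _ o := h2.hasFDerivAt.comp o hin
    have e2 : HasFDerivAt (fun y => c (x, y)) _ o := h1.hasFDerivAt.comp o hin
    have e3 := e2.prodMk (hasFDerivAt_const x o)
    have h3' : HasFDerivAt m (fderiv ℝ m (o, x)) (c (x, o), x) := by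
      rw [h5]; exact h3.hasFDerivAt
    have e4 : HasFDerivAt (fun y => m (c (x, y), x)) _ o := h3'.comp o e3
    have e5 : (fun y => m (c (x, y), x)) =ᶠ[𝓝 o] fun y => m (x, y) :=
      hin.continuousAt.tendsto.eventually h4
    have e6 := congrArg (fun f => f Y) ((e4.congr_of_eventuallyEq e5.symm).unique e1)
    simpa using e6
  have hm' : HasFDerivAt (fderiv ℝ m) (fderiv ℝ (fderiv ℝ m) (o, o)) (o, o) :=
    ((hm.fderiv_right (m := 1) (by norm_num)).differentiableAt (by norm_num)).hasFDerivAt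
  have h7 := (hm'.comp o hr).clm_apply (hA.prodMk (hasFDerivAt_const (0 : E) o))
  have h8 := congrArg (fun f => f X)
    ((h7.congr_of_eventuallyEq (EventuallyEq.symm key)).unique (hM Y))
  have cY : fderiv ℝ c (o, o) (0, Y) = Y := by
    have e1 : HasFDerivAt (fun y => c (o, y)) _ o := hc1.self_of_nhds.hasFDerivAt.comp o hr
    have := (e1.congr_of_eventuallyEq (EventuallyEq.symm hcy)).unique (hasFDerivAt_id o)
    simpa using congrArg (fun f => f Y) this
  have mZ : ∀ Z, fderiv ℝ m (o, o) (Z, 0) = Z := by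
    intro Z
    have e1 : HasFDerivAt (fun y => m (y, o)) _ o :=
      HasFDerivAt.comp (f := fun x : E => (x, o)) o hm1.self_of_nhds.hasFDerivAt hl
    have := (e1.congr_of_eventuallyEq (EventuallyEq.symm hmx)).unique (hasFDerivAt_id o)
    simpa using congrArg (fun f => f Z) this
  rw [hA.fderiv, (hM Y).fderiv, (hM X).fderiv]
  simp [cY, mZ] at h8 ⊢
  rw [← h8, hsymm.eq (0, X) (Y, 0)]
  abel

end SecondDerivative

/-! ### The adjoint representation and the bracket in the chart at the identity -/

section AdjointChart

variable {n : ℕ} {G : Type*} [TopologicalSpace G] [ChartedSpace (EuclideanSpace ℝ (Fin n)) G]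
  [Group G]

variable (n G) in
/-- The chart at the identity. -/
abbrev chartOne : PartialEquiv G (EuclideanSpace ℝ (Fin n)) := extChartAt (𝓡 n) (1 : G)

variable (n G) in
/-- Multiplication, read in the chart at the identity. -/
def chartMul (p : EuclideanSpace ℝ (Fin n) × EuclideanSpace ℝ (Fin n)) :
    EuclideanSpace ℝ (Fin n) :=
  chartOne n G ((chartOne n G).symm p.1 * (chartOne n G).symm p.2)

variable (n G) in
/-- Conjugation, read in the chart at the identity. -/
def chartConj (p : EuclideanSpace ℝ (Fin n) × EuclideanSpace ℝ (Fin n)) :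
    EuclideanSpace ℝ (Fin n) :=
  chartOne n G ((chartOne n G).symm p.1 * (chartOne n G).symm p.2 * ((chartOne n G).symm p.1)⁻¹)

variable (n G) in
theorem chartOne_symm_one : (chartOne n G).symm (chartOne n G 1) = 1 := extChartAt_to_inv 1

variable (n G) in
theorem eventually_chartOne_target : ∀ᶠ x in 𝓝 (chartOne n G 1), x ∈ (chartOne n G).target :=
  extChartAt_target_mem_nhds 1

variable [LieGroup (𝓡 n) ∞ G]

variable (n G) in
theorem contMDiffAt_chartOne_symm :
    ContMDiffAt 𝓘(ℝ, EuclideanSpace ℝ (Fin n)) (𝓡 n) ∞ (chartOne n G).symm (chartOne n G 1) :=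
  (contMDiffOn_extChartAt_symm (1 : G)).contMDiffAt (extChartAt_target_mem_nhds 1)

variable (n G) in
theorem contDiffAt_chartMul :
    ContDiffAt ℝ ∞ (chartMul n G) (chartOne n G 1, chartOne n G 1) := by
  rw [← contMDiffAt_iff_contDiffAt]
  have h1 : ContMDiffAt 𝓘(ℝ, EuclideanSpace ℝ (Fin n) × EuclideanSpace ℝ (Fin n))
      (𝓡 n) ∞ (fun p : EuclideanSpace ℝ (Fin n) × EuclideanSpace ℝ (Fin n) =>
        (chartOne n G).symm p.1) (chartOne n G 1, chartOne n G 1) :=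
    ContMDiffAt.comp _ (contMDiffAt_chartOne_symm n G) contDiffAt_fst.contMDiffAt
  have h2 : ContMDiffAt 𝓘(ℝ, EuclideanSpace ℝ (Fin n) × EuclideanSpace ℝ (Fin n))
      (𝓡 n) ∞ (fun p : EuclideanSpace ℝ (Fin n) × EuclideanSpace ℝ (Fin n) =>
        (chartOne n G).symm p.2) (chartOne n G 1, chartOne n G 1) :=
    ContMDiffAt.comp _ (contMDiffAt_chartOne_symm n G) contDiffAt_snd.contMDiffAt
  refine ContMDiffAt.comp _ ?_ (h1.mul h2)
  simp only [chartOne_symm_one, mul_one]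
  exact contMDiffAt_extChartAt

variable (n G) in
theorem contDiffAt_chartConj :
    ContDiffAt ℝ ∞ (chartConj n G) (chartOne n G 1, chartOne n G 1) := by
  rw [← contMDiffAt_iff_contDiffAt]
  have h1 : ContMDiffAt 𝓘(ℝ, EuclideanSpace ℝ (Fin n) × EuclideanSpace ℝ (Fin n))
      (𝓡 n) ∞ (fun p : EuclideanSpace ℝ (Fin n) × EuclideanSpace ℝ (Fin n) =>
        (chartOne n G).symm p.1) (chartOne n G 1, chartOne n G 1) :=
    ContMDiffAt.comp _ (contMDiffAt_chartOne_symm n G) contDiffAt_fst.contMDiffAt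
  have h2 : ContMDiffAt 𝓘(ℝ, EuclideanSpace ℝ (Fin n) × EuclideanSpace ℝ (Fin n))
      (𝓡 n) ∞ (fun p : EuclideanSpace ℝ (Fin n) × EuclideanSpace ℝ (Fin n) =>
        (chartOne n G).symm p.2) (chartOne n G 1, chartOne n G 1) :=
    ContMDiffAt.comp _ (contMDiffAt_chartOne_symm n G) contDiffAt_snd.contMDiffAt
  refine ContMDiffAt.comp _ ?_ ((h1.mul h2).mul h1.inv)
  simp only [chartOne_symm_one, mul_one, inv_one]
  exact contMDiffAt_extChartAt

theorem lieAd_eq_fderiv (g : G) :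
    lieAd n g = fderiv ℝ (fun y => chartOne n G (g * (chartOne n G).symm y * g⁻¹))
      (chartOne n G 1) := by
  refine (mdifferentiableAt_conj g 1).mfderiv.trans ?_
  simp only [writtenInExtChartAt, ModelWithCorners.range_eq_univ, fderivWithin_univ]
  congr 1
  simp [Function.comp_def]

theorem lieAd_chartOne_symm_apply (Y : LieAlg n G) :
    ∀ᶠ x in 𝓝 (chartOne n G 1), lieAd n ((chartOne n G).symm x) Y =
      fderiv ℝ (chartConj n G) (x, chartOne n G 1) (0, Y) := by
  have tl : Tendsto (fun x => (x, chartOne n G 1)) (𝓝 (chartOne n G 1))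
    (𝓝 (chartOne n G 1, chartOne n G 1)) :=
    (Continuous.prodMk_left (chartOne n G 1)).continuousAt
  filter_upwards [tl.eventually (((contDiffAt_chartConj n G).of_le (m := 1) (by simp)).eventually (by simp))] with x hx
  rw [lieAd_eq_fderiv]
  have e1 : HasFDerivAt (fun y => chartConj n G (x, y)) _ (chartOne n G 1) :=
    (hx.differentiableAt (by simp)).hasFDerivAt.comp _ (hasFDerivAt_prodMk_right x _)
  have := e1.fderiv
  simp only [chartConj] at this
  rw [this]
  simp
  rfl

/-- A left-invariant field is the derivative of multiplication in its second variable; in this form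
its Lie bracket is computable in the chart. -/
theorem mpullbackWithin_chartOne_symm (X : LieAlg n G) :
    ∀ᶠ x in 𝓝 (chartOne n G 1), VectorField.mpullbackWithin 𝓘(ℝ, EuclideanSpace ℝ (Fin n)) (𝓡 n)
      (chartOne n G).symm (mulInvariantVectorField (I := 𝓡 n) X) (range (𝓡 n)) x =
      fderiv ℝ (chartMul n G) (x, chartOne n G 1) (0, X) := by
  have tl : Tendsto (fun x => (x, chartOne n G 1)) (𝓝 (chartOne n G 1))
    (𝓝 (chartOne n G 1, chartOne n G 1)) :=
    (Continuous.prodMk_left (chartOne n G 1)).continuousAt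
  filter_upwards [tl.eventually (((contDiffAt_chartMul n G).of_le (m := 1) (by simp)).eventually (by simp)),
    eventually_chartOne_target n G] with x hx hxt
  have hx1 : (chartOne n G).symm x ∈ (chartOne n G).source := (chartOne n G).map_target hxt
  rw [VectorField.mpullbackWithin_apply, ContinuousLinearMap.inverse_eq
    (mfderivWithin_extChartAt_symm_comp_mfderiv_extChartAt hxt)
    (mfderiv_extChartAt_comp_mfderivWithin_extChartAt_symm hxt)]
  have e1 : HasFDerivAt (fun y => chartMul n G (x, y)) _ (chartOne n G 1) :=
    (hx.differentiableAt (by simp)).hasFDerivAt.comp _ (hasFDerivAt_prodMk_right x _)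
  have e2 := e1.fderiv
  simp only [chartMul] at e2
  have hd : MDifferentiableAt (𝓡 n) 𝓘(ℝ, EuclideanSpace ℝ (Fin n)) (chartOne n G)
      ((chartOne n G).symm x * 1) := by
    rw [mul_one]; exact mdifferentiableAt_extChartAt (by simpa using hx1)
  have e3 := mfderiv_comp (I := 𝓡 n) (I' := 𝓡 n) (I'' := 𝓘(ℝ, EuclideanSpace ℝ (Fin n))) (1 : G)
    hd (mdifferentiableAt_leftMul ((chartOne n G).symm x) 1)
  replace e3 := (hd.comp _ (mdifferentiableAt_leftMul _ 1)).mfderiv.symm.trans e3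
  simp only [writtenInExtChartAt, ModelWithCorners.range_eq_univ, fderivWithin_univ] at e3
  simp only [Function.comp_def, extChartAt_model_space_eq_id, PartialEquiv.refl_coe, id] at e3
  rw [e2, mul_one] at e3
  have := DFunLike.congr_fun (F := EuclideanSpace ℝ (Fin n) →L[ℝ] EuclideanSpace ℝ (Fin n)) e3 X
  exact this.symm

theorem bracket_eq_fderiv_sub (X Y : LieAlg n G) :
    (⁅X, Y⁆ : LieAlg n G) =
      (fderiv ℝ (fun x => fderiv ℝ (chartMul n G) (x, chartOne n G 1) (0, Y)) (chartOne n G 1) X -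
        fderiv ℝ (fun x => fderiv ℝ (chartMul n G) (x, chartOne n G 1) (0, X))
          (chartOne n G 1) Y : EuclideanSpace ℝ (Fin n)) := by
  have hX := mpullbackWithin_chartOne_symm X
  have hY := mpullbackWithin_chartOne_symm Y
  have e : ∀ Z : LieAlg n G,
      fderiv ℝ (chartMul n G) (chartOne n G 1, chartOne n G 1) (0, Z) = Z := by
    intro Z
    have e1 : HasFDerivAt (fun y => chartMul n G (chartOne n G 1, y)) _ (chartOne n G 1) :=
      ((contDiffAt_chartMul n G).differentiableAt (by simp)).hasFDerivAt.comp _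
        (hasFDerivAt_prodMk_right (chartOne n G 1) (chartOne n G 1))
    have e2 : (fun y => chartMul n G (chartOne n G 1, y)) =ᶠ[𝓝 (chartOne n G 1)] id := by
      filter_upwards [eventually_chartOne_target n G] with y hy
      simp only [chartMul, chartOne_symm_one, one_mul, (chartOne n G).right_inv hy, id]
    have := (e1.congr_of_eventuallyEq e2.symm).unique (hasFDerivAt_id _)
    exact DFunLike.congr_fun
      (F := EuclideanSpace ℝ (Fin n) →L[ℝ] EuclideanSpace ℝ (Fin n)) this Z
  have hid : (mfderiv (𝓡 n) 𝓘(ℝ, EuclideanSpace ℝ (Fin n)) (extChartAt (𝓡 n) (1 : G)) 1).inverse =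
      ContinuousLinearMap.id ℝ (EuclideanSpace ℝ (Fin n)) := by
    rw [mfderiv_extChartAt_self]
    exact ContinuousLinearMap.inverse_id
  rw [GroupLieAlgebra.bracket_def, VectorField.mlieBracket, VectorField.mlieBracketWithin_apply]
  refine (DFunLike.congr_fun (F := EuclideanSpace ℝ (Fin n) →L[ℝ] EuclideanSpace ℝ (Fin n))
    hid _).trans ?_
  simp only [ModelWithCorners.range_eq_univ, preimage_univ, univ_inter] at hX hY ⊢
  rw [ContinuousLinearMap.id_apply]
  refine (EventuallyEq.lieBracketWithin_vectorField_eq_nhds hX hY).trans ?_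
  rw [VectorField.lieBracketWithin_univ, VectorField.lieBracket_eq]
  simp only [e]

theorem fderiv_chartConj_eq_bracket (X Y : LieAlg n G) :
    fderiv ℝ (fun x => fderiv ℝ (chartConj n G) (x, chartOne n G 1) (0, Y)) (chartOne n G 1) X =
      (⁅X, Y⁆ : LieAlg n G) := by
  rw [bracket_eq_fderiv_sub]
  have ht := eventually_chartOne_target n G
  have hs := chartOne_symm_one n G
  have hsrc : (chartOne n G).source ∈ 𝓝 (1 : G) := extChartAt_source_mem_nhds 1
  have hcont : ContinuousAt (fun p : EuclideanSpace ℝ (Fin n) × EuclideanSpace ℝ (Fin n) =>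
      (chartOne n G).symm p.1 * (chartOne n G).symm p.2 * ((chartOne n G).symm p.1)⁻¹)
      (chartOne n G 1, chartOne n G 1) := by
    have := lieGroup_isTopologicalGroup n G
    have h := (contMDiffAt_chartOne_symm n G).continuousAt
    have h1 := ContinuousAt.comp (x := (chartOne n G 1, chartOne n G 1)) h continuousAt_fst
    have h2 := ContinuousAt.comp (x := (chartOne n G 1, chartOne n G 1)) h continuousAt_snd
    exact (h1.mul h2).mul h1.inv
  refine fderiv_conj_eq ((contDiffAt_chartMul n G).of_le ENat.LEInfty.out)
    ((contDiffAt_chartConj n G).of_le ENat.LEInfty.out) ?_ ?_ ?_ ?_ X Y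
  · filter_upwards [ht] with x hx
    simp only [chartMul, hs, mul_one, (chartOne n G).right_inv hx]
  · filter_upwards [ht] with x hx
    simp only [chartConj, hs, one_mul, inv_one, mul_one, (chartOne n G).right_inv hx]
  · exact Eventually.of_forall fun x => by simp only [chartConj, hs, mul_one, mul_inv_cancel]
  · have h1 := hcont.eventually (p := fun g => g ∈ (chartOne n G).source) (by simp only [hs, mul_one, inv_one]; exact hsrc)
    filter_upwards [h1] with p hp
    simp only [chartMul, chartConj, (chartOne n G).left_inv hp, inv_mul_cancel_right]

end AdjointChart

/-! ### Linear equations with constant coefficients -/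

section LinearODE

variable {V : Type*} [NormedAddCommGroup V] [NormedSpace ℝ V] [CompleteSpace V]

theorem eq_exp_smul_apply_of_hasDerivAt (A : V →L[ℝ] V) {y : ℝ → V}
    (h : ∀ t, HasDerivAt y (A (y t)) t) (t : ℝ) : y t = NormedSpace.exp (t • A) (y 0) := by
  have h1 : ∀ t : ℝ, HasDerivAt (fun t : ℝ => NormedSpace.exp (t • (-A)) (y t)) 0 t := by
    intro t
    have := (hasDerivAt_exp_smul_const (-A) t).clm_apply (h t)
    convert! this using 1
    simp
  have h2 : NormedSpace.exp (t • (-A)) (y t) = y 0 := by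
    have := is_const_of_deriv_eq_zero (fun t => (h1 t).differentiableAt) (fun t => (h1 t).deriv) t 0
    simpa using this
  let _ : NormedAlgebra ℚ (V →L[ℝ] V) := NormedAlgebra.restrictScalars ℚ ℝ (V →L[ℝ] V)
  have h3 : NormedSpace.exp (t • A) * NormedSpace.exp (t • (-A)) = 1 := by
    rw [smul_neg, ← NormedSpace.exp_add_of_commute (Commute.neg_right (Commute.refl _))]
    simp
  rw [← h2]
  exact (DFunLike.congr_fun h3 (y t)).symm

end LinearODE

/-! ### The adjoint representation and its derivative -/

section Adjoint

variable {n : ℕ} {G : Type*} [TopologicalSpace G] [ChartedSpace (EuclideanSpace ℝ (Fin n)) G]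
  [Group G] [LieGroup (𝓡 n) ∞ G]

theorem lieAd_mul_apply (g h : G) (X : LieAlg n G) :
    lieAd n (g * h) X = lieAd n g (lieAd n h X) := by
  have e : (fun x : G => g * h * x * (g * h)⁻¹) =
      (fun x : G => g * x * g⁻¹) ∘ (fun x : G => h * x * h⁻¹) := by
    ext x; simp [mul_assoc]
  have h1 : MDifferentiableAt (𝓡 n) (𝓡 n) (fun x : G => g * x * g⁻¹) (h * 1 * h⁻¹) :=
    mdifferentiableAt_conj _ _
  have h2 := mfderiv_comp (I := 𝓡 n) (I' := 𝓡 n) (I'' := 𝓡 n) (1 : G) h1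
    (mdifferentiableAt_conj h 1)
  rw [mul_one, mul_inv_cancel] at h2
  unfold lieAd
  rw [e, h2]
  rfl

omit [LieGroup (𝓡 n) ∞ G] in
@[simp]
theorem lieAd_one_apply (X : LieAlg n G) : lieAd n (1 : G) X = X := by
  have e : (fun x : G => (1 : G) * x * (1 : G)⁻¹) = id := by ext; simp
  unfold lieAd
  rw [e, mfderiv_id]
  rfl

omit [LieGroup (𝓡 n) ∞ G] in
theorem mulInvariantVectorField_one_apply (X : LieAlg n G) :
    mulInvariantVectorField (I := 𝓡 n) X (1 : G) = X := by
  have e : (fun x : G => (1 : G) * x) = id := by ext; simp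
  unfold mulInvariantVectorField
  rw [e, mfderiv_id]
  rfl

theorem lieAd_inv_apply_self (g : G) (X : LieAlg n G) : lieAd n g⁻¹ (lieAd n g X) = X := by
  rw [← lieAd_mul_apply, inv_mul_cancel, lieAd_one_apply]

theorem lieAd_apply_inv_self (g : G) (X : LieAlg n G) : lieAd n g (lieAd n g⁻¹ X) = X := by
  rw [← lieAd_mul_apply, mul_inv_cancel, lieAd_one_apply]

theorem eventually_lieAd_apply (Y : LieAlg n G) :
    ∀ᶠ g in 𝓝 (1 : G), lieAd n g Y =
      fderiv ℝ (chartConj n G) (chartOne n G g, chartOne n G 1) (0, Y) := by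
  have hc : ContinuousAt (chartOne n G) (1 : G) := continuousAt_extChartAt 1
  filter_upwards [hc.eventually (lieAd_chartOne_symm_apply (n := n) (G := G) Y),
    extChartAt_source_mem_nhds (I := 𝓡 n) (1 : G)] with g h1 h2
  rwa [(chartOne n G).left_inv h2] at h1

theorem hasFDerivAt_fderiv_chartConj (Y : LieAlg n G) :
    DifferentiableAt ℝ (fun x => fderiv ℝ (chartConj n G) (x, chartOne n G 1)
      ((0, Y) : EuclideanSpace ℝ (Fin n) × EuclideanSpace ℝ (Fin n))) (chartOne n G 1) :=
  (hasFDerivAt_fderiv_apply_comp (j := fun x => (x, chartOne n G 1))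
    ((contDiffAt_chartConj n G).of_le ENat.LEInfty.out)
    (hasFDerivAt_prodMk_left (chartOne n G 1) (chartOne n G 1)) _).differentiableAt

/-- Continuity at `1` is visible in the chart; multiplicativity of `Ad` transports it to every
point. -/
theorem continuous_lieAd_apply (Y : LieAlg n G) : Continuous (fun g : G => lieAd n g Y) := by
  have : IsTopologicalGroup G := lieGroup_isTopologicalGroup n G
  have h1 : ∀ Y : LieAlg n G, ContinuousAt (fun g : G => lieAd n g Y) 1 := by
    intro Y
    have h2 := (hasFDerivAt_fderiv_chartConj (n := n) (G := G) Y).continuousAt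
    have h3 : ContinuousAt (chartOne n G) (1 : G) := continuousAt_extChartAt 1
    have h4 : ContinuousAt (fun g : G => fderiv ℝ (chartConj n G) (chartOne n G g, chartOne n G 1)
      ((0, Y) : EuclideanSpace ℝ (Fin n) × EuclideanSpace ℝ (Fin n))) 1 :=
      ContinuousAt.comp (f := chartOne n G) h2 h3
    exact h4.congr (EventuallyEq.symm (eventually_lieAd_apply Y))
  refine continuous_iff_continuousAt.2 fun g => ?_
  have e : (fun h : G => lieAd n h Y) = (fun Z => lieAd n g Z) ∘ (fun k => lieAd n k Y) ∘
      (fun h => g⁻¹ * h) := by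
    ext1 h
    simp [← lieAd_mul_apply]
  rw [e]
  refine ContinuousAt.comp (lieAd n g).continuous.continuousAt (ContinuousAt.comp ?_
    (continuous_const_mul g⁻¹).continuousAt)
  rw [inv_mul_cancel]
  exact h1 Y

variable [T2Space G]

theorem hasDerivAt_chartOne_lieExp (X : LieAlg n G) :
    HasDerivAt (F := EuclideanSpace ℝ (Fin n))
      (fun t : ℝ => chartOne n G (lieExp (t • X))) X 0 := by
  have e1 := isMIntegralCurve_lieExp (n := n) (G := G) X 0
  have e2 : HasMFDerivAt (𝓡 n) 𝓘(ℝ, EuclideanSpace ℝ (Fin n)) (chartOne n G)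
      (lieExp ((0 : ℝ) • X) : G) (mfderiv (𝓡 n) 𝓘(ℝ, EuclideanSpace ℝ (Fin n))
        (chartOne n G) (lieExp ((0 : ℝ) • X) : G)) := by
    refine MDifferentiableAt.hasMFDerivAt ?_
    rw [zero_smul, lieExp_zero]
    exact mdifferentiableAt_extChartAt (by simp)
  have e3 := (HasMFDerivAt.comp (f := fun t : ℝ => (lieExp (t • X) : G)) 0 e2 e1).hasFDerivAt
  have e4 : ∀ g : G, g = 1 → mfderiv (𝓡 n) 𝓘(ℝ, EuclideanSpace ℝ (Fin n))
      (chartOne n G) g (mulInvariantVectorField (I := 𝓡 n) X g) =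
      (X : EuclideanSpace ℝ (Fin n)) := by
    rintro g rfl
    rw [mfderiv_extChartAt_self]
    exact mulInvariantVectorField_one_apply X
  let L : ℝ →L[ℝ] EuclideanSpace ℝ (Fin n) :=
    (mfderiv (𝓡 n) 𝓘(ℝ, EuclideanSpace ℝ (Fin n)) (chartOne n G)
      (lieExp ((0 : ℝ) • X) : G)).comp ((1 : ℝ →L[ℝ] ℝ).smulRight
        (mulInvariantVectorField (I := 𝓡 n) X (lieExp ((0 : ℝ) • X) : G)))
  have e5 : HasFDerivAt (fun t : ℝ => chartOne n G (lieExp (t • X))) L 0 := e3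
  refine e5.hasDerivAt.congr_deriv (Eq.trans ?_ (e4 (lieExp ((0 : ℝ) • X)) (by simp)))
  exact congrArg (mfderiv (𝓡 n) 𝓘(ℝ, EuclideanSpace ℝ (Fin n)) (chartOne n G)
    (lieExp ((0 : ℝ) • X) : G)) (one_smul ℝ _)

theorem hasDerivAt_lieAd_lieExp_zero (X Y : LieAlg n G) :
    HasDerivAt (F := EuclideanSpace ℝ (Fin n))
      (fun t : ℝ => lieAd n (lieExp (t • X) : G) Y) (⁅X, Y⁆ : LieAlg n G) 0 := by
  have hc := continuous_lieExp_smul (n := n) (G := G) X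
  have h0 : Tendsto (fun t : ℝ => lieExp (t • X) : ℝ → G) (𝓝 0) (𝓝 1) := by
    simpa using hc.tendsto 0
  have h1 := h0.eventually (eventually_lieAd_apply Y)
  have h2 := hasDerivAt_chartOne_lieExp (n := n) (G := G) X
  set Φ := fun x => fderiv ℝ (chartConj n G) (x, chartOne n G 1)
      ((0, Y) : EuclideanSpace ℝ (Fin n) × EuclideanSpace ℝ (Fin n)) with hΦ
  have h3 : HasFDerivAt Φ (fderiv ℝ Φ (chartOne n G 1)) (chartOne n G 1) :=
    (hasFDerivAt_fderiv_chartConj (n := n) (G := G) Y).hasFDerivAt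
  have e0 : chartOne n G (lieExp ((0 : ℝ) • X)) = chartOne n G 1 := by simp
  have h4 : HasFDerivAt Φ (fderiv ℝ Φ (chartOne n G 1)) (chartOne n G (lieExp ((0 : ℝ) • X))) := by
    rw [e0]; exact h3
  have h5 := HasFDerivAt.comp_hasDerivAt (f := fun t : ℝ => chartOne n G (lieExp (t • X)))
    (0 : ℝ) h4 h2
  exact (h5.congr_of_eventuallyEq h1).congr_deriv (fderiv_chartConj_eq_bracket X Y)

theorem hasDerivAt_lieAd_lieExp (X Y : LieAlg n G) (t : ℝ) :
    HasDerivAt (F := EuclideanSpace ℝ (Fin n))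
      (fun t : ℝ => lieAd n (lieExp (t • X) : G) Y)
      (⁅X, lieAd n (lieExp (t • X) : G) Y⁆ : LieAlg n G) t := by
  have h := hasDerivAt_lieAd_lieExp_zero X (lieAd n (lieExp (t • X) : G) Y)
  have h1 : HasDerivAt (fun s : ℝ => s - t) 1 t := (hasDerivAt_id t).sub_const t
  rw [← sub_self t] at h
  have h2 := HasDerivAt.scomp (h := fun s : ℝ => s - t) t h h1
  have e : (fun s : ℝ => lieAd n (lieExp (s • X) : G) Y) =
      (fun s : ℝ => lieAd n (lieExp (s • X) : G) (lieAd n (lieExp (t • X) : G) Y)) ∘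
        fun s => s - t := by
    ext1 s
    simp only [Function.comp]
    rw [← lieAd_mul_apply, ← lieExp_add_smul, sub_add_cancel]
  rw [e]
  exact h2.congr_deriv (one_smul ℝ _)

/-- Obtained by differentiating `Ad(exp(t Ad(g) X)) Ad(g) = Ad(g) Ad(exp tX)` at `t = 0`. -/
theorem lieAd_lie (g : G) (X Y : LieAlg n G) :
    lieAd n g ⁅X, Y⁆ = ⁅lieAd n g X, lieAd n g Y⁆ := by
  have h1 := (lieAd n g).hasFDerivAt (x := lieAd n (lieExp ((0 : ℝ) • X) : G) Y)
  have h2 := HasFDerivAt.comp_hasDerivAt (E := EuclideanSpace ℝ (Fin n))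
    (F := EuclideanSpace ℝ (Fin n)) (0 : ℝ) h1 (hasDerivAt_lieAd_lieExp_zero X Y)
  have h3 := hasDerivAt_lieAd_lieExp_zero (lieAd n g X) (lieAd n g Y)
  have e : (fun t : ℝ => lieAd n (lieExp (t • lieAd n g X) : G) (lieAd n g Y)) =
      lieAd n g ∘ fun t : ℝ => lieAd n (lieExp (t • X) : G) Y := by
    ext1 t
    simp only [Function.comp]
    rw [← map_smul, ← conj_lieExp, ← lieAd_mul_apply, ← lieAd_mul_apply, inv_mul_cancel_right]
  rw [e] at h3
  exact HasDerivAt.unique (F := EuclideanSpace ℝ (Fin n)) h2 h3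

end Adjoint

/-! ### Negative definiteness of the Killing form from an invariant inner product -/

section KillingNegative

variable {L : Type*} [LieRing L] [LieAlgebra ℝ L] [Module.Finite ℝ L]

omit [Module.Finite ℝ L] in
theorem bilin_apply_basis {B : LinearMap.BilinForm ℝ L} {ι : Type*} [Fintype ι]
    (v : Module.Basis ι ℝ L) (hv : LinearMap.BilinForm.iIsOrtho B v) (i : ι) (y : L) :
    B (v i) y = v.repr y i * B (v i) (v i) := by
  classical
  conv_lhs => rw [← v.sum_repr y]
  rw [map_sum, Finset.sum_eq_single i]
  · simp
  · intro j _ hj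
    rw [map_smul, (LinearMap.BilinForm.iIsOrtho_def).1 hv i j hj.symm, smul_zero]
  · simp

/-- Since `ad x` is skew for `B`, the trace of its square is minus a sum of normalized squares of
the `[x, v i]` over an orthogonal basis. It vanishes only for central `x`. -/
theorem killingForm_neg_of_invariant (B : LinearMap.BilinForm ℝ L) (hs : LinearMap.IsSymm B)
    (hpos : ∀ x, x ≠ 0 → 0 < B x x) (hB : ∀ x y z : L, B ⁅x, y⁆ z = -B y ⁅x, z⁆)
    (hc : ∀ x : L, (∀ y : L, ⁅x, y⁆ = 0) → x = 0) (x : L) (hx : x ≠ 0) :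
    killingForm ℝ L x x < 0 := by
  obtain ⟨v, hv⟩ := LinearMap.BilinForm.exists_orthogonal_basis hs
  have hvp : ∀ i, 0 < B (v i) (v i) := fun i => hpos _ (v.ne_zero i)
  have e : ∀ i, v.repr ⁅x, ⁅x, v i⁆⁆ i = -(B ⁅x, v i⁆ ⁅x, v i⁆ / B (v i) (v i)) := by
    intro i
    have h1 := bilin_apply_basis v hv i ⁅x, ⁅x, v i⁆⁆
    have h2 := hB x (v i) ⁅x, v i⁆
    rw [← neg_eq_iff_eq_neg.2 h2.symm.symm] at h1
    · field_simp [(hvp i).ne']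
      linarith
  have ht : killingForm ℝ L x x = -∑ i, B ⁅x, v i⁆ ⁅x, v i⁆ / B (v i) (v i) := by
    classical
    rw [killingForm_apply_apply, LinearMap.trace_eq_matrix_trace ℝ v, Matrix.trace,
      ← Finset.sum_neg_distrib]
    refine Finset.sum_congr rfl fun i _ => ?_
    rw [Matrix.diag_apply, LinearMap.toMatrix_apply, ← e]
    simp
  have hnn : ∀ i, 0 ≤ B ⁅x, v i⁆ ⁅x, v i⁆ / B (v i) (v i) := by
    intro i
    refine div_nonneg ?_ (hvp i).le
    by_cases h : ⁅x, v i⁆ = 0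
    · simp [h]
    · exact (hpos _ h).le
  rw [ht, neg_lt_zero]
  refine lt_of_le_of_ne (Finset.sum_nonneg fun i _ => hnn i) fun h0 => hx (hc x ?_)
  rw [eq_comm, Finset.sum_eq_zero_iff_of_nonneg fun i _ => hnn i] at h0
  have h3 : ∀ i, ⁅x, v i⁆ = 0 := by
    intro i
    by_contra h
    have := h0 i (Finset.mem_univ i)
    rw [div_eq_zero_iff] at this
    rcases this with h | h'
    · exact (hpos _ ‹_›).ne' h
    · exact (hvp i).ne' h'
  have h4 : LieAlgebra.ad ℝ L x = 0 := v.ext fun i => by simp [h3]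
  intro y
  exact congrArg (fun f => f y) h4

end KillingNegative

/-! ### Averaging over a compact group -/

section InvariantForm

variable {n : ℕ} {G : Type*} [TopologicalSpace G] [ChartedSpace (EuclideanSpace ℝ (Fin n)) G]
  [Group G] [LieGroup (𝓡 n) ∞ G]

instance lieAlg_moduleFinite : Module.Finite ℝ (LieAlg n G) :=
  inferInstanceAs (Module.Finite ℝ (EuclideanSpace ℝ (Fin n)))

open MeasureTheory in
theorem exists_lieAd_invariant_form [T2Space G] [CompactSpace G] :
    ∃ B : LinearMap.BilinForm ℝ (LieAlg n G), LinearMap.IsSymm B ∧ (∀ x, x ≠ 0 → 0 < B x x) ∧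
      ∀ (g : G) (x y : LieAlg n G), B (lieAd n g x) (lieAd n g y) = B x y := by
  have : IsTopologicalGroup G := lieGroup_isTopologicalGroup n G
  let _ : MeasurableSpace G := borel G
  have : BorelSpace G := ⟨rfl⟩
  let μ : Measure G := Measure.haar
  -- The inverses turn the action of `Ad g` into a left translation of the integrand, so left
  -- invariance of Haar measure suffices.
  let f (x y : LieAlg n G) (g : G) : ℝ :=
    @inner ℝ (EuclideanSpace ℝ (Fin n)) _ (lieAd n g⁻¹ x) (lieAd n g⁻¹ y)
  have hf : ∀ x y, Continuous (f x y) := fun x y =>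
    Continuous.inner (E := EuclideanSpace ℝ (Fin n)) ((continuous_lieAd_apply x).comp continuous_inv)
      ((continuous_lieAd_apply y).comp continuous_inv)
  have hfi : ∀ x y, Integrable (f x y) μ := fun x y =>
    (hf x y).integrable_of_hasCompactSupport (HasCompactSupport.of_compactSpace _)
  have f1 : ∀ x x' y g, f (x + x') y g = f x y g + f x' y g := by
    intro x x' y g
    simp only [f, map_add]
    exact inner_add_left (E := EuclideanSpace ℝ (Fin n)) _ _ _
  have f2 : ∀ (c : ℝ) x y g, f (c • x) y g = c * f x y g := by
    intro c x y g
    simp only [f, map_smul]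
    exact real_inner_smul_left (F := EuclideanSpace ℝ (Fin n)) _ _ _
  have f3 : ∀ x y g, f x y g = f y x g := by
    intro x y g
    exact real_inner_comm (F := EuclideanSpace ℝ (Fin n)) _ _
  let B : LinearMap.BilinForm ℝ (LieAlg n G) := LinearMap.mk₂ ℝ (fun x y => ∫ g, f x y g ∂μ)
    (by intro x x' y; simp only [f1]; exact integral_add (hfi x y) (hfi x' y))
    (by intro c x y; simp only [f2]; exact integral_const_mul _ _)
    (by intro x y y'; simp only [f3 x, f1]; exact integral_add (hfi y x) (hfi y' x))
    (by intro c x y; simp only [f3 x, f2]; exact integral_const_mul _ _)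
  have hB : ∀ x y, B x y = ∫ g, f x y g ∂μ := fun x y => rfl
  refine ⟨B, ⟨fun x y => ?_⟩, fun x hx => ?_, fun g x y => ?_⟩
  · simp [hB, f3 x y]
  · rw [hB]
    refine (hf x x).integral_pos_of_hasCompactSupport_nonneg_nonzero
      (HasCompactSupport.of_compactSpace _)
      (fun g => real_inner_self_nonneg (F := EuclideanSpace ℝ (Fin n))) (x := 1) ?_
    simp only [f, inv_one, lieAd_one_apply]
    exact (inner_self_ne_zero (𝕜 := ℝ) (E := EuclideanSpace ℝ (Fin n))).2 hx
  · rw [hB, hB, ← integral_mul_left_eq_self (fun h => f x y h) g⁻¹]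
    refine integral_congr_ae (ae_of_all _ fun h => ?_)
    simp [f, lieAd_mul_apply]

theorem bilin_lie_eq_neg_of_lieAd_invariant [T2Space G] (B : LinearMap.BilinForm ℝ (LieAlg n G))
    (hB : ∀ (g : G) (x y : LieAlg n G), B (lieAd n g x) (lieAd n g y) = B x y)
    (x y z : LieAlg n G) : B ⁅x, y⁆ z = -B y ⁅x, z⁆ := by
  let V := EuclideanSpace ℝ (Fin n)
  let B' : V →ₗ[ℝ] V →ₗ[ℝ] ℝ := B
  let B'' : V →L[ℝ] V →L[ℝ] ℝ :=
    LinearMap.toContinuousLinearMap (LinearMap.toContinuousLinearMap.toLinearMap ∘ₗ B')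
  have h1 := hasDerivAt_lieAd_lieExp_zero x y
  have h2 := hasDerivAt_lieAd_lieExp_zero x z
  have h3 := (B''.hasFDerivAt.comp_hasDerivAt (0 : ℝ) h1).clm_apply h2
  have h4 : HasDerivAt (fun t : ℝ => B y z) 0 0 := hasDerivAt_const _ _
  have h5 := h3.unique (h4.congr_of_eventuallyEq (Eventually.of_forall fun t => hB _ y z))
  simp only [Function.comp, zero_smul, lieExp_zero, lieAd_one_apply] at h5
  exact eq_neg_of_add_eq_zero_left h5

theorem killingForm_lieAlg_neg [T2Space G] [CompactSpace G]
    [LieAlgebra.IsSemisimple ℝ (LieAlg n G)] (x : LieAlg n G) (hx : x ≠ 0) :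
    killingForm ℝ (LieAlg n G) x x < 0 := by
  obtain ⟨B, h1, h2, h3⟩ := exists_lieAd_invariant_form (n := n) (G := G)
  refine killingForm_neg_of_invariant B h1 h2 (bilin_lie_eq_neg_of_lieAd_invariant B h3)
    (fun x hx => ?_) x hx
  have := LieAlgebra.center_eq_bot ℝ (LieAlg n G)
  have hm : x ∈ LieAlgebra.center ℝ (LieAlg n G) := by
    rw [LieModule.mem_maxTrivSubmodule]
    intro y
    rw [← lie_skew, hx, neg_zero]
  rw [this] at hm
  simpa using hm

end InvariantForm

/-! ### Compact commutative groups of operators -/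

section CompactCommutative

variable {V : Type*} [NormedAddCommGroup V] [NormedSpace ℝ V] [FiniteDimensional ℝ V]

theorem commute_of_forall_commute_exp {A : V →L[ℝ] V} {B : V →L[ℝ] V}
    (h : ∀ s : ℝ, Commute (NormedSpace.exp (s • B)) A) : Commute B A := by
  have h1 : HasDerivAt (fun s : ℝ => NormedSpace.exp (s • B)) B 0 := by
    simpa using hasDerivAt_exp_smul_const B (0 : ℝ)
  have h2 := (h1.mul_const A).unique
    ((h1.const_mul A).congr_of_eventuallyEq (Eventually.of_forall fun s => h s))
  exact h2

theorem hasDerivAt_exp_smul_apply_zero (A : V →L[ℝ] V) (x : V) :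
    HasDerivAt (fun t : ℝ => NormedSpace.exp (t • A) x) (A x) 0 := by
  have h1 : HasDerivAt (fun s : ℝ => NormedSpace.exp (s • A)) A 0 := by
    simpa using hasDerivAt_exp_smul_const A (0 : ℝ)
  simpa using h1.clm_apply (hasDerivAt_const (0 : ℝ) x)

omit [FiniteDimensional ℝ V] in
theorem exp_smul_zero_apply (A : V →L[ℝ] V) (x : V) : NormedSpace.exp ((0 : ℝ) • A) x = x := by
  simp

theorem exp_apply_eq_self {A : V →L[ℝ] V} {x : V} (h : A x = 0) :
    NormedSpace.exp A x = x := by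
  have := eq_exp_smul_apply_of_hasDerivAt A (y := fun _ => x)
    (fun t => by rw [h]; exact hasDerivAt_const _ _) 1
  simpa using this.symm

/-- The integer multiples `⌊t / ‖u j‖⌋₊ • u j` converge to `t • U`, and their exponentials are
powers of elements of the closed set `K`. -/
theorem exp_mem_of_tendsto {K : Set (V →L[ℝ] V)} (hK : IsClosed K) (h1 : 1 ∈ K)
    (hmul : ∀ a ∈ K, ∀ b ∈ K, a * b ∈ K) {u : ℕ → V →L[ℝ] V} {U : V →L[ℝ] V}
    (hu0 : Tendsto u atTop (𝓝 0)) (hu : ∀ j, u j ≠ 0)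
    (huK : ∀ j, NormedSpace.exp (u j) ∈ K)
    (hU : Tendsto (fun j => ‖u j‖⁻¹ • u j) atTop (𝓝 U)) (t : ℝ) (ht : 0 ≤ t) :
    NormedSpace.exp (t • U) ∈ K := by
  let _ : NormedAlgebra ℚ (V →L[ℝ] V) := NormedAlgebra.restrictScalars ℚ ℝ (V →L[ℝ] V)
  have hpow : ∀ (a) (m : ℕ), a ∈ K → a ^ m ∈ K := by
    intro a m ha
    induction m with
    | zero => simpa using h1
    | succ m ih => rw [pow_succ]; exact hmul _ ih _ ha
  have hn : Tendsto (fun j => ‖u j‖) atTop (𝓝 0) := by simpa using hu0.norm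
  have hfl : Tendsto (fun j => (⌊t / ‖u j‖⌋₊ : ℝ) * ‖u j‖) atTop (𝓝 t) := by
    refine tendsto_of_tendsto_of_tendsto_of_le_of_le (g := fun j => t - ‖u j‖) (h := fun _ => t)
      (by simpa using hn.const_sub t) tendsto_const_nhds (fun j => ?_) (fun j => ?_)
    · have hp : 0 < ‖u j‖ := norm_pos_iff.2 (hu j)
      have := (Nat.lt_floor_add_one (t / ‖u j‖)).le
      rw [div_le_iff₀ hp] at this
      simp only
      linarith
    · have hp : 0 < ‖u j‖ := norm_pos_iff.2 (hu j)
      have := Nat.floor_le (div_nonneg ht hp.le)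
      rwa [le_div_iff₀ hp] at this
  have hlim : Tendsto (fun j => ⌊t / ‖u j‖⌋₊ • u j) atTop (𝓝 (t • U)) := by
    have := hfl.smul hU
    refine this.congr fun j => ?_
    have hp : ‖u j‖ ≠ 0 := norm_ne_zero_iff.2 (hu j)
    rw [smul_smul, mul_assoc, mul_inv_cancel₀ hp, mul_one, Nat.cast_smul_eq_nsmul]
  have hexp := (NormedSpace.exp_continuous.tendsto _).comp hlim
  refine hK.mem_of_tendsto hexp (Eventually.of_forall fun j => ?_)
  simp only [Function.comp]
  rw [NormedSpace.exp_nsmul]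
  exact hpow _ _ (huK j)

/-- An infinitesimal form of the closed subgroup theorem: a vector killed by the Lie algebra of a
compact commutative group of operators is fixed by all group elements near the identity. -/
theorem exists_forall_norm_sub_one_lt_apply_eq {K : Set (V →L[ℝ] V)} (hK : IsCompact K)
    (h1 : 1 ∈ K) (hmul : ∀ a ∈ K, ∀ b ∈ K, a * b ∈ K)
    (hinv : ∀ a ∈ K, ∀ b, a * b = 1 → b ∈ K) (hcomm : ∀ a ∈ K, ∀ b ∈ K, a * b = b * a) (x : V)
    (hx : ∀ A : V →L[ℝ] V, (∀ t : ℝ, NormedSpace.exp (t • A) ∈ K) → A x = 0) :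
    ∃ ε > 0, ∀ k ∈ K, ‖k - 1‖ < ε → k x = x := by
  let _ : NormedAlgebra ℚ (V →L[ℝ] V) := NormedAlgebra.restrictScalars ℚ ℝ (V →L[ℝ] V)
  have hexpneg : ∀ A : V →L[ℝ] V, NormedSpace.exp A * NormedSpace.exp (-A) = 1 := by
    intro A
    rw [← NormedSpace.exp_add_of_commute (Commute.neg_right (Commute.refl _))]
    simp
  have hexpcomm : ∀ A : V →L[ℝ] V, (∀ t : ℝ, NormedSpace.exp (t • A) ∈ K) → ∀ k ∈ K,
      Commute A k := fun A hA k hk =>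
    commute_of_forall_commute_exp fun s => hcomm _ (hA s) _ hk
  -- the Lie algebra
  let 𝔨 : Submodule ℝ (V →L[ℝ] V) :=
    { carrier := {A | ∀ t : ℝ, NormedSpace.exp (t • A) ∈ K}
      add_mem' := by
        intro A B hA hB t
        have hAB : Commute A B := (commute_of_forall_commute_exp fun s =>
          (hexpcomm A hA _ (hB s)).symm).symm
        rw [smul_add, NormedSpace.exp_add_of_commute ((hAB.smul_left t).smul_right t)]
        exact hmul _ (hA t) _ (hB t)
      zero_mem' := by intro t; simpa using h1
      smul_mem' := by intro c A hA t; rw [smul_smul]; exact hA _ }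
  have h𝔨 : ∀ A, A ∈ 𝔨 ↔ ∀ t : ℝ, NormedSpace.exp (t • A) ∈ K := fun A => Iff.rfl
  -- `Q` is a linear projection onto the Lie algebra of `K`.
  obtain ⟨q, hq⟩ := 𝔨.subtype.exists_leftInverse_of_injective (by simp)
  let Q : (V →L[ℝ] V) →L[ℝ] (V →L[ℝ] V) := LinearMap.toContinuousLinearMap (𝔨.subtype ∘ₗ q)
  have hQ1 : ∀ A, Q A ∈ 𝔨 := fun A => (q A).2
  have hQ2 : ∀ A ∈ 𝔨, Q A = A := fun A hA =>
    (congrArg Subtype.val (DFunLike.congr_fun hq (⟨A, hA⟩ : 𝔨)) :)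
  -- the logarithm
  have hst : HasStrictFDerivAt (NormedSpace.exp : (V →L[ℝ] V) → (V →L[ℝ] V))
      ((ContinuousLinearEquiv.refl ℝ (V →L[ℝ] V) : (V →L[ℝ] V) ≃L[ℝ] (V →L[ℝ] V)) :
        (V →L[ℝ] V) →L[ℝ] (V →L[ℝ] V)) 0 := hasStrictFDerivAt_exp_zero
  let log := hst.localInverse
  have hlog0 : Tendsto log (𝓝 1) (𝓝 0) := by simpa using hst.localInverse_tendsto
  have hlogr : ∀ᶠ k in 𝓝 (1 : V →L[ℝ] V), NormedSpace.exp (log k) = k := by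
    simpa using hst.eventually_right_inverse
  obtain ⟨r, hr, hlogl⟩ := Metric.eventually_nhds_iff.1 hst.eventually_left_inverse
  obtain ⟨C, hC⟩ := hK.isBounded.exists_norm_le
  have hC0 : 0 ≤ C := (norm_nonneg _).trans (hC 1 h1)
  -- With this factor both `log k` and its conjugates by elements of `K`, whose norms are at most `C
  -- * C * ‖log k‖`, stay in the ball where `log` inverts `exp`.
  have hlogs : ∀ᶠ k in 𝓝 (1 : V →L[ℝ] V), ‖log k‖ * (C * C + 1) < r := by
    have : Tendsto (fun k => ‖log k‖ * (C * C + 1)) (𝓝 1) (𝓝 0) := by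
      simpa using hlog0.norm.mul_const (C * C + 1)
    exact this.eventually (gt_mem_nhds hr)
  -- the logarithm commutes with the Lie algebra
  have hlogc : ∀ᶠ k in 𝓝 (1 : V →L[ℝ] V), k ∈ K → ∀ B ∈ 𝔨, Commute B (log k) := by
    filter_upwards [hlogr, hlogs] with k h2 h3 hk B hB
    refine commute_of_forall_commute_exp fun s => ?_
    have e1 := hexpneg (s • B)
    have e2 : NormedSpace.exp (-(s • B)) * NormedSpace.exp (s • B) = 1 := by
      simpa using hexpneg (-(s • B))
    set g := NormedSpace.exp (s • B) with hg
    set g' := NormedSpace.exp (-(s • B)) with hg'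
    have hgK : g ∈ K := hB s
    have hg'K : g' ∈ K := by rw [hg', ← neg_smul]; exact hB (-s)
    let gu : (V →L[ℝ] V)ˣ := ⟨g, g', e1, e2⟩
    have e3 : NormedSpace.exp (g * log k * g') = k := by
      have := NormedSpace.exp_units_conj gu (log k)
      rw [h2] at this
      change _ = g * k * g' at this
      exact this.trans (by rw [hcomm g hgK k hk, mul_assoc, e1, mul_one])
    have e4 : dist (g * log k * g') 0 < r := by
      rw [dist_zero_right]
      refine lt_of_le_of_lt ((norm_mul_le _ _).trans (mul_le_mul_of_nonneg_right
        (norm_mul_le _ _) (norm_nonneg _))) (lt_of_le_of_lt ?_ h3)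
      have := mul_le_mul (hC g hgK) (hC g' hg'K) (norm_nonneg _) hC0
      nlinarith [norm_nonneg (log k)]
    have e5 : dist (log k) 0 < r := by
      rw [dist_zero_right]
      refine lt_of_le_of_lt ?_ h3
      nlinarith [norm_nonneg (log k), mul_nonneg hC0 hC0]
    have e6 : g * log k * g' = log k := by
      rw [← hlogl e4, e3]
    calc g * log k = g * log k * (g' * g) := by rw [e2, mul_one]
      _ = (g * log k * g') * g := by simp only [mul_assoc]
      _ = log k * g := by rw [e6]
  by_contra! hcon
  choose k hk1 hk2 hk3 using fun j : ℕ => hcon (1 / ((j : ℝ) + 1)) (by positivity)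
  have hk : Tendsto k atTop (𝓝 1) := by
    rw [tendsto_iff_norm_sub_tendsto_zero]
    exact squeeze_zero (fun _ => norm_nonneg _) (fun j => (hk2 j).le)
      tendsto_one_div_add_atTop_nhds_zero_nat
  obtain ⟨N, hN⟩ := eventually_atTop.1 ((hk.eventually hlogr).and (hk.eventually hlogc))
  -- The part of `log k` transverse to `𝔨`. The removed part commutes with `log k`, so `exp (u j)`
  -- is still in `K`; and `u j ≠ 0`, since otherwise `log k ∈ 𝔨` would kill `x` and `k` would fix
  -- it. A limit direction `U` of the `u j` is a unit vector that lies in `𝔨` and yet satisfies `Q U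
  -- = 0`, a contradiction.
  let u : ℕ → V →L[ℝ] V := fun j => log (k (j + N)) - Q (log (k (j + N)))
  have hkN : Tendsto (fun j => log (k (j + N))) atTop (𝓝 0) :=
    hlog0.comp (hk.comp (tendsto_add_atTop_nat N))
  have hu0 : Tendsto u atTop (𝓝 0) := by
    simpa using hkN.sub ((Q.continuous.tendsto 0).comp hkN)
  have huK : ∀ j, NormedSpace.exp (u j) ∈ K := by
    intro j
    obtain ⟨h2, h3⟩ := hN (j + N) (by omega)
    have h4 := h3 (hk1 _) _ (hQ1 (log (k (j + N))))
    simp only [u]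
    rw [sub_eq_add_neg, NormedSpace.exp_add_of_commute h4.symm.neg_right, h2]
    refine hmul _ (hk1 _) _ ?_
    simpa using hQ1 (log (k (j + N))) (-1)
  have hu : ∀ j, u j ≠ 0 := by
    intro j h0
    obtain ⟨h2, h3⟩ := hN (j + N) (by omega)
    refine hk3 (j + N) ?_
    rw [← h2]
    refine exp_apply_eq_self (hx _ ?_)
    rw [← h𝔨, sub_eq_zero.1 h0]
    exact hQ1 _
  obtain ⟨U, hU, φ, hφ, hφU⟩ := (isCompact_sphere (0 : V →L[ℝ] V) 1).tendsto_subseq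
    (x := fun j => ‖u j‖⁻¹ • u j) (fun j => by
      simp [norm_smul, norm_ne_zero_iff.2 (hu j)])
  have hUpos : ∀ t : ℝ, 0 ≤ t → NormedSpace.exp (t • U) ∈ K := fun t ht =>
    exp_mem_of_tendsto hK.isClosed h1 hmul (hu0.comp hφ.tendsto_atTop) (fun j => hu _)
      (fun j => huK _) hφU t ht
  have hUneg : ∀ t : ℝ, 0 ≤ t → NormedSpace.exp (t • (-U)) ∈ K := by
    refine fun t ht => exp_mem_of_tendsto (u := fun j => -u (φ j)) hK.isClosed h1 hmul
      (by simpa using (hu0.comp hφ.tendsto_atTop).neg) (fun j => neg_ne_zero.2 (hu _))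
      (fun j => ?_) (by simpa using hφU.neg) t ht
    exact hinv _ (huK (φ j)) _ (hexpneg _)
  have hU𝔨 : U ∈ 𝔨 := by
    intro t
    rcases le_total 0 t with ht | ht
    · exact hUpos t ht
    · simpa using hUneg (-t) (by linarith)
  have hQU : Q U = 0 := by
    have h2 : ∀ j, Q (‖u (φ j)‖⁻¹ • u (φ j)) = 0 := by
      intro j
      rw [map_smul]
      simp only [u, map_sub, hQ2 _ (hQ1 _), sub_self, smul_zero]
    have h3 := (Q.continuous.tendsto U).comp hφU
    exact tendsto_nhds_unique h3 (by simp [Function.comp_def, h2])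
  rw [hQ2 U hU𝔨] at hQU
  simp [hQU] at hU

end CompactCommutative

/-! ### Maximal tori and their Lie algebras -/

section Tori

variable {n : ℕ} {G : Type*} [TopologicalSpace G] [ChartedSpace (EuclideanSpace ℝ (Fin n)) G]
  [Group G] [LieGroup (𝓡 n) ∞ G] [T2Space G]

theorem eq_of_forall_lieExp_smul_eq {X Y : LieAlg n G}
    (h : ∀ s : ℝ, (lieExp (s • X) : G) = lieExp (s • Y)) : X = Y := by
  have h1 := hasDerivAt_chartOne_lieExp (n := n) (G := G) X
  have h2 := hasDerivAt_chartOne_lieExp (n := n) (G := G) Y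
  simp only [h] at h1
  exact h1.unique h2

theorem lieAd_eq_self_of_commute {g : G} {X : LieAlg n G}
    (h : ∀ s : ℝ, g * lieExp (s • X) = lieExp (s • X) * g) : lieAd n g X = X := by
  refine eq_of_forall_lieExp_smul_eq fun s => ?_
  rw [← map_smul, ← conj_lieExp, h, mul_inv_cancel_right]

theorem commute_lieExp_of_lieAd_eq_self {g : G} {X : LieAlg n G} (h : lieAd n g X = X) (s : ℝ) :
    g * lieExp (s • X) = lieExp (s • X) * g := by
  rw [← mul_inv_eq_iff_eq_mul, conj_lieExp, map_smul, h]

theorem lie_eq_zero_of_forall_lieAd_eq_self {X Y : LieAlg n G}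
    (h : ∀ s : ℝ, lieAd n (lieExp (s • X) : G) Y = Y) : ⁅X, Y⁆ = 0 := by
  have h1 := hasDerivAt_lieAd_lieExp_zero X Y
  simp only [h] at h1
  exact h1.unique (hasDerivAt_const (F := EuclideanSpace ℝ (Fin n)) _ _)

/-- The operator `ad X`, as a continuous linear map. -/
def lieAdOp (X : LieAlg n G) : EuclideanSpace ℝ (Fin n) →L[ℝ] EuclideanSpace ℝ (Fin n) :=
  LinearMap.toContinuousLinearMap
    (LieAlgebra.ad ℝ (LieAlg n G) X : EuclideanSpace ℝ (Fin n) →ₗ[ℝ] EuclideanSpace ℝ (Fin n))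

theorem lieAd_lieExp_apply (X Y : LieAlg n G) (t : ℝ) :
    lieAd n (lieExp (t • X) : G) Y = NormedSpace.exp (t • lieAdOp X) Y := by
  have := eq_exp_smul_apply_of_hasDerivAt (lieAdOp X)
    (y := fun t : ℝ => lieAd n (lieExp (t • X) : G) Y) (hasDerivAt_lieAd_lieExp X Y) t
  refine this.trans ?_
  have e : lieAd n (lieExp ((0 : ℝ) • X) : G) Y = Y := by rw [zero_smul, lieExp_zero, lieAd_one_apply]
  exact congrArg _ e

theorem lieAd_eq_self_of_mem_lieAlgebraOf {T : Subgroup G} (hT : IsTorus T) {t : G} (ht : t ∈ T)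
    {X : LieAlg n G} (hX : X ∈ lieAlgebraOf n T) : lieAd n t X = X := by
  induction hX using Submodule.span_induction with
  | mem X hX => exact lieAd_eq_self_of_commute fun s => hT.2.2 _ ht _ (hX s)
  | zero => exact map_zero _
  | add X Y _ _ hX hY => rw [map_add, hX, hY]
  | smul c X _ hX => rw [map_smul, hX]

theorem lie_eq_zero_of_mem_lieAlgebraOf {T : Subgroup G} (hT : IsTorus T) {X Y : LieAlg n G}
    (hX : X ∈ lieAlgebraOf n T) (hY : Y ∈ lieAlgebraOf n T) : ⁅X, Y⁆ = 0 := by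
  induction hX using Submodule.span_induction with
  | mem X hX =>
    exact lie_eq_zero_of_forall_lieAd_eq_self fun s => lieAd_eq_self_of_mem_lieAlgebraOf hT (hX s) hY
  | zero => exact zero_lie _
  | add X Y _ _ hX hY => rw [add_lie, hX, hY, add_zero]
  | smul c X _ hX => rw [smul_lie, hX, smul_zero]

omit [T2Space G] in
-- The closure of `T · exp(ℝY)` is compact, connected and abelian, hence a torus containing `T`;
-- maximality applies.
theorem IsMaximalTorus.mem_of_commute [T2Space G] [CompactSpace G] {T : Subgroup G}
    (hT : IsMaximalTorus T) {Y : LieAlg n G}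
    (h : ∀ s : ℝ, ∀ t ∈ T, t * lieExp (s • Y) = lieExp (s • Y) * t) (s : ℝ) :
    lieExp (s • Y) ∈ T := by
  have : IsTopologicalGroup G := lieGroup_isTopologicalGroup n G
  have hc : Continuous fun p : G × ℝ => p.1 * lieExp (p.2 • Y) :=
    continuous_fst.mul ((continuous_lieExp_smul Y).comp continuous_snd)
  let K : Subgroup G :=
    { carrier := (fun p : G × ℝ => p.1 * lieExp (p.2 • Y)) '' ((T : Set G) ×ˢ univ)
      mul_mem' := by
        rintro _ _ ⟨⟨a, r⟩, ⟨ha, -⟩, rfl⟩ ⟨⟨b, r'⟩, ⟨hb, -⟩, rfl⟩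
        refine ⟨(a * b, r + r'), ⟨T.mul_mem ha hb, mem_univ _⟩, ?_⟩
        simp only
        rw [lieExp_add_smul, mul_assoc a, ← mul_assoc b, h r b hb]
        simp only [mul_assoc]
      one_mem' := ⟨(1, 0), ⟨T.one_mem, mem_univ _⟩, by simp⟩
      inv_mem' := by
        rintro _ ⟨⟨a, r⟩, ⟨ha, -⟩, rfl⟩
        refine ⟨(a⁻¹, -r), ⟨T.inv_mem ha, mem_univ _⟩, ?_⟩
        simp only
        rw [h _ _ (T.inv_mem ha), neg_smul, lieExp_neg, mul_inv_rev] }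
  have hKc : IsConnected (K : Set G) :=
    (hT.prop.2.1.prod isConnected_univ).image _ hc.continuousOn
  have hKcomm : ∀ x ∈ K, ∀ y ∈ K, x * y = y * x := by
    rintro _ ⟨⟨a, r⟩, ⟨ha, -⟩, rfl⟩ _ ⟨⟨b, r'⟩, ⟨hb, -⟩, rfl⟩
    simp only
    calc a * lieExp (r • Y) * (b * lieExp (r' • Y))
        = a * (lieExp (r • Y) * b) * lieExp (r' • Y) := by simp only [mul_assoc]
      _ = (a * b) * (lieExp (r • Y) * lieExp (r' • Y)) := by
          rw [← h r b hb]; simp only [mul_assoc]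
      _ = (b * a) * (lieExp (r' • Y) * lieExp (r • Y)) := by
          rw [hT.prop.2.2 a ha b hb, ← lieExp_add_smul, add_comm, lieExp_add_smul]
      _ = b * (a * lieExp (r' • Y)) * lieExp (r • Y) := by simp only [mul_assoc]
      _ = b * lieExp (r' • Y) * (a * lieExp (r • Y)) := by
          rw [h r' a ha]; simp only [mul_assoc]
  have hKt : IsTorus K.topologicalClosure := by
    refine ⟨K.isClosed_topologicalClosure.isCompact, hKc.closure, fun x hx y hy => ?_⟩
    exact congrArg Subtype.val
      ((K.commGroupTopologicalClosure fun x y => Subtype.ext (hKcomm x x.2 y y.2)).mul_comm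
        ⟨x, hx⟩ ⟨y, hy⟩)
  have hTK : T ≤ K.topologicalClosure := fun t ht =>
    K.le_topologicalClosure ⟨(t, 0), ⟨ht, mem_univ _⟩, by simp⟩
  refine hT.le_of_ge hKt hTK (K.le_topologicalClosure ⟨(1, s), ⟨T.one_mem, mem_univ _⟩, by simp⟩)

variable [CompactSpace G] [LieAlgebra.IsSemisimple ℝ (LieAlg n G)]

omit [T2Space G] [CompactSpace G] in
theorem eq_zero_of_forall_lie_eq_zero {X : LieAlg n G} (h : ∀ Y : LieAlg n G, ⁅X, Y⁆ = 0) :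
    X = 0 := by
  rw [← LieDerivation.IsKilling.ad_apply_eq_zero_iff ℝ (LieAlg n G)]
  ext Y
  simpa using h Y

omit [CompactSpace G] [LieAlgebra.IsSemisimple ℝ (LieAlg n G)] in
/-- Involutions commute with the adjoint action of the analytic subgroup of the fixed points. -/
theorem aut_lieAd_of_mem_analyticSubgroup (θ : LieAlg n G ≃ₗ⁅ℝ⁆ LieAlg n G) {h : G}
    (hh : h ∈ analyticSubgroup (autEigenspace θ 1)) (Y : LieAlg n G) :
    θ (lieAd n h Y) = lieAd n h (θ Y) := by
  induction hh using Subgroup.closure_induction generalizing Y with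
  | mem x hx =>
    obtain ⟨X, hX, rfl⟩ := hx
    have hX' : θ X = X := by
      have := Module.End.mem_eigenspace_iff.1 hX
      simpa using this
    let θ' : EuclideanSpace ℝ (Fin n) →L[ℝ] EuclideanSpace ℝ (Fin n) :=
      LinearMap.toContinuousLinearMap
        (θ.toLinearEquiv.toLinearMap : EuclideanSpace ℝ (Fin n) →ₗ[ℝ] EuclideanSpace ℝ (Fin n))
    have h1 : ∀ t, HasDerivAt (F := EuclideanSpace ℝ (Fin n))
        (fun t : ℝ => θ' (lieAd n (lieExp (t • X) : G) Y))
        (lieAdOp X (θ' (lieAd n (lieExp (t • X) : G) Y))) t := by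
      intro t
      refine (HasFDerivAt.comp_hasDerivAt (E := EuclideanSpace ℝ (Fin n))
        (F := EuclideanSpace ℝ (Fin n)) t θ'.hasFDerivAt
        (hasDerivAt_lieAd_lieExp X Y t)).congr_deriv ?_
      exact (LieEquiv.map_lie θ _ _).trans (by rw [hX']; rfl)
    have h2 := eq_exp_smul_apply_of_hasDerivAt (lieAdOp X) h1 1
    have h3 := lieAd_lieExp_apply X (θ Y) 1
    rw [one_smul] at h2 h3
    rw [zero_smul, lieExp_zero] at h2
    refine h2.trans (Eq.trans ?_ h3.symm)
    rw [one_smul]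
    exact congrArg _ (congrArg θ (lieAd_one_apply Y))
  | one => rw [lieAd_one_apply, lieAd_one_apply]
  | mul x y _ _ hx hy => rw [lieAd_mul_apply, lieAd_mul_apply, hx, hy]
  | inv x _ hx =>
    have := hx (lieAd n x⁻¹ Y)
    rw [lieAd_apply_inv_self] at this
    rw [this, lieAd_inv_apply_self]

omit [CompactSpace G] in
-- As `θ` commutes with `Ad` on the analytic subgroup, differentiation along `exp tX` gives `θ[X, Y]
-- = [X, θY]`. Comparison with `[θX, θY]` shows that `θX - X` is central, hence zero.
theorem lieAlgebraOf_le_autEigenspace (θ : LieAlg n G ≃ₗ⁅ℝ⁆ LieAlg n G) {T : Subgroup G}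
    (hT : T ≤ analyticSubgroup (autEigenspace θ 1)) :
    lieAlgebraOf n T ≤ autEigenspace θ 1 := by
  refine Submodule.span_le.2 fun X hX => ?_
  refine Module.End.mem_eigenspace_iff.2 ?_
  change θ X = (1 : ℝ) • X
  rw [one_smul, ← sub_eq_zero]
  refine eq_zero_of_forall_lie_eq_zero fun Z => ?_
  obtain ⟨Y, rfl⟩ := θ.surjective Z
  let θ' : EuclideanSpace ℝ (Fin n) →L[ℝ] EuclideanSpace ℝ (Fin n) :=
    LinearMap.toContinuousLinearMap
      (θ.toLinearEquiv.toLinearMap : EuclideanSpace ℝ (Fin n) →ₗ[ℝ] EuclideanSpace ℝ (Fin n))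
  have h1 := HasFDerivAt.comp_hasDerivAt (E := EuclideanSpace ℝ (Fin n))
        (F := EuclideanSpace ℝ (Fin n)) 0 θ'.hasFDerivAt (hasDerivAt_lieAd_lieExp_zero X Y)
  have h2 := hasDerivAt_lieAd_lieExp_zero X (θ Y)
  have e : (fun t : ℝ => lieAd n (lieExp (t • X) : G) (θ Y)) =
      θ' ∘ (fun t : ℝ => lieAd n (lieExp (t • X) : G) Y) :=
    funext fun t => (aut_lieAd_of_mem_analyticSubgroup θ (hT (hX t)) Y).symm
  rw [e] at h2
  have h3 : θ ⁅X, Y⁆ = ⁅X, θ Y⁆ := h1.unique h2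
  have h4 : ⁅θ X, θ Y⁆ = ⁅X, θ Y⁆ := (LieEquiv.map_lie θ X Y).symm.trans h3
  exact (sub_lie _ _ _).trans (sub_eq_zero.2 h4)

omit [CompactSpace G] [LieAlgebra.IsSemisimple ℝ (LieAlg n G)] [T2Space G] in
theorem continuous_lieAd : Continuous fun g : G =>
    (lieAd n g : EuclideanSpace ℝ (Fin n) →L[ℝ] EuclideanSpace ℝ (Fin n)) :=
  (continuous_clm_apply (E := EuclideanSpace ℝ (Fin n)) (F := EuclideanSpace ℝ (Fin n))).2
    fun Y => continuous_lieAd_apply Y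

omit [CompactSpace G] in
-- The operators `exp(tA)` are automorphisms of the Lie algebra, so `A` is a derivation, and
-- derivations of a semisimple algebra are inner.
theorem exists_eq_lieAdOp {A : EuclideanSpace ℝ (Fin n) →L[ℝ] EuclideanSpace ℝ (Fin n)}
    (hA : ∀ t : ℝ, ∃ g : G, NormedSpace.exp (t • A) = lieAd n g) :
    ∃ Y : LieAlg n G, A = lieAdOp Y := by
  let V := EuclideanSpace ℝ (Fin n)
  let br : V →ₗ[ℝ] V →ₗ[ℝ] V :=
    (LieModule.toEnd ℝ (LieAlg n G) (LieAlg n G) : LieAlg n G →ₗ[ℝ] Module.End ℝ (LieAlg n G))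
  let br' : V →L[ℝ] V →L[ℝ] V :=
    LinearMap.toContinuousLinearMap (LinearMap.toContinuousLinearMap.toLinearMap ∘ₗ br)
  have h0 : ∀ Y : V, HasDerivAt (fun t : ℝ => NormedSpace.exp (t • A) Y) (A Y) 0 :=
    hasDerivAt_exp_smul_apply_zero A
  have hder : ∀ X Y : V, A (br' X Y) = br' (A X) Y + br' X (A Y) := by
    intro X Y
    have h1 := h0 (br' X Y)
    have h3 := br'.hasDerivAt_of_bilinear (fun _ => h0 X) (fun _ => h0 Y)
    have e : (fun t : ℝ => br' (NormedSpace.exp (t • A) X) (NormedSpace.exp (t • A) Y)) =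
        fun t : ℝ => NormedSpace.exp (t • A) (br' X Y) := by
      funext t
      obtain ⟨g, hg⟩ := hA t
      rw [hg]
      exact (lieAd_lie g X Y).symm
    rw [e] at h3
    rw [exp_smul_zero_apply, exp_smul_zero_apply] at h3
    exact (h1.unique h3).trans (add_comm _ _)
  let D : LieDerivation ℝ (LieAlg n G) (LieAlg n G) :=
    { toLinearMap := (A : V →ₗ[ℝ] V)
      leibniz' := by
        intro X Y
        refine (hder X Y).trans ?_
        rw [sub_eq_add_neg, lie_skew, add_comm]
        rfl }
  obtain ⟨Y, hY⟩ := LieDerivation.IsKilling.exists_eq_ad D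
  refine ⟨Y, ContinuousLinearMap.ext fun X => ?_⟩
  have h1 : ∀ Z : LieAlg n G, D Z = ⁅Y, Z⁆ := fun Z => by
    rw [← hY, LieDerivation.ad_apply_apply]
  exact h1 X

/-- A one-parameter group in `Ad T` is generated by some `ad Y` with `Y` fixed by `T`; by maximality
`Y` is in the Lie algebra of `T`, so `ad Y` kills `X`. The infinitesimal closed subgroup theorem
then shows that `X` is fixed by a neighbourhood of `1` in `T`, hence by the connected group `T`. So
`exp sX` commutes with `T`, and maximality puts it in `T`. -/
theorem IsMaximalTorus.mem_lieAlgebraOf {T : Subgroup G} (hT : IsMaximalTorus T) {X : LieAlg n G}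
    (hX : ∀ Y ∈ lieAlgebraOf n T, ⁅Y, X⁆ = 0) : X ∈ lieAlgebraOf n T := by
  have : IsTopologicalGroup G := lieGroup_isTopologicalGroup n G
  let V := EuclideanSpace ℝ (Fin n)
  let A : G → V →L[ℝ] V := fun g => lieAd n g
  have hA : Continuous A := continuous_lieAd
  have hmul : ∀ g h, A g * A h = A (g * h) := fun g h =>
    ContinuousLinearMap.ext fun Y => (lieAd_mul_apply g h Y).symm
  have hone : A 1 = 1 := ContinuousLinearMap.ext fun Y => lieAd_one_apply Y
  obtain ⟨ε, hε, hfix⟩ := exists_forall_norm_sub_one_lt_apply_eq (K := A '' T)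
    (hT.prop.1.image hA) ⟨1, T.one_mem, hone⟩
    (by
      rintro _ ⟨a, ha, rfl⟩ _ ⟨b, hb, rfl⟩
      exact ⟨a * b, T.mul_mem ha hb, (hmul a b).symm⟩)
    (by
      rintro _ ⟨a, ha, rfl⟩ b hb
      refine ⟨a⁻¹, T.inv_mem ha, ?_⟩
      rw [← mul_one (A a⁻¹), ← hb, ← mul_assoc, hmul, inv_mul_cancel, hone, one_mul])
    (by
      rintro _ ⟨a, ha, rfl⟩ _ ⟨b, hb, rfl⟩
      rw [hmul, hmul, hT.prop.2.2 a ha b hb]) X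
    (by
      intro B hB
      obtain ⟨Y, rfl⟩ := exists_eq_lieAdOp (G := G) (A := B) fun t => by
        obtain ⟨g, -, hg⟩ := hB t
        exact ⟨g, hg.symm⟩
      refine hX Y (Submodule.subset_span fun s => hT.mem_of_commute (fun s t ht => ?_) s)
      refine commute_lieExp_of_lieAd_eq_self ?_ s
      rw [← sub_eq_zero]
      refine eq_zero_of_forall_lie_eq_zero fun Z => ?_
      have hc : Commute (lieAdOp Y) (A t) := commute_of_forall_commute_exp fun s => by
        obtain ⟨g, hg, hg'⟩ := hB s
        rw [← hg']
        change A g * A t = A t * A g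
        rw [hmul, hmul, hT.prop.2.2 g hg t ht]
      have h2 : lieAdOp Y (A t (lieAd n t⁻¹ Z)) = A t (lieAdOp Y (lieAd n t⁻¹ Z)) :=
        DFunLike.congr_fun (F := V →L[ℝ] V) hc (lieAd n t⁻¹ Z)
      have h3 : ⁅Y, lieAd n t (lieAd n t⁻¹ Z)⁆ = lieAd n t ⁅Y, lieAd n t⁻¹ Z⁆ := h2
      rw [lieAd_lie, lieAd_apply_inv_self] at h3
      rw [sub_lie, h3, sub_self])
  let St : Subgroup T :=
    { carrier := {t | lieAd n (t : G) X = X}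
      mul_mem' := by
        intro a b ha hb
        change lieAd n ((a : G) * (b : G)) X = X
        rw [lieAd_mul_apply, hb, ha]
      one_mem' := lieAd_one_apply X
      inv_mem' := by
        intro a ha
        change lieAd n ((a : G)⁻¹) X = X
        conv_lhs => rw [← show lieAd n (a : G) X = X from ha]
        exact lieAd_inv_apply_self _ _ }
  have hSt : IsOpen (St : Set T) := by
    refine Subgroup.isOpen_of_mem_nhds St (g := 1) ?_
    have h1 : ContinuousAt (fun t : T => ‖A (t : G) - 1‖) 1 :=
      ((hA.comp continuous_subtype_val).sub continuous_const).norm.continuousAt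
    have h2 : ∀ᶠ t : T in 𝓝 1, ‖A (t : G) - 1‖ < ε := by
      refine h1.eventually (gt_mem_nhds ?_)
      simp [hone, hε]
    filter_upwards [h2] with t ht
    exact hfix _ ⟨t, t.2, rfl⟩ ht
  have : ConnectedSpace T := isConnected_iff_connectedSpace.1 hT.prop.2.1
  have hSt' : (St : Set T) = univ :=
    IsClopen.eq_univ ⟨St.isClosed_of_isOpen hSt, hSt⟩ ⟨1, St.one_mem⟩
  refine Submodule.subset_span fun s => hT.mem_of_commute (fun s t ht => ?_) s
  refine commute_lieExp_of_lieAd_eq_self ?_ s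
  have : (⟨t, ht⟩ : T) ∈ (St : Set T) := hSt' ▸ mem_univ _
  exact this

end Tori

/-! ### Bases of root systems and the free action of the Weyl group -/

namespace RootPairing

open IsAddIndecomposable Module Submodule

variable {ι M N : Type*} [Finite ι] [AddCommGroup M] [AddCommGroup N] [Module ℂ M] [Module ℂ N]
  (P : RootPairing ι ℂ M N) [P.IsRootSystem] [P.IsCrystallographic]

/-- Positivity makes the indecomposable roots a basis of the real span of the roots. They also span
`M` over `ℂ`, and the real rank of the root span equals the complex dimension of `M`, so counting
gives independence over `ℂ`. -/
theorem linearIndepOn_root_baseOf_real [Module ℝ M] [IsScalarTower ℝ ℂ M] [Module ℝ N]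
    [IsScalarTower ℝ ℂ N] (f : Dual ℝ M) (hf : ∀ i, f (P.root i) ≠ 0) :
    LinearIndepOn ℂ P.root (baseOf P.root (f : M →+ ℝ)) := by
  let := P.indexNeg
  have : P.IsValuedIn ℝ := IsValuedIn.trans P ℝ ℤ
  have : Fintype (baseOf P.root (f : M →+ ℝ)) := Fintype.ofFinite _
  let v (i : baseOf P.root (f : M →+ ℝ)) : P.rootSpan ℝ := P.rootSpanMem ℝ i
  change LinearIndependent ℂ ((P.rootSpan ℝ).subtype ∘ v)
  have h_span : span ℝ (range v) = ⊤ := by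
    suffices span ℝ (range v) = span ℝ (range (P.rootSpanMem ℝ)) by
      rw [this, eq_top_iff, ← (P.rootSpan ℝ).subtype.map_le_map_iff' (by simp), map_span,
        ← image_univ, ← image_comp]
      simp only [Submodule.map_top, range_subtype, image_univ]
      exact span_mono (by rintro _ ⟨i, rfl⟩; exact ⟨i, rfl⟩)
    apply le_antisymm (span_mono fun x i ↦ by aesop) (span_le.mpr ?_)
    rintro - ⟨i, rfl⟩
    suffices (P.rootSpanMem ℝ i : M) ∈ span ℝ (P.root '' baseOf P.root (f : M →+ ℝ)) by
      rw [← (injective_subtype (P.rootSpan ℝ)).mem_set_image, ← map_coe, SetLike.mem_coe, map_span,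
        ← image_univ, ← image_comp]
      convert! this
      aesop
    rw [← span_span_of_tower ℤ, ← Submodule.coe_toAddSubgroup, span_int_eq_addSubgroupClosure,
      AddSubgroup.closure_image_isAddIndecomposable_baseOf P.root (by simp) (f : M →+ ℝ) (by simpa)]
    exact subset_span <| AddSubgroup.subset_closure <| by simp
  have h_card : Nat.card (baseOf P.root (f : M →+ ℝ)) = finrank ℂ M := by
    let b : Basis (baseOf P.root (f : M →+ ℝ)) ℝ (P.rootSpan ℝ) := by
      replace this : LinearIndependent ℝ v :=
        .of_comp (P.rootSpan ℝ).subtype <| P.linearIndepOn_root_baseOf' f hf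
      exact Basis.mk this (by rw [h_span])
    rw [← RootPairing.finrank_rootSpanIn ℝ P, finrank_eq_nat_card_basis b]
  replace h_span : span ℂ (range <| (P.rootSpan ℝ).subtype ∘ v) = ⊤ := by
    rw [range_comp, ← span_span_of_tower ℝ, span_image, h_span]
    simp
  rw [linearIndependent_iff_card_eq_finrank_span, Set.finrank, h_span, finrank_top, ← h_card,
    Fintype.card_eq_nat_card]

variable [P.IsReduced]

/-- Passes from positive systems cut out by a real functional to bases. The functional is positive
on the base, hence on sums of its elements; for the converse, one of `i` and `-i` is positive for
the base. -/
theorem exists_base_isPos_iff [Module ℝ M] [IsScalarTower ℝ ℂ M] [Module ℝ N]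
    [IsScalarTower ℝ ℂ N] (f : Dual ℝ M) (hf : ∀ i, f (P.root i) ≠ 0) :
    ∃ b : P.Base, ∀ i, b.IsPos i ↔ 0 < f (P.root i) := by
  let := P.indexNeg
  let b : P.Base := Base.mk' P (baseOf P.root (f : M →+ ℝ)) (P.linearIndepOn_root_baseOf_real f hf)
    (fun i ↦ mem_or_neg_mem_closure_baseOf P.root (f : M →+ ℝ) i (hf i) (by simp))
  have hb : ∀ i ∈ b.support, 0 < f (P.root i) := by
    intro i hi
    have : i ∈ baseOf P.root (f : M →+ ℝ) := by simpa [b, Base.mk'] using hi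
    exact this.1
  have h1 : ∀ i, b.IsPos i → 0 < f (P.root i) := fun i hi => by
    refine hi.induction_on_add (p := fun i => 0 < f (P.root i)) hb ?_
    intro i j k hk hi hj
    rw [hk, map_add]
    exact add_pos hi (hb j hj)
  refine ⟨b, fun i => ⟨h1 i, fun hi => ?_⟩⟩
  rcases Base.IsPos.or_neg b i with h | h
  · exact h
  · have := h1 _ h
    simp at this
    linarith

variable {P}

omit [Finite ι] [P.IsRootSystem] [P.IsCrystallographic] [P.IsReduced] in
theorem reflection_eq_of_root_eq_prod (l : List ι) {a k : ι}
    (hk : P.root k = (l.map P.reflection).prod (P.root a)) :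
    P.reflection k = (l.map P.reflection).prod * P.reflection a * (l.map P.reflection).prod⁻¹ := by
  induction l generalizing k with
  | nil =>
    have : k = a := by simpa using hk
    simp [this]
  | cons c l ih =>
    have hk' : P.root (P.reflectionPerm c k) = (l.map P.reflection).prod (P.root a) := by
      rw [root_reflectionPerm, hk, List.map_cons, List.prod_cons, LinearEquiv.mul_apply,
        reflection_same]
    conv_lhs => rw [← P.reflectionPerm_self c k]
    rw [reflection_reflectionPerm, ih hk', List.map_cons, List.prod_cons, mul_inv_rev,
      reflection_inv]
    simp only [mul_assoc]

omit [P.IsRootSystem] in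
/-- The deletion property of words in the simple reflections. -/
theorem Base.exists_list_prod_mul_reflection_eq (b : P.Base) (l : List ι)
    (hl : ∀ i ∈ l, i ∈ b.support) {a : ι} (ha : a ∈ b.support) {k : ι}
    (hk : P.root k = (l.map P.reflection).prod (P.root a)) (hneg : ¬ b.IsPos k) :
    ∃ l' : List ι, (∀ i ∈ l', i ∈ b.support) ∧ l'.length < l.length ∧
      (l.map P.reflection).prod * P.reflection a = (l'.map P.reflection).prod := by
  induction l generalizing k with
  | nil =>
    have : k = a := by simpa using hk
    exact absurd (this ▸ isPos_of_mem_support ha) hneg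
  | cons c l ih =>
    have hc : c ∈ b.support := hl c (by simp)
    have hl' : ∀ i ∈ l, i ∈ b.support := fun i hi => hl i (by simp [hi])
    have hk' : P.root (P.reflectionPerm c k) = (l.map P.reflection).prod (P.root a) := by
      rw [root_reflectionPerm, hk, List.map_cons, List.prod_cons, LinearEquiv.mul_apply,
        reflection_same]
    -- The simple reflection in `c` permutes the positive roots other than `c`. If it makes the
    -- negative root `k` positive, then it sends `k` to `c`; so `c` is the image of `a` under the
    -- rest `l` of the word. The reflection in `c` is then the conjugate by `l` of the one in `a`,
    -- and both letters cancel. Otherwise the deletion takes place within `l`.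
    by_cases hp : b.IsPos (P.reflectionPerm c k)
    · have hck : P.reflectionPerm c k = c := by
        by_contra hne
        have := hp.reflectionPerm hc hne
        rw [reflectionPerm_self] at this
        exact hneg this
      refine ⟨l, hl', by simp, ?_⟩
      rw [hck] at hk'
      have h1 := reflection_eq_of_root_eq_prod l hk'
      rw [List.map_cons, List.prod_cons, h1, inv_mul_cancel_right, mul_assoc, ← sq, reflection_sq,
        mul_one]
    · obtain ⟨l', h1, h2, h3⟩ := ih hl' hk' hp
      refine ⟨c :: l', by simpa [hc] using h1, by simpa using h2, ?_⟩
      rw [List.map_cons, List.prod_cons, mul_assoc, h3, List.map_cons, List.prod_cons]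

omit [P.IsRootSystem] in
theorem Base.exists_list_prod_eq (b : P.Base) {g : M ≃ₗ[ℂ] M}
    (hg : g ∈ Subgroup.closure (range P.reflection)) :
    ∃ l : List ι, (∀ i ∈ l, i ∈ b.support) ∧ g = (l.map P.reflection).prod := by
  have hmul : ∀ l l' : List ι, ((l ++ l').map P.reflection).prod =
    (l.map P.reflection).prod * (l'.map P.reflection).prod := by simp
  induction hg using Subgroup.closure_induction with
  | mem x hx =>
    obtain ⟨i, rfl⟩ := hx
    refine b.induction_reflect i (p := fun i => ∃ l : List ι, (∀ i ∈ l, i ∈ b.support) ∧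
      P.reflection i = (l.map P.reflection).prod) ?_ ?_ ?_
    · rintro i ⟨l, hl, h⟩
      refine ⟨l, hl, ?_⟩
      rw [reflection_reflectionPerm, ← h]
      simp [← sq]
    · exact fun i hi => ⟨[i], by simpa using hi, by simp⟩
    · rintro i j ⟨l, hl, h⟩ hj
      refine ⟨j :: (l ++ [j]), ?_, ?_⟩
      · intro k hk
        simp only [List.mem_cons, List.mem_append, List.not_mem_nil, or_false] at hk
        rcases hk with rfl | hk | rfl
        · exact hj
        · exact hl k hk
        · exact hj
      · rw [reflection_reflectionPerm, h]
        simp [mul_assoc]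
  | one => exact ⟨[], by simp, by simp⟩
  | mul x y _ _ hx hy =>
    obtain ⟨l, hl, rfl⟩ := hx
    obtain ⟨l', hl', rfl⟩ := hy
    exact ⟨l ++ l', by simpa [or_imp, forall_and] using ⟨hl, hl'⟩, (hmul l l').symm⟩
  | inv x _ hx =>
    obtain ⟨l, hl, rfl⟩ := hx
    refine ⟨l.reverse, by simpa using hl, ?_⟩
    rw [List.prod_inv_reverse, List.map_map, List.map_reverse]
    simp [Function.comp_def]

/-- The Weyl group acts simply transitively on positive systems. -/
theorem Base.eq_one_of_forall_isPos (b : P.Base) {g : M ≃ₗ[ℂ] M}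
    (hg : g ∈ Subgroup.closure (range P.reflection))
    (hpos : ∀ i k, b.IsPos i → P.root k = g (P.root i) → b.IsPos k) : g = 1 := by
  obtain ⟨l, hl, rfl⟩ := b.exists_list_prod_eq hg
  clear hg
  generalize hN : l.length = N
  induction N using Nat.strong_induction_on generalizing l with
  | _ N ih =>
    rcases l.eq_nil_or_concat with rfl | ⟨l, a, rfl⟩
    · simp
    · have ha : a ∈ b.support := hl a (by simp)
      have hl' : ∀ i ∈ l, i ∈ b.support := fun i hi => hl i (by simp [hi])
      have hex : ∃ k, P.root k = (l.map P.reflection).prod (P.root a) := by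
        clear hpos hN hl hl'
        induction l with
        | nil => exact ⟨a, by simp⟩
        | cons c l ihl =>
          obtain ⟨k, hk⟩ := ihl
          exact ⟨P.reflectionPerm c k, by
            rw [root_reflectionPerm, hk, List.map_cons, List.prod_cons, LinearEquiv.mul_apply]⟩
      obtain ⟨k, hk⟩ := hex
      -- The whole word sends the simple root `a` to `-k`, which must be positive by hypothesis; so
      -- the deletion property shortens the word.
      have hneg : ¬ b.IsPos k := by
        let := P.indexNeg
        rw [← Base.IsPos.neg_iff_not]
        refine hpos a (-k) (isPos_of_mem_support ha) ?_
        simp [← hk]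
      obtain ⟨l', h1, h2, h3⟩ := b.exists_list_prod_mul_reflection_eq l hl' ha hk hneg
      have h4 : ((l.concat a).map P.reflection).prod = (l'.map P.reflection).prod := by
        rw [← h3]; simp
      rw [h4] at hpos ⊢
      simp only [List.concat_eq_append, List.length_append, List.length_cons] at hN
      exact ih l'.length (by omega) l' h1 hpos rfl

end RootPairing

/-! ### Real and imaginary parts in a complexified vector space -/

section Complexification

variable {V W : Type*} [AddCommGroup V] [Module ℝ V] [AddCommGroup W] [Module ℝ W]

variable (V) in
/-- The real part of a vector of the complexification. -/
def cplxRe : ℂ ⊗[ℝ] V →ₗ[ℝ] V :=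
  TensorProduct.lid ℝ V ∘ₗ LinearMap.rTensor V Complex.reLm

variable (V) in
/-- The imaginary part of a vector of the complexification. -/
def cplxIm : ℂ ⊗[ℝ] V →ₗ[ℝ] V :=
  TensorProduct.lid ℝ V ∘ₗ LinearMap.rTensor V Complex.imLm

@[simp] theorem cplxRe_tmul (z : ℂ) (x : V) : cplxRe V (z ⊗ₜ x) = z.re • x := by simp [cplxRe]

@[simp] theorem cplxIm_tmul (z : ℂ) (x : V) : cplxIm V (z ⊗ₜ x) = z.im • x := by simp [cplxIm]

theorem cplx_smul_tmul (z w : ℂ) (x : V) : z • (w ⊗ₜ[ℝ] x) = (z * w) ⊗ₜ[ℝ] x := by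
  rw [TensorProduct.smul_tmul', smul_eq_mul]

theorem cplx_eq (ξ : ℂ ⊗[ℝ] V) :
    ξ = (1 : ℂ) ⊗ₜ[ℝ] cplxRe V ξ + Complex.I • ((1 : ℂ) ⊗ₜ[ℝ] cplxIm V ξ) := by
  induction ξ using TensorProduct.induction_on with
  | zero => simp
  | tmul z x =>
    rw [cplxRe_tmul, cplxIm_tmul, cplx_smul_tmul, TensorProduct.tmul_smul, TensorProduct.tmul_smul,
      TensorProduct.smul_tmul', TensorProduct.smul_tmul', ← TensorProduct.add_tmul]
    congr 1
    apply Complex.ext <;> simp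
  | add a b ha hb =>
    rw [map_add, map_add, TensorProduct.tmul_add, TensorProduct.tmul_add, smul_add]
    conv_lhs => rw [ha, hb]
    abel

theorem cplx_ext {ξ η : ℂ ⊗[ℝ] V} (h1 : cplxRe V ξ = cplxRe V η) (h2 : cplxIm V ξ = cplxIm V η) :
    ξ = η := by
  rw [cplx_eq ξ, cplx_eq η, h1, h2]

@[simp] theorem cplxRe_smul (z : ℂ) (ξ : ℂ ⊗[ℝ] V) :
    cplxRe V (z • ξ) = z.re • cplxRe V ξ - z.im • cplxIm V ξ := by
  induction ξ using TensorProduct.induction_on with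
  | zero => simp
  | tmul w x => rw [cplx_smul_tmul]; simp [sub_smul, mul_smul]
  | add a b ha hb => rw [smul_add, map_add, ha, hb]; simp; abel

@[simp] theorem cplxIm_smul (z : ℂ) (ξ : ℂ ⊗[ℝ] V) :
    cplxIm V (z • ξ) = z.re • cplxIm V ξ + z.im • cplxRe V ξ := by
  induction ξ using TensorProduct.induction_on with
  | zero => simp
  | tmul w x => rw [cplx_smul_tmul]; simp [add_smul, mul_smul]
  | add a b ha hb => rw [smul_add, map_add, ha, hb]; simp; abel

theorem mem_baseChange_complex_iff {U : Submodule ℝ V} {ξ : ℂ ⊗[ℝ] V} :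
    ξ ∈ U.baseChange ℂ ↔ cplxRe V ξ ∈ U ∧ cplxIm V ξ ∈ U := by
  constructor
  · intro h
    rw [Submodule.baseChange_eq_span] at h
    induction h using Submodule.span_induction with
    | mem x hx =>
      obtain ⟨y, hy, rfl⟩ := hx
      simpa using hy
    | zero => simp
    | add a b _ _ ha hb => exact ⟨by rw [map_add]; exact add_mem ha.1 hb.1,
        by rw [map_add]; exact add_mem ha.2 hb.2⟩
    | smul z a _ ha =>
      rw [cplxRe_smul, cplxIm_smul]
      exact ⟨sub_mem (U.smul_mem _ ha.1) (U.smul_mem _ ha.2),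
        add_mem (U.smul_mem _ ha.2) (U.smul_mem _ ha.1)⟩
  · rintro ⟨h1, h2⟩
    rw [cplx_eq ξ]
    exact add_mem (Submodule.tmul_mem_baseChange_of_mem _ h1)
      (Submodule.smul_mem _ _ (Submodule.tmul_mem_baseChange_of_mem _ h2))

end Complexification

/-! ### The complexification of a real Lie algebra -/

section ComplexLie

section ScalarExtension

variable (R A L : Type*) [CommRing R] [CommRing A] [Algebra R A] [LieRing L] [LieAlgebra R L]

/-- The Lie ring structure on an extension of scalars. -/
abbrev lieRingExtension : LieRing (A ⊗[R] L) := inferInstance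

/-- The Lie algebra structure on an extension of scalars. -/
abbrev lieAlgebraExtension : LieAlgebra A (A ⊗[R] L) := inferInstance

variable {R L} in
theorem one_tmul_lie_tmul (z : A) (x y : L) :
    (⁅(1 : A) ⊗ₜ[R] x, z ⊗ₜ[R] y⁆ : A ⊗[R] L) = z ⊗ₜ[R] ⁅x, y⁆ :=
  (LieAlgebra.ExtendScalars.bracket_tmul R A L L 1 z x y).trans (by rw [one_mul])

variable {R L} in
theorem killingForm_one_tmul [Module.Free R L] [Module.Finite R L] (x y : L) :
    killingForm A (A ⊗[R] L) ((1 : A) ⊗ₜ[R] x) ((1 : A) ⊗ₜ[R] y) =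
      algebraMap R A (killingForm R L x y) := by
  rw [killingForm, LieModule.traceForm_baseChange]
  simp [killingForm, Algebra.algebraMap_eq_smul_one]

theorem moduleFinite_extension [Module.Finite R L] : Module.Finite A (A ⊗[R] L) := inferInstance

end ScalarExtension

variable (L : Type*) [LieRing L] [LieAlgebra ℝ L]

/-- The complexification of a real Lie algebra. -/
def CLie : Type _ := ℂ ⊗[ℝ] L

instance : LieRing (CLie L) := lieRingExtension ℝ ℂ L

instance : LieAlgebra ℂ (CLie L) := lieAlgebraExtension ℝ ℂ L

instance [Module.Finite ℝ L] : Module.Finite ℂ (CLie L) := moduleFinite_extension ℝ ℂ L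

variable {L}

namespace CLie

/-- The inclusion of a real Lie algebra into its complexification. -/
def of : L →+ CLie L where
  toFun x := (1 : ℂ) ⊗ₜ[ℝ] x
  map_zero' := TensorProduct.tmul_zero L (1 : ℂ)
  map_add' x y := TensorProduct.tmul_add (1 : ℂ) x y

/-- The real part. -/
def re : CLie L →+ L := (cplxRe L).toAddMonoidHom

/-- The imaginary part. -/
def im : CLie L →+ L := (cplxIm L).toAddMonoidHom

theorem of_smul (r : ℝ) (x : L) : of (r • x) = (r : ℂ) • of x := by
  have h : (1 : ℂ) ⊗ₜ[ℝ] (r • x) = (r : ℂ) • ((1 : ℂ) ⊗ₜ[ℝ] x) := by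
    rw [cplx_smul_tmul, TensorProduct.tmul_smul, TensorProduct.smul_tmul', mul_one]
    simp
  exact h

theorem of_lie (x y : L) : of ⁅x, y⁆ = ⁅of x, of y⁆ := (one_tmul_lie_tmul ℂ 1 x y).symm

@[simp] theorem re_of (x : L) : re (of x) = x := (cplxRe_tmul 1 x).trans (one_smul ℝ x)

@[simp] theorem im_of (x : L) : im (of x) = 0 := (cplxIm_tmul 1 x).trans (zero_smul ℝ x)

theorem re_smul (z : ℂ) (ξ : CLie L) : re (z • ξ) = z.re • re ξ - z.im • im ξ :=
  cplxRe_smul z ξ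

theorem im_smul (z : ℂ) (ξ : CLie L) : im (z • ξ) = z.re • im ξ + z.im • re ξ :=
  cplxIm_smul z ξ

theorem eq_re_add_im (ξ : CLie L) : ξ = of (re ξ) + Complex.I • of (im ξ) := cplx_eq ξ

protected theorem ext {ξ η : CLie L} (h1 : re ξ = re η) (h2 : im ξ = im η) : ξ = η :=
  cplx_ext h1 h2

theorem re_lie_of (x : L) (ξ : CLie L) : re ⁅of x, ξ⁆ = ⁅x, re ξ⁆ := by
  conv_lhs => rw [eq_re_add_im ξ]
  simp [lie_add, lie_smul, ← of_lie, re_smul]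

theorem im_lie_of (x : L) (ξ : CLie L) : im ⁅of x, ξ⁆ = ⁅x, im ξ⁆ := by
  conv_lhs => rw [eq_re_add_im ξ]
  simp [lie_add, lie_smul, ← of_lie, im_smul]

/-- The complex subspace spanned by a real subspace. -/
def sub (U : Submodule ℝ L) : Submodule ℂ (CLie L) where
  carrier := {ξ | re ξ ∈ U ∧ im ξ ∈ U}
  add_mem' ha hb := ⟨by rw [map_add]; exact add_mem ha.1 hb.1,
    by rw [map_add]; exact add_mem ha.2 hb.2⟩
  zero_mem' := ⟨by simp, by simp⟩
  smul_mem' z a ha := by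
    refine ⟨?_, ?_⟩
    · rw [re_smul]; exact sub_mem (U.smul_mem _ ha.1) (U.smul_mem _ ha.2)
    · rw [im_smul]; exact add_mem (U.smul_mem _ ha.2) (U.smul_mem _ ha.1)

theorem mem_sub {U : Submodule ℝ L} {ξ : CLie L} : ξ ∈ sub U ↔ re ξ ∈ U ∧ im ξ ∈ U := Iff.rfl

theorem of_mem_sub {U : Submodule ℝ L} {x : L} : of x ∈ sub U ↔ x ∈ U := by simp [mem_sub]

theorem sub_eq_span (U : Submodule ℝ L) : sub U = Submodule.span ℂ (of '' (U : Set L)) := by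
  refine le_antisymm (fun ξ hξ => ?_) (Submodule.span_le.2 ?_)
  · rw [eq_re_add_im ξ]
    exact add_mem (Submodule.subset_span ⟨_, hξ.1, rfl⟩)
      (Submodule.smul_mem _ _ (Submodule.subset_span ⟨_, hξ.2, rfl⟩))
  · rintro _ ⟨x, hx, rfl⟩
    exact of_mem_sub.2 hx

variable [Module.Finite ℝ L]

theorem killingForm_of (x y : L) :
    killingForm ℂ (CLie L) (of x) (of y) = killingForm ℝ L x y := killingForm_one_tmul ℂ x y

theorem killingForm_of_right (ξ : CLie L) (y : L) :
    killingForm ℂ (CLie L) ξ (of y) =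
      killingForm ℝ L (re ξ) y + Complex.I * killingForm ℝ L (im ξ) y := by
  conv_lhs => rw [eq_re_add_im ξ]
  rw [map_add, map_smul, LinearMap.add_apply, LinearMap.smul_apply, killingForm_of,
    killingForm_of, smul_eq_mul]

/-- Pairing with real vectors separates into real and imaginary parts, so both parts of a vector in
the radical lie in the real radical. -/
instance isKilling [LieAlgebra.IsKilling ℝ L] : LieAlgebra.IsKilling ℂ (CLie L) where
  killingCompl_top_eq_bot := by
    rw [eq_bot_iff]
    intro ξ hξ
    rw [LieIdeal.mem_killingCompl] at hξ
    have h0 : ∀ x : L, (∀ y, killingForm ℝ L x y = 0) → x = 0 := fun x hx => by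
      have : x ∈ LinearMap.ker (killingForm ℝ L) := LinearMap.ext fun y => hx y
      simpa using this
    have h1 : ∀ y : L, killingForm ℝ L (re ξ) y = 0 ∧ killingForm ℝ L (im ξ) y = 0 := by
      intro y
      have h2 := hξ (of y) (LieSubmodule.mem_top _)
      rw [LieModule.traceForm_comm] at h2
      have h3 := (killingForm_of_right ξ y).symm.trans h2
      exact ⟨by simpa using congrArg Complex.re h3, by simpa using congrArg Complex.im h3⟩
    rw [LieSubmodule.mem_bot]
    exact CLie.ext (by simpa using h0 _ fun y => (h1 y).1) (by simpa using h0 _ fun y => (h1 y).2)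

end CLie

end ComplexLie

/-! ### Maximal abelian subalgebras and weight spaces -/

section CompactCartan

variable {L : Type*} [LieRing L] [LieAlgebra ℝ L]

/-- The subspace `𝔱` is a maximal abelian subalgebra, and the Killing form is negative definite. -/
structure IsCompactCartan (𝔱 : Submodule ℝ L) : Prop where
  neg : ∀ x : L, x ≠ 0 → killingForm ℝ L x x < 0
  comm : ∀ x ∈ 𝔱, ∀ y ∈ 𝔱, ⁅x, y⁆ = 0
  mem : ∀ x : L, (∀ y ∈ 𝔱, ⁅y, x⁆ = 0) → x ∈ 𝔱

variable {𝔱 : Submodule ℝ L}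

variable (𝔱) in
/-- The space of vectors of weight `α` in the complexification. -/
def rootSub (α : ComplexDual 𝔱) : Submodule ℂ (CLie L) where
  carrier := {ξ | ∀ X : 𝔱, ⁅CLie.of (X : L), ξ⁆ = α X • ξ}
  add_mem' ha hb X := by rw [lie_add, ha X, hb X, smul_add]
  zero_mem' X := by simp
  smul_mem' c ξ h X := by rw [lie_smul, h X, smul_comm]

theorem mem_rootSub {α : ComplexDual 𝔱} {ξ : CLie L} :
    ξ ∈ rootSub 𝔱 α ↔ ∀ X : 𝔱, ⁅CLie.of (X : L), ξ⁆ = α X • ξ := Iff.rfl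

theorem mem_rootsIn_iff {α : ComplexDual 𝔱} {U : Submodule ℝ L} :
    α ∈ rootsIn 𝔱 U ↔ α ≠ 0 ∧ ∃ ξ ∈ CLie.sub U, ξ ≠ 0 ∧ ξ ∈ rootSub 𝔱 α := by
  refine and_congr_right fun _ => exists_congr fun ξ => ?_
  exact and_congr_left fun _ => mem_baseChange_complex_iff

theorem mem_rootsIn_top_iff {α : ComplexDual 𝔱} :
    α ∈ rootsIn 𝔱 ⊤ ↔ α ≠ 0 ∧ ∃ ξ ∈ rootSub 𝔱 α, ξ ≠ 0 := by
  rw [mem_rootsIn_iff]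
  simp [and_comm, CLie.mem_sub]

theorem lie_mem_rootSub {α β : ComplexDual 𝔱} {ξ η : CLie L} (hξ : ξ ∈ rootSub 𝔱 α)
    (hη : η ∈ rootSub 𝔱 β) : ⁅ξ, η⁆ ∈ rootSub 𝔱 (α + β) := by
  intro X
  rw [leibniz_lie, hξ X, hη X, smul_lie, lie_smul, LinearMap.add_apply, add_smul]

/-- Invariance of the form gives `(α + β)(X) B(ξ, η) = 0` for all `X`. -/
theorem killingForm_eq_zero_of_mem_rootSub {α β : ComplexDual 𝔱} {ξ η : CLie L}
    (hξ : ξ ∈ rootSub 𝔱 α) (hη : η ∈ rootSub 𝔱 β) (h : α + β ≠ 0) :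
    killingForm ℂ (CLie L) ξ η = 0 := by
  obtain ⟨X, hX⟩ : ∃ X, (α + β) X ≠ 0 := by
    by_contra! hcon
    exact h (LinearMap.ext hcon)
  have h1 := LieModule.traceForm_apply_lie_apply ℂ (CLie L) (CLie L) ξ (CLie.of (X : L)) η
  rw [← lie_skew, hξ X, hη X, map_neg, map_smul, map_smul, LinearMap.neg_apply,
    LinearMap.smul_apply] at h1
  have h2 : (α + β) X * killingForm ℂ (CLie L) ξ η = 0 := by
    simp only [smul_eq_mul] at h1
    rw [LinearMap.add_apply, add_mul, killingForm]
    linear_combination -h1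
  exact (mul_eq_zero.1 h2).resolve_left hX

theorem killingForm_lie_self (x y : L) : killingForm ℝ L ⁅x, y⁆ y = 0 := by
  rw [killingForm, LieModule.traceForm_apply_lie_apply, lie_self, map_zero]

theorem killingForm_lie_left (x y z : L) :
    killingForm ℝ L ⁅x, y⁆ z = -killingForm ℝ L y ⁅x, z⁆ := by
  rw [← lie_skew, map_neg, LinearMap.neg_apply, killingForm, LieModule.traceForm_apply_lie_apply]

namespace IsCompactCartan

variable (h𝔱 : IsCompactCartan 𝔱)
include h𝔱

theorem isKilling [Module.Finite ℝ L] : LieAlgebra.IsKilling ℝ L where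
  killingCompl_top_eq_bot := by
    rw [eq_bot_iff]
    intro x hx
    rw [LieIdeal.mem_killingCompl] at hx
    by_contra hne
    exact (h𝔱.neg x hne).ne (hx x (LieSubmodule.mem_top _))

/-- By invariance `B([X, a], [X, a]) = -B(a, [X, [X, a]]) = 0`, and the form is definite. -/
theorem lie_eq_zero_of_lie_lie_eq_zero {X a : L} (h : ⁅X, ⁅X, a⁆⁆ = 0) : ⁅X, a⁆ = 0 := by
  by_contra hne
  refine (h𝔱.neg _ hne).ne ?_
  rw [killingForm_lie_left, h, map_zero, neg_zero]

/-- Roots are purely imaginary. -/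
theorem re_eq_zero {α : ComplexDual 𝔱} (hα : α ∈ rootsIn 𝔱 ⊤) (X : 𝔱) : (α X).re = 0 := by
  obtain ⟨-, ξ, hξ, hne⟩ := mem_rootsIn_top_iff.1 hα
  have h1 := congrArg (CLie.re) (hξ X)
  have h2 := congrArg (CLie.im) (hξ X)
  rw [CLie.re_lie_of, CLie.re_smul] at h1
  rw [CLie.im_lie_of, CLie.im_smul] at h2
  have h3 := killingForm_lie_self (X : L) (CLie.re ξ)
  have h4 := killingForm_lie_self (X : L) (CLie.im ξ)
  rw [h1] at h3
  rw [h2] at h4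
  simp only [map_sub, map_add, map_smul, LinearMap.sub_apply, LinearMap.add_apply,
    LinearMap.smul_apply, smul_eq_mul] at h3 h4
  have h5 : killingForm ℝ L (CLie.re ξ) (CLie.im ξ) =
    killingForm ℝ L (CLie.im ξ) (CLie.re ξ) := LieModule.traceForm_comm _ _ _ _ _
  rw [h5] at h4
  -- `ad X` is skew, so both parts of `ξ` are orthogonal to their images; on adding the two
  -- relations the terms with `Im α(X)` cancel by symmetry.
  have h6 : (α X).re * (killingForm ℝ L (CLie.re ξ) (CLie.re ξ) +
    killingForm ℝ L (CLie.im ξ) (CLie.im ξ)) = 0 := by linear_combination h3 + h4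
  refine (mul_eq_zero.1 h6).resolve_right (ne_of_lt ?_)
  have hle : ∀ x : L, killingForm ℝ L x x ≤ 0 := fun x => by
    rcases eq_or_ne x 0 with rfl | hx
    · simp
    · exact (h𝔱.neg x hx).le
  by_cases h7 : CLie.re ξ = 0
  · have h8 : CLie.im ξ ≠ 0 := fun h8 => hne (CLie.ext (by simpa using h7) (by simpa using h8))
    have := h𝔱.neg _ h8
    have := hle (CLie.re ξ)
    linarith
  · have := h𝔱.neg _ h7
    have := hle (CLie.im ξ)
    linarith

theorem rootSub_zero : rootSub 𝔱 0 = CLie.sub 𝔱 := by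
  ext ξ
  rw [CLie.mem_sub, mem_rootSub]
  constructor
  · intro h
    refine ⟨h𝔱.mem _ fun y hy => ?_, h𝔱.mem _ fun y hy => ?_⟩
    · have := congrArg (CLie.re) (h ⟨y, hy⟩)
      simpa [CLie.re_lie_of] using this
    · have := congrArg (CLie.im) (h ⟨y, hy⟩)
      simpa [CLie.im_lie_of] using this
  · rintro ⟨h1, h2⟩ X
    refine CLie.ext ?_ ?_
    · rw [CLie.re_lie_of, h𝔱.comm _ X.2 _ h1]; simp
    · rw [CLie.im_lie_of, h𝔱.comm _ X.2 _ h2]; simp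

end IsCompactCartan

end CompactCartan

/-! ### The root system of the complexification and the Weyl group -/

section CartanRoots

variable {L : Type*} [LieRing L] [LieAlgebra ℝ L] {𝔱 : Submodule ℝ L}

namespace IsCompactCartan

theorem lie_eq_zero_of_mem_sub (h𝔱 : IsCompactCartan 𝔱) {ξ η : CLie L} (hξ : ξ ∈ CLie.sub 𝔱)
    (hη : η ∈ CLie.sub 𝔱) : ⁅ξ, η⁆ = 0 := by
  rw [← h𝔱.rootSub_zero] at hη
  have h1 := hη ⟨_, hξ.1⟩
  have h2 := hη ⟨_, hξ.2⟩
  rw [CLie.eq_re_add_im ξ, add_lie, smul_lie]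
  simp only [LinearMap.zero_apply, zero_smul] at h1 h2
  rw [h1, h2, smul_zero, add_zero]

/-- The complexified Cartan subalgebra. -/
def cartan (h𝔱 : IsCompactCartan 𝔱) : LieSubalgebra ℂ (CLie L) :=
  { CLie.sub 𝔱 with
    lie_mem' := fun hx hy => by
      have := h𝔱.lie_eq_zero_of_mem_sub hx hy
      rw [this]
      exact (CLie.sub 𝔱).zero_mem }

variable (h𝔱 : IsCompactCartan 𝔱)

instance : IsLieAbelian h𝔱.cartan where
  trivial x y := Subtype.ext (h𝔱.lie_eq_zero_of_mem_sub x.2 y.2)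

/-- For `ξ` in the normalizer, `[x, ξ]` lies in the abelian algebra `𝔱_ℂ`, so `(ad x)² ξ = 0`.
Definiteness gives `[x, ξ] = 0`, and `𝔱` is its own centralizer. -/
instance : h𝔱.cartan.IsCartanSubalgebra where
  nilpotent := inferInstance
  self_normalizing := by
    refine le_antisymm (fun ξ hξ => ?_) h𝔱.cartan.le_normalizer
    rw [LieSubalgebra.mem_normalizer_iff'] at hξ
    have h1 : ∀ x ∈ 𝔱, ⁅CLie.of x, ⁅CLie.of x, ξ⁆⁆ = 0 := fun x hx =>
      h𝔱.lie_eq_zero_of_mem_sub (CLie.of_mem_sub.2 hx) (hξ _ (CLie.of_mem_sub.2 hx))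
    refine ⟨h𝔱.mem _ fun y hy => h𝔱.lie_eq_zero_of_lie_lie_eq_zero ?_,
      h𝔱.mem _ fun y hy => h𝔱.lie_eq_zero_of_lie_lie_eq_zero ?_⟩
    · simpa [CLie.re_lie_of] using congrArg CLie.re (h1 y hy)
    · simpa [CLie.im_lie_of] using congrArg CLie.im (h1 y hy)

/-- Linear forms on the complexified Cartan subalgebra are complex-valued real-linear forms on the
Cartan subalgebra. -/
def dualEquiv : Module.Dual ℂ h𝔱.cartan ≃ₗ[ℂ] ComplexDual 𝔱 where
  toFun l :=
    { toFun := fun X => l ⟨CLie.of (X : L), CLie.of_mem_sub.2 X.2⟩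
      map_add' := fun X Y => by
        rw [← map_add]; congr 1; exact Subtype.ext (map_add CLie.of _ _)
      map_smul' := fun r X => by
        rw [RingHom.id_apply, ← Complex.coe_smul, ← map_smul]
        congr 1; exact Subtype.ext (CLie.of_smul _ _) }
  map_add' l m := rfl
  map_smul' c l := rfl
  invFun μ :=
    { toFun := fun ξ => μ ⟨_, ξ.2.1⟩ + Complex.I * μ ⟨_, ξ.2.2⟩
      map_add' := fun ξ η => by
        have h1 : (⟨_, (ξ + η).2.1⟩ : 𝔱) = ⟨_, ξ.2.1⟩ + ⟨_, η.2.1⟩ :=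
          Subtype.ext (map_add CLie.re _ _)
        have h2 : (⟨_, (ξ + η).2.2⟩ : 𝔱) = ⟨_, ξ.2.2⟩ + ⟨_, η.2.2⟩ :=
          Subtype.ext (map_add CLie.im _ _)
        rw [h1, h2, map_add, map_add]
        ring
      map_smul' := fun z ξ => by
        have h1 : (⟨_, (z • ξ).2.1⟩ : 𝔱) = z.re • ⟨_, ξ.2.1⟩ - z.im • ⟨_, ξ.2.2⟩ :=
          Subtype.ext (CLie.re_smul _ _)
        have h2 : (⟨_, (z • ξ).2.2⟩ : 𝔱) = z.re • ⟨_, ξ.2.2⟩ + z.im • ⟨_, ξ.2.1⟩ :=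
          Subtype.ext (CLie.im_smul _ _)
        rw [h1, h2, map_sub, map_add, map_smul, map_smul, map_smul, map_smul, RingHom.id_apply,
          smul_eq_mul]
        simp only [Complex.real_smul]
        conv_rhs => rw [← Complex.re_add_im z]
        linear_combination (-(z.im : ℂ) * μ ⟨_, ξ.2.2⟩) * Complex.I_sq }
  left_inv l := by
    refine LinearMap.ext fun ξ => ?_
    change l _ + Complex.I * l _ = l ξ
    rw [← smul_eq_mul, ← map_smul, ← map_add]
    congr 1
    exact Subtype.ext (CLie.eq_re_add_im _).symm
  right_inv μ := by
    refine LinearMap.ext fun X => ?_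
    change μ ⟨CLie.re (CLie.of (X : L)), _⟩ + Complex.I * μ ⟨CLie.im (CLie.of (X : L)), _⟩ = μ X
    have h1 : (⟨CLie.re (CLie.of (X : L)), (CLie.of_mem_sub.2 X.2).1⟩ : 𝔱) = X :=
      Subtype.ext (CLie.re_of _)
    have h2 : (⟨CLie.im (CLie.of (X : L)), (CLie.of_mem_sub.2 X.2).2⟩ : 𝔱) = 0 :=
      Subtype.ext (CLie.im_of _)
    rw [h1, h2, map_zero, mul_zero, add_zero]

theorem dualEquiv_apply (l : Module.Dual ℂ h𝔱.cartan) (X : 𝔱) :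
    h𝔱.dualEquiv l X = l ⟨CLie.of (X : L), CLie.of_mem_sub.2 X.2⟩ := rfl

theorem dualEquiv_symm_apply (μ : ComplexDual 𝔱) (ξ : h𝔱.cartan) :
    h𝔱.dualEquiv.symm μ ξ = μ ⟨_, ξ.2.1⟩ + Complex.I * μ ⟨_, ξ.2.2⟩ := rfl

theorem lie_eq_of_mem_rootSub {μ : ComplexDual 𝔱} {ξ : CLie L} (hξ : ξ ∈ rootSub 𝔱 μ)
    (h : h𝔱.cartan) : ⁅(h : CLie L), ξ⁆ = h𝔱.dualEquiv.symm μ h • ξ := by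
  have h1 := hξ ⟨_, h.2.1⟩
  have h2 := hξ ⟨_, h.2.2⟩
  rw [dualEquiv_symm_apply, add_smul, mul_smul, ← h1, ← h2]
  conv_lhs => rw [CLie.eq_re_add_im (h : CLie L), add_lie, smul_lie]

variable [Module.Finite ℝ L] [LieAlgebra.IsKilling ℝ L]

open LieAlgebra LieModule

theorem mem_rootSpace_iff {l : Module.Dual ℂ h𝔱.cartan} {ξ : CLie L} :
    ξ ∈ rootSpace h𝔱.cartan l ↔ ξ ∈ rootSub 𝔱 (h𝔱.dualEquiv l) := by
  constructor
  · intro h X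
    exact IsKilling.lie_eq_smul_of_mem_rootSpace h ⟨CLie.of (X : L), CLie.of_mem_sub.2 X.2⟩
  · intro h
    refine (mem_genWeightSpace (CLie L) _ ξ).2 fun x => ⟨1, ?_⟩
    have := h𝔱.lie_eq_of_mem_rootSub h x
    rw [LinearEquiv.symm_apply_apply] at this
    rw [pow_one, LinearMap.sub_apply]
    exact sub_eq_zero.2 this

theorem mem_genWeightSpace_iff {w : Weight ℂ h𝔱.cartan (CLie L)} {ξ : CLie L} :
    ξ ∈ genWeightSpace (CLie L) w ↔ ξ ∈ rootSub 𝔱 (h𝔱.dualEquiv w.toLinear) := by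
  rw [← h𝔱.mem_rootSpace_iff]
  exact Iff.rfl

/-- The roots, indexed as in the root system of the complexification. -/
def rootOf (i : h𝔱.cartan.root) : ComplexDual 𝔱 :=
  h𝔱.dualEquiv ((IsKilling.rootSystem h𝔱.cartan).root i)

/-- Identifies the roots on `𝔱` with the abstract root system; finiteness, one-dimensional root
spaces and the Weyl group are imported through it. -/
theorem range_rootOf : range h𝔱.rootOf = rootsIn 𝔱 ⊤ := by
  ext α
  rw [mem_rootsIn_top_iff]
  constructor
  · rintro ⟨i, rfl⟩
    refine ⟨?_, ?_⟩
    · exact (LinearEquiv.map_ne_zero_iff _).2 ((IsKilling.rootSystem h𝔱.cartan).ne_zero i)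
    · obtain ⟨ξ, hξ, hne⟩ := i.1.exists_ne_zero
      exact ⟨ξ, h𝔱.mem_genWeightSpace_iff.1 hξ, hne⟩
  · rintro ⟨h0, ξ, hξ, hne⟩
    have h1 : ξ ∈ rootSpace h𝔱.cartan (h𝔱.dualEquiv.symm α) := by
      rw [h𝔱.mem_rootSpace_iff, LinearEquiv.apply_symm_apply]; exact hξ
    let w : Weight ℂ h𝔱.cartan (CLie L) := 
      { toFun := ⇑(h𝔱.dualEquiv.symm α)
        genWeightSpace_ne_bot' := fun hbot => by
          exact hne ((LieSubmodule.mem_bot ξ).1 (by rw [← hbot]; exact h1)) }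
    have hw : w.IsNonZero := fun hz => h0 (by
      have h2 : h𝔱.dualEquiv.symm α = 0 := LinearMap.ext fun x => congrFun hz x
      simpa using h2)
    refine ⟨⟨w, by simpa using hw⟩, ?_⟩
    have h2 : w.toLinear = h𝔱.dualEquiv.symm α := LinearMap.ext fun x => rfl
    rw [rootOf, IsKilling.rootSystem_root_apply, h2, LinearEquiv.apply_symm_apply]

include h𝔱 in
theorem finite_rootsIn : (rootsIn 𝔱 (⊤ : Submodule ℝ L)).Finite := by
  rw [← h𝔱.range_rootOf]; exact finite_range _

include h𝔱 in
theorem exists_smul_eq_of_mem_rootSub {α : ComplexDual 𝔱} (hα : α ∈ rootsIn 𝔱 ⊤) {ξ η : CLie L}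
    (hξ : ξ ∈ rootSub 𝔱 α) (hη : η ∈ rootSub 𝔱 α) (hne : ξ ≠ 0) : ∃ c : ℂ, c • ξ = η := by
  rw [← h𝔱.range_rootOf] at hα
  obtain ⟨i, rfl⟩ := hα
  have hi : i.1.IsNonZero := LieSubalgebra.isNonZero_coe_root i
  have h1 := IsKilling.finrank_rootSpace_eq_one i.1 hi
  have hξ' := h𝔱.mem_genWeightSpace_iff.2 hξ
  have hη' := h𝔱.mem_genWeightSpace_iff.2 hη
  obtain ⟨c, hc⟩ := (finrank_eq_one_iff_of_nonzero' (⟨ξ, hξ'⟩ : rootSpace h𝔱.cartan i.1)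
    (fun h => hne (congrArg Subtype.val h))).1 h1 ⟨η, hη'⟩
  exact ⟨c, congrArg Subtype.val hc⟩

include h𝔱 in
-- The root space decomposition, in the form used for spanning arguments.
theorem eq_top_of_rootSub_le {N : Submodule ℂ (CLie L)} (h0 : CLie.sub 𝔱 ≤ N)
    (hN : ∀ α ∈ rootsIn 𝔱 ⊤, rootSub 𝔱 α ≤ N) : N = ⊤ := by
  have h1 := LieModule.iSup_genWeightSpace_eq_top' ℂ h𝔱.cartan (CLie L)
  rw [← LieSubmodule.toSubmodule_inj, LieSubmodule.iSup_toSubmodule,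
    LieSubmodule.top_toSubmodule] at h1
  rw [eq_top_iff, ← h1, iSup_le_iff]
  intro w ξ hξ
  have h2 : ξ ∈ rootSub 𝔱 (h𝔱.dualEquiv w.toLinear) := h𝔱.mem_genWeightSpace_iff.1 hξ
  by_cases hw : h𝔱.dualEquiv w.toLinear = 0
  · rw [hw, h𝔱.rootSub_zero] at h2
    exact h0 h2
  · by_cases hne : ξ = 0
    · rw [hne]; exact N.zero_mem
    · exact hN _ (mem_rootsIn_top_iff.2 ⟨hw, ξ, h2, hne⟩) h2

include h𝔱 in
-- A weight space for `α` is orthogonal to every weight space except that for `-α`, so nondegeneracy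
-- must be realized there.
theorem exists_killingForm_ne_zero {α : ComplexDual 𝔱} {ξ : CLie L} (hξ : ξ ∈ rootSub 𝔱 α)
    (hne : ξ ≠ 0) : ∃ η ∈ rootSub 𝔱 (-α), killingForm ℂ (CLie L) ξ η ≠ 0 := by
  by_contra! hcon
  refine hne ?_
  have h1 : LinearMap.ker (killingForm ℂ (CLie L) ξ) = ⊤ := by
    have h2 : ∀ β, rootSub 𝔱 β ≤ LinearMap.ker (killingForm ℂ (CLie L) ξ) := fun β η hη => by
      by_cases h : α + β = 0
      · exact hcon η (by rwa [neg_eq_of_add_eq_zero_right h])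
      · exact killingForm_eq_zero_of_mem_rootSub hξ hη h
    exact h𝔱.eq_top_of_rootSub_le (by rw [← h𝔱.rootSub_zero]; exact h2 0) fun β _ => h2 β
  have h2 : ξ ∈ LinearMap.ker (killingForm ℂ (CLie L)) := LinearMap.ker_eq_top.1 h1
  simpa using h2

include h𝔱 in
theorem neg_mem_rootsIn {α : ComplexDual 𝔱} (hα : α ∈ rootsIn 𝔱 ⊤) : -α ∈ rootsIn 𝔱 ⊤ := by
  obtain ⟨h0, ξ, hξ, hne⟩ := mem_rootsIn_top_iff.1 hα
  obtain ⟨η, hη, h1⟩ := h𝔱.exists_killingForm_ne_zero hξ hne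
  exact mem_rootsIn_top_iff.2 ⟨neg_ne_zero.2 h0, η, hη, fun h => h1 (by simp [h])⟩

/-- Both `u` and the coroot span the orthogonal complement of `ker α`, and `α` takes the value `2`
on the coroot, which is therefore `(2 / α u) u`. -/
theorem eq_reflection_of_isRootReflection {i : h𝔱.cartan.root}
    {s : ComplexDual 𝔱 ≃ₗ[ℂ] ComplexDual 𝔱} (hs : IsRootReflection (h𝔱.rootOf i) s)
    (l : Module.Dual ℂ h𝔱.cartan) :
    s (h𝔱.dualEquiv l) = h𝔱.dualEquiv ((IsKilling.rootSystem h𝔱.cartan).reflection i l) := by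
  obtain ⟨u, hu, hker, hs⟩ := hs
  set α := h𝔱.rootOf i with hα
  have hαΔ : α ∈ rootsIn 𝔱 ⊤ := by rw [← h𝔱.range_rootOf]; exact ⟨i, rfl⟩
  let U : h𝔱.cartan := ⟨CLie.of (u : L), CLie.of_mem_sub.2 u.2⟩
  let a : Module.Dual ℂ h𝔱.cartan := (IsKilling.rootSystem h𝔱.cartan).root i
  have hau : a U = α u := rfl
  let c : h𝔱.cartan := IsKilling.coroot i.1
  have hac : a c = 2 := IsKilling.root_apply_coroot (α := i.1) (LieSubalgebra.isNonZero_coe_root i)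
  have hkU : ∀ h : h𝔱.cartan, a h = 0 → killingForm ℂ (CLie L) h (U : CLie L) = 0 := by
    intro h hh
    have h1 := h𝔱.dualEquiv_symm_apply α h
    rw [hα, rootOf, LinearEquiv.symm_apply_apply] at h1
    change a h = α _ + Complex.I * α _ at h1
    rw [hh] at h1
    -- Roots are imaginary on `𝔱`, so `α(re h) + i α(im h) = 0` forces both terms to vanish.
    have h2 := h𝔱.re_eq_zero hαΔ ⟨_, h.2.1⟩
    have h3 := h𝔱.re_eq_zero hαΔ ⟨_, h.2.2⟩
    have h4 : α ⟨_, h.2.1⟩ = 0 := by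
      have := congrArg Complex.im h1
      refine Complex.ext h2 ?_
      simpa [h3] using this.symm
    have h5 : α ⟨_, h.2.2⟩ = 0 := by
      have := congrArg Complex.re h1
      refine Complex.ext h3 ?_
      simpa [h2] using this.symm
    have h6 := hker _ h4
    have h7 := hker _ h5
    rw [show (U : CLie L) = CLie.of (u : L) from rfl, CLie.killingForm_of_right,
      LieModule.traceForm_comm, h6, LieModule.traceForm_comm, h7]
    simp
  have hkc : ∀ h : h𝔱.cartan, a h = 0 → killingForm ℂ (CLie L) h (c : CLie L) = 0 := by
    intro h hh
    have h1 := IsKilling.traceForm_coroot i.1 h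
    have h2 : i.1 h = 0 := hh
    rw [h2, smul_zero, smul_zero] at h1
    rw [LieModule.traceForm_comm]
    exact h1
  -- This difference lies in `ker α` and is orthogonal to `ker α`. It is therefore also orthogonal
  -- to `c`, hence to all of `𝔱_ℂ`, and vanishes.
  let d : h𝔱.cartan := c - (2 / α u) • U
  have had : a d = 0 := by
    simp only [d, map_sub, map_smul, hac, hau, smul_eq_mul]
    field_simp
    simp
  have hd : (d : CLie L) = (c : CLie L) - (2 / α u) • (U : CLie L) := rfl
  have hd0 : d = 0 := by
    have hz : ∀ h : h𝔱.cartan, killingForm ℂ (CLie L) d h = 0 := by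
      intro h
      have h1 : a (h - (a h / 2) • c) = 0 := by
        simp only [map_sub, map_smul, hac, smul_eq_mul]; ring
      have h2 : killingForm ℂ (CLie L) (h - (a h / 2) • c : h𝔱.cartan) (d : CLie L) = 0 := by
        have e1 := hkc _ h1
        have e2 := hkU _ h1
        rw [hd, map_sub, map_smul, e1, e2, smul_zero, sub_zero]
      have h3 := hkc d had
      rw [LieModule.traceForm_comm] at h2
      have h5 : ((h - (a h / 2) • c : h𝔱.cartan) : CLie L) =
        (h : CLie L) - (a h / 2) • (c : CLie L) := rfl
      rw [h5, map_sub, map_smul] at h2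
      have h4 : killingForm ℂ (CLie L) d h = (a h / 2) • killingForm ℂ (CLie L) d c :=
        sub_eq_zero.1 h2
      rw [h4, h3, smul_zero]
    have hnd := IsKilling.traceForm_cartan_nondegenerate ℂ (CLie L) h𝔱.cartan
    exact hnd.1 d fun h => hz h
  have hc : c = (2 / α u) • U := sub_eq_zero.1 hd0
  rw [hs, RootPairing.reflection_apply]
  rw [map_sub, map_smul]
  have h1 : (IsKilling.rootSystem h𝔱.cartan).coroot' i l = l c := rfl
  rw [h1, hc, map_smul, smul_eq_mul]
  have h2 : (2 * h𝔱.dualEquiv l u / α u) = 2 / α u * l U := by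
    rw [h𝔱.dualEquiv_apply]; ring
  rw [h2, hα, rootOf]

/-- Elements of the Weyl group, transported to the dual of the complexified Cartan subalgebra. -/
theorem exists_mem_closure_reflection {g : ComplexDual 𝔱 ≃ₗ[ℂ] ComplexDual 𝔱}
    (hg : g ∈ lieWeylGroup 𝔱) :
    ∃ g' ∈ Subgroup.closure (range (IsKilling.rootSystem h𝔱.cartan).reflection),
      ∀ l, g (h𝔱.dualEquiv l) = h𝔱.dualEquiv (g' l) := by
  induction hg using Subgroup.closure_induction with
  | mem s hs =>
    obtain ⟨α, hα, hs⟩ := hs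
    rw [← h𝔱.range_rootOf] at hα
    obtain ⟨i, rfl⟩ := hα
    exact ⟨_, Subgroup.subset_closure ⟨i, rfl⟩, h𝔱.eq_reflection_of_isRootReflection hs⟩
  | one => exact ⟨1, Subgroup.one_mem _, fun l => rfl⟩
  | mul x y _ _ hx hy =>
    obtain ⟨x', hx', ex⟩ := hx
    obtain ⟨y', hy', ey⟩ := hy
    refine ⟨x' * y', Subgroup.mul_mem _ hx' hy', fun l => ?_⟩
    rw [LinearEquiv.mul_apply, ey, ex, LinearEquiv.mul_apply]
  | inv x _ hx =>
    obtain ⟨x', hx', ex⟩ := hx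
    refine ⟨x'⁻¹, Subgroup.inv_mem _ hx', fun l => ?_⟩
    have h1 := ex (x'⁻¹ l)
    rw [← LinearEquiv.mul_apply x', mul_inv_cancel] at h1
    change _ = h𝔱.dualEquiv l at h1
    rw [← h1, ← LinearEquiv.mul_apply x⁻¹, inv_mul_cancel]
    rfl

include h𝔱 in
theorem weyl_apply_mem_rootsIn {g : ComplexDual 𝔱 ≃ₗ[ℂ] ComplexDual 𝔱}
    (hg : g ∈ lieWeylGroup 𝔱) {α : ComplexDual 𝔱} (hα : α ∈ rootsIn 𝔱 ⊤) : g α ∈ rootsIn 𝔱 ⊤ := by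
  induction hg using Subgroup.closure_induction generalizing α with
  | mem s hs =>
    obtain ⟨β, hβ, hs⟩ := hs
    rw [← h𝔱.range_rootOf] at hβ hα ⊢
    obtain ⟨i, rfl⟩ := hβ
    obtain ⟨j, rfl⟩ := hα
    refine ⟨(IsKilling.rootSystem h𝔱.cartan).reflectionPerm i j, ?_⟩
    rw [rootOf, rootOf, h𝔱.eq_reflection_of_isRootReflection hs, RootPairing.root_reflectionPerm]
  | one => exact hα
  | mul x y _ _ hx hy => exact hx (hy hα)
  | inv x _ hx =>
    -- An injective map of a finite set into itself is onto, so the inverse preserves the roots as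
    -- well.
    have h1 : x '' rootsIn 𝔱 ⊤ ⊆ rootsIn 𝔱 ⊤ := by rintro _ ⟨β, hβ, rfl⟩; exact hx hβ
    have h2 : x '' rootsIn 𝔱 ⊤ = rootsIn 𝔱 ⊤ := eq_of_subset_of_ncard_le h1
      (ncard_image_of_injective _ x.injective).ge h𝔱.finite_rootsIn
    rw [← h2] at hα
    obtain ⟨β, hβ, rfl⟩ := hα
    rw [← LinearEquiv.mul_apply, inv_mul_cancel]
    exact hβ

include h𝔱 in
/-- The Weyl group acts freely on systems of positive roots. -/
theorem weyl_eq_one {P : Set (ComplexDual 𝔱)} (hP : IsPositiveSystem 𝔱 P)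
    {g : ComplexDual 𝔱 ≃ₗ[ℂ] ComplexDual 𝔱} (hg : g ∈ lieWeylGroup 𝔱)
    (hgP : ∀ α ∈ P, g α ∈ P) : g = 1 := by
  obtain ⟨X₀, hreg, rfl⟩ := hP
  obtain ⟨g', hg', e⟩ := h𝔱.exists_mem_closure_reflection hg
  let f : Module.Dual ℝ (Module.Dual ℂ h𝔱.cartan) :=
    { toFun := fun l => (h𝔱.dualEquiv l X₀).im
      map_add' := fun l m => by rw [map_add, LinearMap.add_apply, Complex.add_im]
      map_smul' := fun r l => by
        change ((r • l) _).im = r • (l _).im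
        rw [LinearMap.smul_apply, Complex.smul_im] }
  have hfi : ∀ i, f ((IsKilling.rootSystem h𝔱.cartan).root i) = (h𝔱.rootOf i X₀).im := fun i => rfl
  have hmem : ∀ i, h𝔱.rootOf i ∈ rootsIn 𝔱 ⊤ := fun i => by
    rw [← h𝔱.range_rootOf]; exact ⟨i, rfl⟩
  obtain ⟨b, hb⟩ := (IsKilling.rootSystem h𝔱.cartan).exists_base_isPos_iff f fun i =>
    hreg _ (hmem i)
  have h1 : g' = 1 := by
    refine b.eq_one_of_forall_isPos hg' fun i k hi hk => ?_
    rw [hb, hfi] at hi ⊢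
    have h2 := (hgP _ ⟨hmem i, hi⟩).2
    rwa [rootOf, e, ← hk] at h2
  refine LinearEquiv.ext fun μ => ?_
  have h2 := e (h𝔱.dualEquiv.symm μ)
  rw [h1] at h2
  change _ = h𝔱.dualEquiv (h𝔱.dualEquiv.symm μ) at h2
  rwa [LinearEquiv.apply_symm_apply] at h2

end IsCompactCartan

end CartanRoots

/-! ### Algebras with anticommuting generators -/

section CliffordGenerators

variable {K A ι : Type*} [Field K] [Ring A] [Algebra K A] {e : ι → A} {ε : A →ₐ[K] A}

theorem map_mem_adjoin_image (hε : ∀ i, ε (e i) = -e i) (s : Set ι) {x : A}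
    (hx : x ∈ Algebra.adjoin K (e '' s)) : ε x ∈ Algebra.adjoin K (e '' s) := by
  have : Algebra.adjoin K (e '' s) ≤ (Algebra.adjoin K (e '' s)).comap ε := by
    refine Algebra.adjoin_le ?_
    rintro _ ⟨i, hi, rfl⟩
    change ε (e i) ∈ Algebra.adjoin K (e '' s)
    rw [hε]
    exact neg_mem (Algebra.subset_adjoin ⟨i, hi, rfl⟩)
  exact this hx

theorem mul_eq_mul_map_of_mem_adjoin (hε : ∀ i, ε (e i) = -e i)
    (hanti : ∀ i j, i ≠ j → e i * e j = -(e j * e i)) {s : Set ι} {j : ι} (hj : j ∉ s) {x : A}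
    (hx : x ∈ Algebra.adjoin K (e '' s)) : x * e j = e j * ε x := by
  induction hx using Algebra.adjoin_induction with
  | mem x hx =>
    obtain ⟨i, hi, rfl⟩ := hx
    rw [hε, hanti i j (fun h => hj (h ▸ hi)), mul_neg]
  | algebraMap r => rw [AlgHom.commutes, Algebra.commutes]
  | add x y _ _ hx hy => rw [add_mul, hx, hy, map_add, mul_add]
  | mul x y _ _ hx hy => rw [mul_assoc, hy, ← mul_assoc, hx, map_mul, mul_assoc]

/-- Elements of the smaller algebra move past `e j` at the cost of the grading automorphism `ε`, and
`e j * e j` is a scalar, so at most one factor `e j` remains. This drives the inductions on the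
number of generators. -/
theorem exists_eq_add_mul_of_mem_adjoin_insert {q : ι → K}
    (hsq : ∀ i, e i * e i = algebraMap K A (q i)) (hε : ∀ i, ε (e i) = -e i)
    (hanti : ∀ i j, i ≠ j → e i * e j = -(e j * e i)) {s : Set ι} {j : ι} (hj : j ∉ s) {x : A}
    (hx : x ∈ Algebra.adjoin K (e '' insert j s)) :
    ∃ a ∈ Algebra.adjoin K (e '' s), ∃ b ∈ Algebra.adjoin K (e '' s), x = a + e j * b := by
  induction hx using Algebra.adjoin_induction with
  | mem x hx =>
    obtain ⟨i, rfl | hi, rfl⟩ := hx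
    · exact ⟨0, zero_mem _, 1, one_mem _, by simp⟩
    · exact ⟨e i, Algebra.subset_adjoin ⟨i, hi, rfl⟩, 0, zero_mem _, by simp⟩
  | algebraMap r => exact ⟨_, Subalgebra.algebraMap_mem _ r, 0, zero_mem _, by simp⟩
  | add x y _ _ hx hy =>
    obtain ⟨a, ha, b, hb, rfl⟩ := hx
    obtain ⟨a', ha', b', hb', rfl⟩ := hy
    exact ⟨a + a', add_mem ha ha', b + b', add_mem hb hb', by rw [mul_add]; abel⟩
  | mul x y _ _ hx hy =>
    obtain ⟨a, ha, b, hb, rfl⟩ := hx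
    obtain ⟨a', ha', b', hb', rfl⟩ := hy
    have h1 := fun x hx => map_mem_adjoin_image (K := K) hε s (x := x) hx
    have h2 := fun x hx => mul_eq_mul_map_of_mem_adjoin hε hanti hj (x := x) hx
    refine ⟨a * a' + algebraMap K A (q j) * (ε b * b'), ?_, ε a * b' + b * a', ?_, ?_⟩
    · exact add_mem (mul_mem ha ha') (mul_mem (Subalgebra.algebraMap_mem _ _)
        (mul_mem (h1 _ hb) hb'))
    · exact add_mem (mul_mem (h1 _ ha) hb') (mul_mem hb ha')
    · have k1 : a * (e j * b') = e j * (ε a * b') := by rw [← mul_assoc, h2 a ha, mul_assoc]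
      have k2 : e j * b * (e j * b') = e j * e j * (ε b * b') := by
        rw [mul_assoc, ← mul_assoc b, h2 b hb, mul_assoc, mul_assoc]
      rw [← hsq j, add_mul, mul_add, mul_add, k1, k2, mul_add, mul_assoc (e j) b a']
      abel

theorem fg_adjoin_image {q : ι → K} (hsq : ∀ i, e i * e i = algebraMap K A (q i))
    (hε : ∀ i, ε (e i) = -e i) (hanti : ∀ i j, i ≠ j → e i * e j = -(e j * e i)) (s : Finset ι) :
    (Subalgebra.toSubmodule (Algebra.adjoin K (e '' (s : Set ι)))).FG := by
  classical
  induction s using Finset.induction_on with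
  | empty =>
    simp only [Finset.coe_empty, image_empty, Algebra.adjoin_empty]
    exact Subalgebra.fg_bot_toSubmodule
  | insert j s hj ih =>
    refine Submodule.FG.of_le (ih.sup (ih.map (LinearMap.mulLeft K (e j)))) fun x hx => ?_
    rw [Finset.coe_insert] at hx
    obtain ⟨a, ha, b, hb, rfl⟩ := exists_eq_add_mul_of_mem_adjoin_insert hsq hε hanti
      (by simpa using hj) hx
    exact Submodule.add_mem_sup ha (Submodule.mem_map.2 ⟨b, hb, rfl⟩)

/-- An even element that commutes with all generators is a scalar. -/
theorem mem_bot_of_forall_commute [NeZero (2 : K)] {q : ι → K}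
    (hsq : ∀ i, e i * e i = algebraMap K A (q i)) (hq : ∀ i, q i ≠ 0)
    (hε : ∀ i, ε (e i) = -e i) (hanti : ∀ i j, i ≠ j → e i * e j = -(e j * e i))
    (hε2 : ∀ x, ε (ε x) = x) (s : Finset ι) {u : A}
    (hu : u ∈ Algebra.adjoin K (e '' (s : Set ι))) (heven : ε u = u)
    (hcomm : ∀ i ∈ s, e i * u = u * e i) : u ∈ (⊥ : Subalgebra K A) := by
  classical
  induction s using Finset.induction_on generalizing u with
  | empty => simpa using hu
  | insert j s hj ih =>
    have h20 : (2 : K) ≠ 0 := NeZero.ne 2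
    have hj' : j ∉ (s : Set ι) := by simpa using hj
    rw [Finset.coe_insert] at hu
    obtain ⟨a', ha', b', hb', hu'⟩ := exists_eq_add_mul_of_mem_adjoin_insert hsq hε hanti hj' hu
    have hε' := fun x hx => map_mem_adjoin_image (K := K) hε (s : Set ι) (x := x) hx
    -- Averaging with `ε` makes `a` even and `b` odd, because `u` is even. Commuting with `e j` then
    -- reads `2 q(j) b = 0`.
    obtain ⟨a, ha, haε, b, hb, hbε, rfl⟩ : ∃ a ∈ Algebra.adjoin K (e '' (s : Set ι)),
        ε a = a ∧ ∃ b ∈ Algebra.adjoin K (e '' (s : Set ι)), ε b = -b ∧ u = a + e j * b := by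
      refine ⟨(2 : K)⁻¹ • (a' + ε a'), Subalgebra.smul_mem _ (add_mem ha' (hε' _ ha')) _, ?_,
        (2 : K)⁻¹ • (b' - ε b'), Subalgebra.smul_mem _ (sub_mem hb' (hε' _ hb')) _, ?_, ?_⟩
      · rw [map_smul, map_add, hε2, add_comm]
      · rw [map_smul, map_sub, hε2, ← smul_neg, neg_sub]
      · have h1 : u = (2 : K)⁻¹ • (u + ε u) := by
          rw [heven, ← two_smul K u, smul_smul, inv_mul_cancel₀ h20, one_smul]
        rw [h1, hu', map_add, map_mul, hε, mul_smul_comm, ← smul_add, mul_sub, neg_mul]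
        congr 1
        abel
    have h1 := hcomm j (Finset.mem_insert_self _ _)
    have h2 := mul_eq_mul_map_of_mem_adjoin hε hanti hj' ha
    have h3 := mul_eq_mul_map_of_mem_adjoin hε hanti hj' hb
    rw [mul_add, add_mul, h2, haε, ← mul_assoc, hsq, mul_assoc, h3, hbε, mul_neg, mul_neg,
      ← mul_assoc, hsq, add_right_inj, ← Algebra.smul_def, ← sub_eq_zero, sub_neg_eq_add,
      ← two_smul K, smul_smul, smul_eq_zero] at h1
    have hb0 : b = 0 := h1.resolve_left (mul_ne_zero h20 (hq j))
    rw [hb0, mul_zero, add_zero] at hcomm ⊢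
    exact ih ha haε fun i hi => hcomm i (Finset.mem_insert_of_mem hi)

end CliffordGenerators

/-! ### The Clifford algebra and the infinitesimal spin representation -/

section CliffordAlgebra

open CliffordAlgebra

variable {V : Type*} [AddCommGroup V] [Module ℝ V] {Q : QuadraticForm ℝ V} {ι' : Type*} [Finite ι']
  (v : Module.Basis ι' ℝ V) (hv : ∀ i j, i ≠ j → QuadraticMap.polar Q (v i) (v j) = 0)
include v hv

omit [Finite ι'] in
theorem ι_basis_anticommute (i j : ι') (h : i ≠ j) :
    ι Q (v i) * ι Q (v j) = -(ι Q (v j) * ι Q (v i)) := by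
  rw [eq_neg_iff_add_eq_zero, ι_mul_ι_add_swap, hv i j h, map_zero]

omit hv [Finite ι'] in
theorem adjoin_range_ι_basis : Algebra.adjoin ℝ (range fun i => ι Q (v i)) = ⊤ := by
  rw [eq_top_iff, ← adjoin_range_ι]
  refine Algebra.adjoin_le ?_
  rintro _ ⟨x, rfl⟩
  have h1 : x ∈ Submodule.span ℝ (range v) := by rw [v.span_eq]; trivial
  have h2 : Submodule.span ℝ (range v) ≤ (Subalgebra.toSubmodule
      (Algebra.adjoin ℝ (range fun i => ι Q (v i)))).comap (ι Q) := by
    refine Submodule.span_le.2 ?_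
    rintro _ ⟨i, rfl⟩
    exact Algebra.subset_adjoin ⟨i, rfl⟩
  exact h2 h1

theorem cliffordAlgebra_finite : Module.Finite ℝ (CliffordAlgebra Q) := by
  have := Fintype.ofFinite ι'
  have h := fg_adjoin_image (K := ℝ) (e := fun i => ι Q (v i)) (q := fun i => Q (v i))
    (ε := involute) (fun i => ι_sq_scalar Q _) (fun i => involute_ι _)
    (ι_basis_anticommute v hv) Finset.univ
  rw [Finset.coe_univ, image_univ, adjoin_range_ι_basis v, Algebra.top_toSubmodule] at h
  exact ⟨h⟩

/-- An even element of the Clifford algebra that is changed to its negative by reversion and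
commutes with all vectors vanishes. -/
theorem eq_zero_of_commute_ι (hQ : ∀ i, Q (v i) ≠ 0) {u : CliffordAlgebra Q}
    (heven : involute u = u) (hrev : reverse u = -u) (hcomm : ∀ x, ι Q x * u = u * ι Q x) :
    u = 0 := by
  have := Fintype.ofFinite ι'
  have h := mem_bot_of_forall_commute (K := ℝ) (e := fun i => ι Q (v i)) (q := fun i => Q (v i))
    (ε := involute) (fun i => ι_sq_scalar Q _) hQ (fun i => involute_ι _)
    (ι_basis_anticommute v hv) involute_involute Finset.univ (u := u)
    (by rw [Finset.coe_univ, image_univ, adjoin_range_ι_basis v]; trivial) heven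
    (fun i _ => hcomm _)
  -- So `u` is a scalar; reversion fixes scalars but negates `u`.
  obtain ⟨r, rfl⟩ := Algebra.mem_bot.1 h
  rw [reverse.commutes, eq_neg_iff_add_eq_zero, ← two_smul ℝ, smul_eq_zero] at hrev
  exact hrev.resolve_left two_ne_zero

omit v hv [Finite ι'] in
theorem ι_mul_ι_commutator (a b x : V) : ι Q a * ι Q b * ι Q x - ι Q x * (ι Q a * ι Q b) =
    QuadraticMap.polar Q b x • ι Q a - QuadraticMap.polar Q a x • ι Q b := by
  have h1 := ι_mul_ι_add_swap (Q := Q) b x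
  have h2 := ι_mul_ι_add_swap (Q := Q) a x
  rw [← eq_sub_iff_add_eq] at h1 h2
  rw [mul_assoc, h1, mul_sub, ← mul_assoc, h2, sub_mul, ← mul_assoc, ← Algebra.commutes,
    ← Algebra.smul_def, ← Algebra.smul_def]
  abel

omit [Finite ι'] in
theorem sum_polar_smul_basis [Fintype ι'] (hQ : ∀ i, Q (v i) ≠ 0) {M : Type*} [AddCommGroup M]
    [Module ℝ M] (g : V →ₗ[ℝ] M) (x : V) :
    ∑ i, ((Q (v i))⁻¹ * QuadraticMap.polar Q (v i) x) • g (v i) = (2 : ℝ) • g x := by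
  have h : ∀ i, (Q (v i))⁻¹ * QuadraticMap.polar Q (v i) x = 2 * v.repr x i := by
    intro i
    have h1 : QuadraticMap.polar Q (v i) x = ∑ j, v.repr x j * QuadraticMap.polar Q (v i) (v j) := by
      conv_lhs => rw [← v.sum_repr x]
      rw [← QuadraticMap.polarBilin_apply_apply, map_sum]
      simp
    rw [h1, Finset.sum_eq_single i (fun j _ hj => by rw [hv i j hj.symm, mul_zero]) (by simp),
      QuadraticMap.polar_self]
    rw [nsmul_eq_mul, Nat.cast_ofNat]
    field_simp [hQ i]
  simp only [h]
  conv_rhs => rw [← v.sum_repr x, map_sum, Finset.smul_sum]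
  simp only [map_smul, smul_smul]

omit hv [Finite ι'] in
/-- The element of the Clifford algebra whose commutator with vectors is a given skew-symmetric
endomorphism. -/
def spinOf [Fintype ι'] : Module.End ℝ V →ₗ[ℝ] CliffordAlgebra Q :=
  (-(1 / 4) : ℝ) • ∑ i, (Q (v i))⁻¹ • (LinearMap.mulLeft ℝ (ι Q (v i)) ∘ₗ ι Q ∘ₗ
    LinearMap.applyₗ (v i))

omit hv [Finite ι'] in
theorem spinOf_apply [Fintype ι'] (A : Module.End ℝ V) : spinOf (Q := Q) v A =
    (-(1 / 4) : ℝ) • ∑ i, (Q (v i))⁻¹ • (ι Q (v i) * ι Q (A (v i))) := by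
  simp [spinOf, LinearMap.sum_apply]

omit [Finite ι'] in
-- The commutator of `v i · A (v i)` with `x` has two terms; by skewness of `A`, each sums to an
-- expansion of `A x` in the orthogonal basis. As `polar Q y y = 2 Q y`, each contributes `-2`, and
-- the factor `-1/4` compensates.
theorem spinOf_commutator [Fintype ι'] (hQ : ∀ i, Q (v i) ≠ 0) {A : Module.End ℝ V}
    (hA : ∀ x y, QuadraticMap.polar Q (A x) y = -QuadraticMap.polar Q x (A y)) (x : V) :
    spinOf v A * ι Q x - ι Q x * spinOf v A = ι Q (A x) := by
  rw [spinOf_apply, smul_mul_assoc, mul_smul_comm, ← smul_sub, Finset.sum_mul, Finset.mul_sum,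
    ← Finset.sum_sub_distrib]
  have h : ∀ i, (Q (v i))⁻¹ • (ι Q (v i) * ι Q (A (v i))) * ι Q x -
      ι Q x * (Q (v i))⁻¹ • (ι Q (v i) * ι Q (A (v i))) =
      -(((Q (v i))⁻¹ * QuadraticMap.polar Q (v i) (A x)) • ι Q (v i)) -
      ((Q (v i))⁻¹ * QuadraticMap.polar Q (v i) x) • (ι Q ∘ₗ A) (v i) := by
    intro i
    rw [smul_mul_assoc, mul_smul_comm, ← smul_sub, ι_mul_ι_commutator, hA, smul_sub, smul_smul,
      smul_smul, mul_neg, neg_smul, LinearMap.comp_apply]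
  simp only [h]
  rw [Finset.sum_sub_distrib, Finset.sum_neg_distrib, sum_polar_smul_basis v hv hQ,
    sum_polar_smul_basis v hv hQ, LinearMap.comp_apply, ← neg_smul, ← sub_smul, smul_smul]
  norm_num

omit hv [Finite ι'] in
theorem involute_spinOf [Fintype ι'] (A : Module.End ℝ V) :
    involute (spinOf (Q := Q) v A) = spinOf v A := by
  simp only [spinOf_apply, map_smul, map_sum, map_mul, involute_ι, neg_mul_neg]

omit v hv [Finite ι'] in
theorem polar_apply_self {A : Module.End ℝ V}
    (hA : ∀ x y, QuadraticMap.polar Q (A x) y = -QuadraticMap.polar Q x (A y)) (x : V) :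
    QuadraticMap.polar Q x (A x) = 0 := by
  have := hA x x
  rw [QuadraticMap.polar_comm] at this
  linarith

omit hv [Finite ι'] in
-- Reversion exchanges `v i` and `A (v i)`, which are orthogonal by skewness and so anticommute.
theorem reverse_spinOf [Fintype ι'] {A : Module.End ℝ V}
    (hA : ∀ x y, QuadraticMap.polar Q (A x) y = -QuadraticMap.polar Q x (A y)) :
    reverse (spinOf (Q := Q) v A) = -spinOf v A := by
  simp only [spinOf_apply, map_smul, map_sum, reverse.map_mul, reverse_ι]
  rw [← smul_neg, ← Finset.sum_neg_distrib]
  congr 1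
  refine Finset.sum_congr rfl fun i _ => ?_
  have := ι_mul_ι_add_swap (Q := Q) (A (v i)) (v i)
  rw [QuadraticMap.polar_comm, polar_apply_self hA, map_zero] at this
  rw [← smul_neg, eq_neg_of_add_eq_zero_left this]

end CliffordAlgebra

/-! ### One-parameter groups and differential equations without a chosen norm -/

section OneParameter

/-- A continuous one-parameter subgroup of a Banach algebra is differentiable. -/
theorem exists_hasDerivAt_of_map_add {B : Type*} [NormedRing B] [NormedAlgebra ℝ B]
    [CompleteSpace B] {F : ℝ → B} (hF : Continuous F) (h0 : F 0 = 1)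
    (hadd : ∀ s t, F (s + t) = F s * F t) : ∃ D, HasDerivAt F D 0 := by
  set K : ℝ → B := fun u => ∫ x in (0 : ℝ)..u, F x with hK
  have hKd : ∀ t, HasDerivAt K (F t) t := fun t => (hF.integral_hasStrictDerivAt 0 t).hasDerivAt
  have hslope : Tendsto (fun t : ℝ => t⁻¹ • K t) (𝓝[≠] 0) (𝓝 1) := by
    have := (hKd 0).tendsto_slope_zero
    simpa [hK, h0] using this
  -- The mean of `F` over a short interval is near `1`, hence invertible. The group law gives `F t *
  -- K a = K (t + a) - K t`, which is differentiable in `t`, and `K a` can be divided out.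
  obtain ⟨a, hau, ha0⟩ : ∃ a : ℝ, IsUnit (a⁻¹ • K a) ∧ a ≠ 0 := by
    have h1 : ∀ᶠ t in 𝓝[≠] (0 : ℝ), IsUnit (t⁻¹ • K t) :=
      hslope.eventually (Units.isOpen.mem_nhds isUnit_one)
    exact (h1.and self_mem_nhdsWithin).exists
  obtain ⟨u, hu⟩ := hau
  have hKa : K a * (a⁻¹ • (↑u⁻¹ : B)) = 1 := by
    rw [mul_smul_comm, ← smul_mul_assoc, ← hu, Units.mul_inv]
  have hint : ∀ t, F t * K a = K (t + a) - K t := by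
    intro t
    have h1 : K (t + a) - K t = ∫ x in t..(t + a), F x := by
      rw [hK]
      exact intervalIntegral.integral_interval_sub_left (hF.intervalIntegrable _ _)
        (hF.intervalIntegrable _ _)
    rw [h1, hK]
    have h2 := intervalIntegral.integral_comp_add_left (a := 0) (b := a) F t
    rw [add_zero] at h2
    rw [← h2]
    simp only [hadd]
    exact ((ContinuousLinearMap.mul ℝ B (F t)).intervalIntegral_comp_comm
      (hF.intervalIntegrable (μ := MeasureTheory.volume) 0 a)).symm
  have hFeq : F = fun t => (K (t + a) - K t) * (a⁻¹ • (↑u⁻¹ : B)) := by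
    funext t
    rw [← hint, mul_assoc, hKa, mul_one]
  refine ⟨(F (0 + a) - F 0) * (a⁻¹ • (↑u⁻¹ : B)), ?_⟩
  have h2 : HasDerivAt (fun t => (K (t + a) - K t) * (a⁻¹ • (↑u⁻¹ : B)))
      ((F (0 + a) - F 0) * (a⁻¹ • (↑u⁻¹ : B))) 0 :=
    (((hKd (0 + a)).comp_add_const 0 a).sub (hKd 0)).mul_const _
  rwa [← hFeq] at h2

/-- A continuous one-parameter subgroup of a finite-dimensional algebra has a generator. -/
theorem exists_generator {A : Type*} [Ring A] [Algebra ℝ A] [Module.Finite ℝ A] {f : ℝ → A}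
    (hf : @Continuous ℝ A _ (moduleTopology ℝ A) f) (h0 : f 0 = 1)
    (hadd : ∀ s t, f (s + t) = f s * f t) :
    ∃ D, ∀ (φ : A →ₗ[ℝ] ℝ) t, HasDerivAt (fun s => φ (f s)) (φ (D * f t)) t := by
  classical
  let _ := moduleTopology ℝ A
  have _ : IsModuleTopology ℝ A := ⟨rfl⟩
  -- By the group law the derivative at `t` is that at `0`, with `φ` precomposed with right
  -- multiplication by `f t`.
  suffices h : ∃ D, ∀ φ : A →ₗ[ℝ] ℝ, HasDerivAt (fun s => φ (f s)) (φ D) 0 by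
    obtain ⟨D, hD⟩ := h
    refine ⟨D, fun φ t => ?_⟩
    have h1 := hD (φ ∘ₗ LinearMap.mulRight ℝ (f t))
    have h2 : (fun s => φ (f s)) = fun s => (φ ∘ₗ LinearMap.mulRight ℝ (f t)) (f (s - t)) := by
      funext s
      simp only [LinearMap.comp_apply, LinearMap.mulRight_apply, ← hadd, sub_add_cancel]
    rw [h2]
    rw [← sub_self t] at h1
    exact h1.comp_sub_const t t
  let e := (Module.finBasis ℝ A).equivFun
  let E := Fin (Module.finrank ℝ A) → ℝ
  -- The left regular representation embeds `A` in a Banach algebra; the linear left inverse `r`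
  -- brings the generator back.
  let l : A →ₐ[ℝ] (E →L[ℝ] E) :=
    ((Module.End.toContinuousLinearMap E).toAlgHom.comp (e.conjAlgEquiv ℝ).toAlgHom).comp
      (Algebra.lmul ℝ A)
  have hl : Function.Injective l := by
    refine (EquivLike.injective (Module.End.toContinuousLinearMap E)).comp
      ((EquivLike.injective (e.conjAlgEquiv ℝ)).comp ?_)
    exact Algebra.lmul_injective
  obtain ⟨r, hr⟩ := LinearMap.exists_leftInverse_of_injective l.toLinearMap
    (LinearMap.ker_eq_bot.2 hl)
  have hcont : Continuous fun t => l (f t) :=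
    (IsModuleTopology.continuous_of_linearMap l.toLinearMap).comp hf
  obtain ⟨D, hD⟩ := exists_hasDerivAt_of_map_add hcont (by rw [h0, map_one])
    (fun s t => by rw [hadd, map_mul])
  refine ⟨r D, fun φ => ?_⟩
  have h1 := (LinearMap.toContinuousLinearMap (φ ∘ₗ r)).hasFDerivAt.comp_hasDerivAt 0 hD
  have h2 : (fun s => φ (f s)) = (LinearMap.toContinuousLinearMap (φ ∘ₗ r)) ∘ fun s => l (f s) := by
    funext s
    change φ (f s) = φ ((r ∘ₗ l.toLinearMap) (f s))
    rw [hr, LinearMap.id_apply]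
  rw [h2]
  exact h1

variable {M : Type*} [AddCommGroup M] [Module ℝ M]

/-- Uniqueness for the linear equation `y' = B y`, where the derivative is taken coordinatewise. -/
theorem eq_zero_of_hasDerivAt_dual [Module.Finite ℝ M] {B : Module.End ℝ M} {y : ℝ → M}
    (hy : ∀ (φ : M →ₗ[ℝ] ℝ) t, HasDerivAt (fun s => φ (y s)) (φ (B (y t))) t) (h0 : y 0 = 0)
    (t : ℝ) : y t = 0 := by
  let e := (Module.finBasis ℝ M).equivFun
  let E := EuclideanSpace ℝ (Fin (Module.finrank ℝ M))
  let e' : M ≃ₗ[ℝ] E := e.trans (WithLp.linearEquiv 2 ℝ _).symm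
  let B' : E →L[ℝ] E := LinearMap.toContinuousLinearMap (e'.toLinearMap ∘ₗ B ∘ₗ e'.symm.toLinearMap)
  have h : ∀ t, HasDerivAt (fun s => e' (y s)) (B' (e' (y t))) t := by
    intro t
    have h1 : HasDerivAt (fun s => e (y s)) (e (B (y t))) t := by
      rw [hasDerivAt_pi]
      exact fun i => hy (LinearMap.proj i ∘ₗ e.toLinearMap) t
    have h2 := (PiLp.continuousLinearEquiv 2 ℝ (fun _ : Fin (Module.finrank ℝ M) =>
      ℝ)).symm.hasFDerivAt.comp_hasDerivAt t h1
    have h3 : B' (e' (y t)) = e' (B (y t)) := by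
      change e' (B (e'.symm (e' (y t)))) = _
      rw [e'.symm_apply_apply]
    rw [h3]
    exact h2
  have h1 := eq_exp_smul_apply_of_hasDerivAt B' h t
  rw [h0, map_zero, map_zero] at h1
  exact (LinearEquiv.map_eq_zero_iff e').1 h1

/-- The curve solves the induced equation in `M ⧸ U` with initial value zero. -/
theorem mem_of_hasDerivAt_dual [Module.Finite ℝ M] {B : Module.End ℝ M} {y : ℝ → M}
    (hy : ∀ (φ : M →ₗ[ℝ] ℝ) t, HasDerivAt (fun s => φ (y s)) (φ (B (y t))) t)
    {U : Submodule ℝ M} (hU : ∀ x ∈ U, B x ∈ U) (h0 : y 0 ∈ U) (t : ℝ) : y t ∈ U := by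
  rw [← Submodule.Quotient.mk_eq_zero]
  refine eq_zero_of_hasDerivAt_dual (M := M ⧸ U) (B := U.mapQ U B hU)
    (y := fun s => Submodule.Quotient.mk (y s)) (fun φ t => ?_)
    ((Submodule.Quotient.mk_eq_zero U).2 h0) t
  exact hy (φ ∘ₗ U.mkQ) t

theorem eq_of_forall_dual_eq {x y : M} (h : ∀ φ : M →ₗ[ℝ] ℝ, φ x = φ y) : x = y := by
  rw [← sub_eq_zero, ← Module.forall_dual_apply_eq_zero_iff ℝ]
  intro φ
  rw [map_sub, h, sub_self]

end OneParameter

/-! ### Roots of a symmetric pair of equal rank -/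

section SymmetricPair

variable {L : Type*} [LieRing L] [LieAlgebra ℝ L]

theorem CLie.lie_mem_sub {U V W : Submodule ℝ L} (h : ∀ x ∈ U, ∀ y ∈ V, ⁅x, y⁆ ∈ W) {ξ η : CLie L}
    (hξ : ξ ∈ sub U) (hη : η ∈ sub V) : ⁅ξ, η⁆ ∈ sub W := by
  rw [eq_re_add_im ξ, add_lie, smul_lie]
  exact add_mem ⟨by rw [re_lie_of]; exact h _ hξ.1 _ hη.1, by rw [im_lie_of]; exact h _ hξ.1 _ hη.2⟩
    (Submodule.smul_mem _ _
      ⟨by rw [re_lie_of]; exact h _ hξ.2 _ hη.1, by rw [im_lie_of]; exact h _ hξ.2 _ hη.2⟩)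

/-- The eigenspace decomposition of an involution. -/
structure IsSymmetricPair (𝔥 𝔭 : Submodule ℝ L) : Prop where
  isCompl : IsCompl 𝔥 𝔭
  lie_mem : ∀ x ∈ 𝔥, ∀ y ∈ 𝔥, ⁅x, y⁆ ∈ 𝔥
  lie_mem' : ∀ x ∈ 𝔥, ∀ y ∈ 𝔭, ⁅x, y⁆ ∈ 𝔭
  killingForm_eq_zero : ∀ x ∈ 𝔥, ∀ y ∈ 𝔭, killingForm ℝ L x y = 0

namespace IsSymmetricPair

variable {𝔱 𝔥 𝔭 : Submodule ℝ L} (h : IsSymmetricPair 𝔥 𝔭)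
include h

theorem eq_zero_of_mem_sub {ξ : CLie L} (h1 : ξ ∈ CLie.sub 𝔥) (h2 : ξ ∈ CLie.sub 𝔭) : ξ = 0 :=
  CLie.ext (by rw [map_zero]; exact Submodule.disjoint_def.1 h.isCompl.disjoint _ h1.1 h2.1)
    (by rw [map_zero]; exact Submodule.disjoint_def.1 h.isCompl.disjoint _ h1.2 h2.2)

theorem exists_add_eq (ξ : CLie L) : ∃ ξ₁ ∈ CLie.sub 𝔥, ∃ ξ₂ ∈ CLie.sub 𝔭, ξ₁ + ξ₂ = ξ := by
  have hd : ∀ x : L, ∃ a ∈ 𝔥, ∃ b ∈ 𝔭, a + b = x := fun x => by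
    rw [← Submodule.mem_sup, h.isCompl.sup_eq_top]; trivial
  obtain ⟨a, ha, b, hb, h1⟩ := hd (CLie.re ξ)
  obtain ⟨a', ha', b', hb', h2⟩ := hd (CLie.im ξ)
  refine ⟨CLie.of a + Complex.I • CLie.of a', add_mem (CLie.of_mem_sub.2 ha)
    (Submodule.smul_mem _ _ (CLie.of_mem_sub.2 ha')), CLie.of b + Complex.I • CLie.of b',
    add_mem (CLie.of_mem_sub.2 hb) (Submodule.smul_mem _ _ (CLie.of_mem_sub.2 hb')), ?_⟩
  rw [CLie.eq_re_add_im ξ, ← h1, ← h2, map_add, map_add, smul_add]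
  abel

theorem killingForm_eq_zero_of_mem_sub [Module.Finite ℝ L] {ξ η : CLie L} (hξ : ξ ∈ CLie.sub 𝔥)
    (hη : η ∈ CLie.sub 𝔭) : killingForm ℂ (CLie L) ξ η = 0 := by
  rw [CLie.eq_re_add_im η, map_add, map_smul, CLie.killingForm_of_right,
    CLie.killingForm_of_right, h.killingForm_eq_zero _ hξ.1 _ hη.1,
    h.killingForm_eq_zero _ hξ.2 _ hη.1, h.killingForm_eq_zero _ hξ.1 _ hη.2,
    h.killingForm_eq_zero _ hξ.2 _ hη.2]
  simp

variable [Module.Finite ℝ L] [LieAlgebra.IsKilling ℝ L] (h𝔱 : IsCompactCartan 𝔱) (hle : 𝔱 ≤ 𝔥)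

include h𝔱 hle in
-- Since `ad 𝔱` preserves `𝔥` and `𝔭`, both components of a root vector have weight `α`; the root
-- space is a line, so a nonzero component spans it.
theorem rootSub_le_or {α : ComplexDual 𝔱} (hα : α ∈ rootsIn 𝔱 ⊤) :
    rootSub 𝔱 α ≤ CLie.sub 𝔥 ∨ rootSub 𝔱 α ≤ CLie.sub 𝔭 := by
  obtain ⟨-, ξ, hξ, hne⟩ := mem_rootsIn_top_iff.1 hα
  obtain ⟨ξ₁, h1, ξ₂, h2, rfl⟩ := h.exists_add_eq ξ
  have key : ∀ X : 𝔱, ⁅CLie.of (X : L), ξ₁⁆ = α X • ξ₁ ∧ ⁅CLie.of (X : L), ξ₂⁆ = α X • ξ₂ := by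
    intro X
    have e := hξ X
    have hX : CLie.of (X : L) ∈ CLie.sub 𝔥 := CLie.of_mem_sub.2 (hle X.2)
    have k1 := CLie.lie_mem_sub h.lie_mem hX h1
    have k2 := CLie.lie_mem_sub h.lie_mem' hX h2
    rw [lie_add, smul_add] at e
    have e' : ⁅CLie.of (X : L), ξ₁⁆ - α X • ξ₁ = α X • ξ₂ - ⁅CLie.of (X : L), ξ₂⁆ := by
      rw [sub_eq_sub_iff_add_eq_add, e, add_comm]
    have z := h.eq_zero_of_mem_sub (sub_mem k1 (Submodule.smul_mem _ (α X) h1))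
      (by rw [e']; exact sub_mem (Submodule.smul_mem _ _ h2) k2)
    refine ⟨sub_eq_zero.1 z, ?_⟩
    rw [z] at e'
    exact (sub_eq_zero.1 e'.symm).symm
  by_cases h0 : ξ₁ = 0
  · right
    intro η hη
    obtain ⟨c, rfl⟩ := h𝔱.exists_smul_eq_of_mem_rootSub hα (fun X => (key X).2) hη
      (fun h => hne (by rw [h0, h, add_zero]))
    exact Submodule.smul_mem _ _ h2
  · left
    intro η hη
    obtain ⟨c, rfl⟩ := h𝔱.exists_smul_eq_of_mem_rootSub hα (fun X => (key X).1) hη h0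
    exact Submodule.smul_mem _ _ h1

omit h [Module.Finite ℝ L] [LieAlgebra.IsKilling ℝ L] in
theorem _root_.rootsIn_subset_top {U : Submodule ℝ L} : rootsIn 𝔱 U ⊆ rootsIn 𝔱 ⊤ := by
  intro α hα
  obtain ⟨h0, ξ, -, hne, hξ⟩ := mem_rootsIn_iff.1 hα
  exact mem_rootsIn_top_iff.2 ⟨h0, ξ, hξ, hne⟩

omit h [Module.Finite ℝ L] [LieAlgebra.IsKilling ℝ L] in
theorem _root_.mem_rootsIn_of_rootSub_le {U : Submodule ℝ L} {α : ComplexDual 𝔱}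
    (hα : α ∈ rootsIn 𝔱 ⊤) (hU : rootSub 𝔱 α ≤ CLie.sub U) : α ∈ rootsIn 𝔱 U := by
  obtain ⟨h0, ξ, hξ, hne⟩ := mem_rootsIn_top_iff.1 hα
  exact mem_rootsIn_iff.2 ⟨h0, ξ, hU hξ, hne, hξ⟩

omit h in
include h𝔱 in
theorem _root_.IsCompactCartan.rootSub_le_of_mem_rootsIn {U : Submodule ℝ L} {α : ComplexDual 𝔱}
    (hα : α ∈ rootsIn 𝔱 U) : rootSub 𝔱 α ≤ CLie.sub U := by
  obtain ⟨-, ξ, hU, hne, hξ⟩ := mem_rootsIn_iff.1 hα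
  intro η hη
  obtain ⟨c, rfl⟩ := h𝔱.exists_smul_eq_of_mem_rootSub (rootsIn_subset_top hα) hξ hη hne
  exact Submodule.smul_mem _ _ hU

include h𝔱 hle in
theorem mem_or_mem {α : ComplexDual 𝔱} (hα : α ∈ rootsIn 𝔱 ⊤) :
    α ∈ rootsIn 𝔱 𝔥 ∨ α ∈ rootsIn 𝔱 𝔭 :=
  (h.rootSub_le_or h𝔱 hle hα).imp (mem_rootsIn_of_rootSub_le hα) (mem_rootsIn_of_rootSub_le hα)

include h𝔱 in
theorem notMem_of_mem {α : ComplexDual 𝔱} (hα : α ∈ rootsIn 𝔱 𝔥) : α ∉ rootsIn 𝔱 𝔭 := by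
  intro hα'
  obtain ⟨-, ξ, hU, hne, hξ⟩ := mem_rootsIn_iff.1 hα
  exact hne (h.eq_zero_of_mem_sub hU (h𝔱.rootSub_le_of_mem_rootsIn hα' hξ))

include h𝔱 hle in
-- Root vectors for `α` and `-α` pair nontrivially, whereas `𝔥` and `𝔭` are orthogonal.
theorem neg_mem_rootsIn_p {α : ComplexDual 𝔱} (hα : α ∈ rootsIn 𝔱 𝔭) : -α ∈ rootsIn 𝔱 𝔭 := by
  have hn := h𝔱.neg_mem_rootsIn (rootsIn_subset_top hα)
  obtain ⟨-, ξ, hU, hne, hξ⟩ := mem_rootsIn_iff.1 hα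
  refine (h.mem_or_mem h𝔱 hle hn).resolve_left fun hh => ?_
  obtain ⟨η, hη, h1⟩ := h𝔱.exists_killingForm_ne_zero hξ hne
  rw [LieModule.traceForm_comm] at h1
  exact h1 (h.killingForm_eq_zero_of_mem_sub (h𝔱.rootSub_le_of_mem_rootsIn hh hη) hU)

include h𝔱 hle in
theorem neg_mem_rootsIn_h {α : ComplexDual 𝔱} (hα : α ∈ rootsIn 𝔱 𝔥) : -α ∈ rootsIn 𝔱 𝔥 := by
  have hn := h𝔱.neg_mem_rootsIn (rootsIn_subset_top hα)
  refine (h.mem_or_mem h𝔱 hle hn).resolve_right fun hh => ?_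
  have := h.neg_mem_rootsIn_p h𝔱 hle hh
  rw [neg_neg] at this
  exact h.notMem_of_mem h𝔱 hα this

include h𝔱 hle in
-- This is where equality of ranks enters: `𝔱 ≤ 𝔥`, so `𝔭_ℂ` is spanned by root vectors alone.
theorem sub_p_le {N : Submodule ℂ (CLie L)} (hN : ∀ α ∈ rootsIn 𝔱 𝔭, rootSub 𝔱 α ≤ N) :
    CLie.sub 𝔭 ≤ N := by
  have h1 : CLie.sub 𝔥 ⊔ (N ⊓ CLie.sub 𝔭) = ⊤ := by
    refine h𝔱.eq_top_of_rootSub_le (le_sup_of_le_left fun ξ hξ => ⟨hle hξ.1, hle hξ.2⟩)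
      fun α hα => ?_
    rcases h.mem_or_mem h𝔱 hle hα with h2 | h2
    · exact le_sup_of_le_left (h𝔱.rootSub_le_of_mem_rootsIn h2)
    · exact le_sup_of_le_right (le_inf (hN α h2) (h𝔱.rootSub_le_of_mem_rootsIn h2))
  intro ξ hξ
  obtain ⟨a, ha, b, hb, rfl⟩ := Submodule.mem_sup.1 (h1 ▸ Submodule.mem_top : ξ ∈ _)
  have ha0 := h.eq_zero_of_mem_sub ha (by simpa using sub_mem hξ hb.2)
  rw [ha0, zero_add]
  exact hb.1

include h𝔱 hle in
theorem sub_h_le {N : Submodule ℂ (CLie L)} (h0 : CLie.sub 𝔱 ≤ N)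
    (hN : ∀ α ∈ rootsIn 𝔱 𝔥, rootSub 𝔱 α ≤ N) : CLie.sub 𝔥 ≤ N := by
  have h1 : (N ⊓ CLie.sub 𝔥) ⊔ CLie.sub 𝔭 = ⊤ := by
    refine h𝔱.eq_top_of_rootSub_le
      (le_sup_of_le_left (le_inf h0 fun ξ hξ => ⟨hle hξ.1, hle hξ.2⟩)) fun α hα => ?_
    rcases h.mem_or_mem h𝔱 hle hα with h2 | h2
    · exact le_sup_of_le_left (le_inf (hN α h2) (h𝔱.rootSub_le_of_mem_rootsIn h2))
    · exact le_sup_of_le_right (h𝔱.rootSub_le_of_mem_rootsIn h2)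
  intro ξ hξ
  obtain ⟨a, ha, b, hb, rfl⟩ := Submodule.mem_sup.1 (h1 ▸ Submodule.mem_top : ξ ∈ _)
  have hb0 := h.eq_zero_of_mem_sub (by simpa using sub_mem hξ ha.2) hb
  rw [hb0, add_zero]
  exact ha.1

end IsSymmetricPair

end SymmetricPair

/-! ### Canonical anticommutation relations -/

section Fock

variable {ι S : Type*} [AddCommGroup S] [Module ℂ S] [Nontrivial S] (a b : ι → Module.End ℂ S)
  (s : Finset ι)

/-- Finitely many anticommuting operators of square zero have a common null vector. -/
theorem exists_forall_apply_eq_zero (haa : ∀ i ∈ s, ∀ j ∈ s, a i * a j + a j * a i = 0) :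
    ∃ v : S, v ≠ 0 ∧ ∀ i ∈ s, a i v = 0 := by
  classical
  induction s using Finset.induction_on with
  | empty =>
    obtain ⟨v, hv⟩ := exists_ne (0 : S)
    exact ⟨v, hv, by simp⟩
  | insert j s hj ih =>
    obtain ⟨v, hv, h0⟩ := ih fun i hi k hk => haa i (Finset.mem_insert_of_mem hi) k
      (Finset.mem_insert_of_mem hk)
    by_cases hz : a j v = 0
    · exact ⟨v, hv, by simpa [Finset.forall_mem_insert] using ⟨hz, h0⟩⟩
    -- `a j v` is killed by `a j`, whose square is zero, and by the other `a i`, which anticommute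
    -- with `a j` and kill `v`.
    · refine ⟨a j v, hz, fun i hi => ?_⟩
      rcases Finset.mem_insert.1 hi with rfl | hi
      · have h1 := LinearMap.congr_fun (haa i (Finset.mem_insert_self _ _) i
          (Finset.mem_insert_self _ _)) v
        rw [← two_smul ℂ (a i * a i), LinearMap.smul_apply, LinearMap.zero_apply,
          smul_eq_zero] at h1
        exact h1.resolve_left two_ne_zero
      · have h1 := LinearMap.congr_fun (haa i (Finset.mem_insert_of_mem hi) j
          (Finset.mem_insert_self _ _)) v
        simpa [h0 i hi] using h1

omit [Nontrivial S] in
/-- An irreducible module over the canonical anticommutation relations is generated from the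
vacuum by the creation operators. -/
theorem eq_top_of_forall_creation_mem [DecidableEq ι]
    (hab : ∀ i ∈ s, ∀ j ∈ s, a i * b j + b j * a i = if i = j then 1 else 0)
    (hirr : ∀ W : Submodule ℂ S, (∀ i ∈ s, ∀ x ∈ W, a i x ∈ W) → (∀ i ∈ s, ∀ x ∈ W, b i x ∈ W) →
      W = ⊥ ∨ W = ⊤) {v : S} (hv : v ≠ 0) (h0 : ∀ i ∈ s, a i v = 0) {W : Submodule ℂ S}
    (hvW : v ∈ W) (hW : ∀ i ∈ s, ∀ x ∈ W, b i x ∈ W) : W = ⊤ := by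
  -- The smallest submodule containing the vacuum and stable under creation. The anticommutation
  -- relations make it stable under annihilation too, so it is everything by irreducibility.
  set U : Submodule ℂ S := sInf {W | v ∈ W ∧ ∀ i ∈ s, ∀ x ∈ W, b i x ∈ W} with hU
  have hUle : ∀ W' : Submodule ℂ S, v ∈ W' → (∀ i ∈ s, ∀ x ∈ W', b i x ∈ W') → U ≤ W' :=
    fun W' h1 h2 => sInf_le ⟨h1, h2⟩
  have hvU : v ∈ U := Submodule.mem_sInf.2 fun W' h => h.1
  have hbU : ∀ i ∈ s, ∀ x ∈ U, b i x ∈ U := fun i hi x hx =>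
    Submodule.mem_sInf.2 fun W' h => h.2 i hi x (Submodule.mem_sInf.1 hx W' h)
  have haU : ∀ i ∈ s, ∀ x ∈ U, a i x ∈ U := by
    let U' : Submodule ℂ S :=
      { carrier := {x | x ∈ U ∧ ∀ i ∈ s, a i x ∈ U}
        add_mem' := fun h1 h2 => ⟨add_mem h1.1 h2.1, fun i hi => by
          rw [map_add]; exact add_mem (h1.2 i hi) (h2.2 i hi)⟩
        zero_mem' := ⟨zero_mem _, fun i _ => by rw [map_zero]; exact zero_mem _⟩
        smul_mem' := fun c x h1 => ⟨Submodule.smul_mem _ _ h1.1, fun i hi => by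
          rw [map_smul]; exact Submodule.smul_mem _ _ (h1.2 i hi)⟩ }
    have h1 : U ≤ U' := by
      refine hUle U' ⟨hvU, fun i hi => by rw [h0 i hi]; exact zero_mem _⟩ fun j hj x hx =>
        ⟨hbU j hj x hx.1, fun i hi => ?_⟩
      have h2 := LinearMap.congr_fun (hab i hi j hj) x
      rw [LinearMap.add_apply, Module.End.mul_apply, Module.End.mul_apply,
        ← eq_sub_iff_add_eq] at h2
      rw [h2]
      refine sub_mem ?_ (hbU j hj _ (hx.2 i hi))
      split_ifs
      · exact hx.1
      · exact zero_mem _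
    exact fun i hi x hx => (h1 hx).2 i hi
  have hUtop : U = ⊤ := (hirr U haU hbU).resolve_left fun h => hv (by
    rw [h] at hvU; exact hvU)
  rw [eq_top_iff, ← hUtop]
  exact hUle W hvW hW

end Fock

/-! ### The Clifford action of `𝔭` and the spin action of `𝔥` -/

section SpinModule

variable {L : Type*} [LieRing L] [LieAlgebra ℝ L] {S : Type*} [AddCommGroup S] [Module ℂ S]

/-- The action `c` of `𝔭` by Clifford multiplication on spinors, and the infinitesimal spin
representation `D` of `𝔥`. -/
structure IsSpinModule (𝔥 𝔭 : Submodule ℝ L) (c D : CLie L →ₗ[ℂ] Module.End ℂ S) : Prop where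
  finite : Module.Finite ℂ S
  nontrivial : Nontrivial S
  cliff : ∀ x ∈ 𝔭, ∀ y ∈ 𝔭, c (CLie.of x) * c (CLie.of y) + c (CLie.of y) * c (CLie.of x) =
    (2 * (killingForm ℝ L x y : ℂ)) • 1
  comm : ∀ x ∈ 𝔥, ∀ y ∈ 𝔭, D (CLie.of x) * c (CLie.of y) - c (CLie.of y) * D (CLie.of x) =
    c (CLie.of ⁅x, y⁆)
  trace : ∀ x ∈ 𝔥, LinearMap.trace ℂ S (D (CLie.of x)) = 0
  irred : ∀ W : Submodule ℂ S, (∀ x ∈ 𝔭, ∀ v ∈ W, c (CLie.of x) v ∈ W) → W = ⊥ ∨ W = ⊤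
  compl : ∀ W : Submodule ℂ S, (∀ x ∈ 𝔥, ∀ v ∈ W, D (CLie.of x) v ∈ W) →
    ∃ W' : Submodule ℂ S, (∀ x ∈ 𝔥, ∀ v ∈ W', D (CLie.of x) v ∈ W') ∧ IsCompl W W'

theorem CLie.sub_le {U : Submodule ℝ L} {N : Submodule ℂ (CLie L)} (h : ∀ x ∈ U, of x ∈ N) :
    sub U ≤ N := by
  rw [sub_eq_span]
  exact Submodule.span_le.2 (by rintro _ ⟨x, hx, rfl⟩; exact h x hx)

namespace IsSpinModule

variable {𝔱 𝔥 𝔭 : Submodule ℝ L} {c D : CLie L →ₗ[ℂ] Module.End ℂ S} (h : IsSpinModule 𝔥 𝔭 c D)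
include h

/-- Schur's lemma for operators of trace zero. -/
theorem eq_zero_of_commute {T : Module.End ℂ S} (hT : LinearMap.trace ℂ S T = 0)
    (hc : ∀ x ∈ 𝔭, T * c (CLie.of x) = c (CLie.of x) * T) : T = 0 := by
  have := h.finite
  have := h.nontrivial
  obtain ⟨z, hz⟩ := Module.End.exists_eigenvalue T
  have h1 : Module.End.eigenspace T z = ⊤ := by
    refine (h.irred _ fun x hx v hv => ?_).resolve_left hz
    rw [Module.End.mem_eigenspace_iff] at hv ⊢
    have := LinearMap.congr_fun (hc x hx) v
    rw [Module.End.mul_apply, Module.End.mul_apply, hv, map_smul] at this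
    exact this
  have h2 : T = z • 1 := by
    ext v
    exact Module.End.mem_eigenspace_iff.1 (h1 ▸ Submodule.mem_top : v ∈ T.eigenspace z)
  rw [h2, map_smul, LinearMap.trace_one, smul_eq_mul, mul_eq_zero] at hT
  have h3 : (Module.finrank ℂ S : ℂ) ≠ 0 := Nat.cast_ne_zero.2 Module.finrank_pos.ne'
  rw [h2, hT.resolve_right h3, zero_smul]

theorem trace_sub {ξ : CLie L} (hξ : ξ ∈ CLie.sub 𝔥) : LinearMap.trace ℂ S (D ξ) = 0 :=
  CLie.sub_le (N := LinearMap.ker (LinearMap.trace ℂ S ∘ₗ D)) h.trace hξ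

theorem comm_sub {ξ η : CLie L} (hξ : ξ ∈ CLie.sub 𝔥) (hη : η ∈ CLie.sub 𝔭) :
    D ξ * c η - c η * D ξ = c ⁅ξ, η⁆ := by
  have h1 : ∀ y ∈ 𝔭, D ξ * c (CLie.of y) - c (CLie.of y) * D ξ = c ⁅ξ, CLie.of y⁆ := by
    intro y hy
    rw [CLie.eq_re_add_im ξ, add_lie, smul_lie, map_add, map_smul, map_add c, map_smul c,
      ← CLie.of_lie, ← CLie.of_lie, ← h.comm _ hξ.1 _ hy, ← h.comm _ hξ.2 _ hy, add_mul, mul_add,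
      smul_mul_assoc, mul_smul_comm, smul_sub]
    abel
  rw [CLie.eq_re_add_im η, lie_add, lie_smul, map_add, map_smul, map_add c, map_smul c,
    ← h1 _ hη.1, ← h1 _ hη.2, add_mul, mul_add, smul_mul_assoc, mul_smul_comm, smul_sub]
  abel

theorem cliff_sub [Module.Finite ℝ L] {ξ η : CLie L} (hξ : ξ ∈ CLie.sub 𝔭) (hη : η ∈ CLie.sub 𝔭) :
    c ξ * c η + c η * c ξ = (2 * killingForm ℂ (CLie L) ξ η) • 1 := by
  have h1 : ∀ y ∈ 𝔭, c ξ * c (CLie.of y) + c (CLie.of y) * c ξ =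
      (2 * killingForm ℂ (CLie L) ξ (CLie.of y)) • 1 := by
    intro y hy
    have e : c ξ * c (CLie.of y) + c (CLie.of y) * c ξ =
        (c (CLie.of (CLie.re ξ)) * c (CLie.of y) + c (CLie.of y) * c (CLie.of (CLie.re ξ))) +
        Complex.I • (c (CLie.of (CLie.im ξ)) * c (CLie.of y) +
          c (CLie.of y) * c (CLie.of (CLie.im ξ))) := by
      conv_lhs => rw [CLie.eq_re_add_im ξ, map_add, map_smul, add_mul, mul_add,
        smul_mul_assoc, mul_smul_comm]
      rw [smul_add]
      abel
    rw [e, h.cliff _ hξ.1 _ hy, h.cliff _ hξ.2 _ hy, CLie.killingForm_of_right, smul_smul,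
      ← add_smul]
    congr 1
    ring
  have e : c ξ * c η + c η * c ξ =
      (c ξ * c (CLie.of (CLie.re η)) + c (CLie.of (CLie.re η)) * c ξ) +
      Complex.I • (c ξ * c (CLie.of (CLie.im η)) + c (CLie.of (CLie.im η)) * c ξ) := by
    conv_lhs => rw [CLie.eq_re_add_im η, map_add, map_smul, add_mul, mul_add,
      smul_mul_assoc, mul_smul_comm]
    rw [smul_add]
    abel
  rw [e, h1 _ hη.1, h1 _ hη.2, smul_smul, ← add_smul]
  congr 1
  conv_rhs => rw [CLie.eq_re_add_im η, map_add, map_smul, smul_eq_mul]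
  ring

/-- By the Jacobi identity both sides have the same commutators with the Clifford action, and both
have trace zero; Schur's lemma applies to their difference. -/
theorem map_lie (hp : IsSymmetricPair 𝔥 𝔭) {ξ η : CLie L} (hξ : ξ ∈ CLie.sub 𝔥)
    (hη : η ∈ CLie.sub 𝔥) : D ⁅ξ, η⁆ = D ξ * D η - D η * D ξ := by
  have := h.finite
  rw [← sub_eq_zero]
  refine h.eq_zero_of_commute ?_ fun x hx => ?_
  · rw [map_sub, h.trace_sub (CLie.lie_mem_sub hp.lie_mem hξ hη), map_sub,
      LinearMap.trace_mul_comm, sub_self, sub_self]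
  · have hx' : CLie.of x ∈ CLie.sub 𝔭 := CLie.of_mem_sub.2 hx
    have e1 := h.comm_sub (CLie.lie_mem_sub hp.lie_mem hξ hη) hx'
    have e2 := h.comm_sub hξ hx'
    have e3 := h.comm_sub hη hx'
    have e4 := h.comm_sub hξ (CLie.lie_mem_sub hp.lie_mem' hη hx')
    have e5 := h.comm_sub hη (CLie.lie_mem_sub hp.lie_mem' hξ hx')
    rw [lie_lie, map_sub c, ← e4, ← e5, ← e2, ← e3] at e1
    rw [← sub_eq_zero] at e1 ⊢
    rw [← e1]
    noncomm_ring

theorem apply_eigenspace {ξ η : CLie L} (hξ : ξ ∈ CLie.sub 𝔥) (hη : η ∈ CLie.sub 𝔭) {r z : ℂ}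
    (hr : ⁅ξ, η⁆ = r • η) {x : S} (hx : D ξ x = z • x) : D ξ (c η x) = (z + r) • c η x := by
  have e := LinearMap.congr_fun (h.comm_sub hξ hη) x
  rw [LinearMap.sub_apply, Module.End.mul_apply, Module.End.mul_apply, hx, hr, map_smul, map_smul,
    LinearMap.smul_apply, sub_eq_iff_eq_add] at e
  rw [e, add_smul, add_comm]

theorem apply_eigenspace' (hp : IsSymmetricPair 𝔥 𝔭) {ξ η : CLie L} (hξ : ξ ∈ CLie.sub 𝔥)
    (hη : η ∈ CLie.sub 𝔥) {r z : ℂ} (hr : ⁅ξ, η⁆ = r • η) {x : S} (hx : D ξ x = z • x) :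
    D ξ (D η x) = (z + r) • D η x := by
  have e := LinearMap.congr_fun (h.map_lie hp hξ hη) x
  rw [LinearMap.sub_apply, Module.End.mul_apply, Module.End.mul_apply, hx, hr, map_smul, map_smul,
    LinearMap.smul_apply, eq_sub_iff_add_eq] at e
  rw [← e, add_smul, add_comm]

end IsSpinModule

end SpinModule

/-! ### The vacuum vector and its weight -/

section HighestWeight

variable {L : Type*} [LieRing L] [LieAlgebra ℝ L] [Module.Finite ℝ L] [LieAlgebra.IsKilling ℝ L]
  {S : Type*} [AddCommGroup S] [Module ℂ S]

/-- The factor `2` matches the Clifford relation `c ξ c η + c η c ξ = 2 B(ξ, η)`, so that `c (e α)`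
and `c (f α)` satisfy the canonical anticommutation relation. -/
theorem IsCompactCartan.exists_normalized {𝔱 U : Submodule ℝ L} (h𝔱 : IsCompactCartan 𝔱) :
    ∃ e f : ComplexDual 𝔱 → CLie L, ∀ α ∈ rootsIn 𝔱 U, e α ∈ rootSub 𝔱 α ∧
      f α ∈ rootSub 𝔱 (-α) ∧ 2 * killingForm ℂ (CLie L) (e α) (f α) = 1 := by
  have key : ∀ α, ∃ p : CLie L × CLie L, α ∈ rootsIn 𝔱 U → p.1 ∈ rootSub 𝔱 α ∧
      p.2 ∈ rootSub 𝔱 (-α) ∧ 2 * killingForm ℂ (CLie L) p.1 p.2 = 1 := by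
    intro α
    by_cases hα : α ∈ rootsIn 𝔱 U
    · obtain ⟨-, ξ, -, hne, hξ⟩ := mem_rootsIn_iff.1 hα
      obtain ⟨η, hη, h0⟩ := h𝔱.exists_killingForm_ne_zero hξ hne
      refine ⟨(ξ, (2 * killingForm ℂ (CLie L) ξ η)⁻¹ • η), fun _ =>
        ⟨hξ, Submodule.smul_mem _ _ hη, ?_⟩⟩
      rw [map_smul, smul_eq_mul]
      field_simp
    · exact ⟨0, fun h => absurd h hα⟩
  choose p hp using key
  exact ⟨fun α => (p α).1, fun α => (p α).2, hp⟩

/-- Half the sum of the roots of `𝔭` that are positive at `X₁`. -/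
def halfSum (𝔱 𝔭 : Submodule ℝ L) (X₁ : 𝔱) : ComplexDual 𝔱 :=
  (1 / 2 : ℂ) • ∑ᶠ α ∈ {α ∈ rootsIn 𝔱 𝔭 | 0 < (α X₁).im}, α

namespace IsSpinModule

variable {𝔱 𝔥 𝔭 : Submodule ℝ L} {c D : CLie L →ₗ[ℂ] Module.End ℂ S}
  (h : IsSpinModule 𝔥 𝔭 c D) (hp : IsSymmetricPair 𝔥 𝔭) (h𝔱 : IsCompactCartan 𝔱) (hle : 𝔱 ≤ 𝔥)
  {X₁ : 𝔱} (hreg : ∀ α ∈ rootsIn 𝔱 ⊤, (α X₁).im ≠ 0)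
include h h𝔱

omit [LieAlgebra.IsKilling ℝ L] h𝔱 in
theorem commutator_mul {e f ξ : CLie L} (he : e ∈ CLie.sub 𝔭) (hf : f ∈ CLie.sub 𝔭)
    (hξ : ξ ∈ CLie.sub 𝔭) : c e * c f * c ξ - c ξ * (c e * c f) =
      (2 * killingForm ℂ (CLie L) f ξ) • c e - (2 * killingForm ℂ (CLie L) e ξ) • c f := by
  have h1 := h.cliff_sub hf hξ
  have h2 := h.cliff_sub he hξ
  rw [← eq_sub_iff_add_eq] at h1 h2
  rw [mul_assoc, h1, mul_sub, ← mul_assoc (c e), h2, sub_mul]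
  simp only [mul_smul_comm, mul_one, smul_mul_assoc, one_mul, mul_assoc]
  abel

omit [LieAlgebra.IsKilling ℝ L] h𝔱 in
theorem trace_mul {e f : CLie L} (he : e ∈ CLie.sub 𝔭) (hf : f ∈ CLie.sub 𝔭)
    (hef : 2 * killingForm ℂ (CLie L) e f = 1) :
    LinearMap.trace ℂ S (c e * c f - (1 / 2 : ℂ) • 1) = 0 := by
  have h1 := congrArg (LinearMap.trace ℂ S) (h.cliff_sub he hf)
  rw [hef, one_smul, map_add, LinearMap.trace_mul_comm ℂ (c f)] at h1
  rw [map_sub, map_smul, ← h1, smul_eq_mul]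
  ring

include hp hle hreg

/-- The central computation. Both sides have commutator `β(X) c ξ` with `c ξ` for a root vector `ξ`
of `𝔭` of weight `β`, and such vectors span `𝔭_ℂ`. The summand `-1/2` makes the trace of the right
side vanish, like that of the left, and Schur's lemma gives equality. -/
theorem cartan_apply {e f : ComplexDual 𝔱 → CLie L}
    (hef : ∀ α ∈ rootsIn 𝔱 𝔭, e α ∈ rootSub 𝔱 α ∧ f α ∈ rootSub 𝔱 (-α) ∧
      2 * killingForm ℂ (CLie L) (e α) (f α) = 1)
    {s : Finset (ComplexDual 𝔱)} (hs : ∀ α, α ∈ s ↔ α ∈ rootsIn 𝔱 𝔭 ∧ 0 < (α X₁).im) (X : 𝔱) :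
    D (CLie.of (X : L)) = ∑ α ∈ s, α X • (c (e α) * c (f α) - (1 / 2 : ℂ) • 1) := by
  have hsp : ∀ α ∈ s, α ∈ rootsIn 𝔱 𝔭 := fun α hα => ((hs α).1 hα).1
  have he : ∀ α ∈ s, e α ∈ CLie.sub 𝔭 := fun α hα =>
    h𝔱.rootSub_le_of_mem_rootsIn (hsp α hα) (hef α (hsp α hα)).1
  have hf : ∀ α ∈ s, f α ∈ CLie.sub 𝔭 := fun α hα =>
    h𝔱.rootSub_le_of_mem_rootsIn (hp.neg_mem_rootsIn_p h𝔱 hle (hsp α hα)) (hef α (hsp α hα)).2.1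
  have hX : CLie.of (X : L) ∈ CLie.sub 𝔥 := CLie.of_mem_sub.2 (hle X.2)
  set T := D (CLie.of (X : L)) - ∑ α ∈ s, α X • (c (e α) * c (f α) - (1 / 2 : ℂ) • 1) with hT
  rw [← sub_eq_zero, ← hT]
  have hzero : ∀ α β, α + β ≠ 0 → ∀ ξ ∈ rootSub 𝔱 α, ∀ η ∈ rootSub 𝔱 β,
      killingForm ℂ (CLie L) ξ η = 0 := fun α β h0 ξ hξ η hη =>
    killingForm_eq_zero_of_mem_rootSub hξ hη h0
  have hcomm : ∀ ξ ∈ CLie.sub 𝔭, T * c ξ - c ξ * T = c ⁅CLie.of (X : L), ξ⁆ - ∑ α ∈ s, α X •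
      ((2 * killingForm ℂ (CLie L) (f α) ξ) • c (e α) -
        (2 * killingForm ℂ (CLie L) (e α) ξ) • c (f α)) := by
    intro ξ hξ
    rw [← h.comm_sub hX hξ, hT, sub_mul, mul_sub, Finset.sum_mul, Finset.mul_sum,
      sub_sub_sub_comm, ← Finset.sum_sub_distrib]
    congr 1
    refine Finset.sum_congr rfl fun α hα => ?_
    rw [← h.commutator_mul (he α hα) (hf α hα) hξ, smul_mul_assoc, mul_smul_comm, ← smul_sub,
      sub_mul, mul_sub]
    simp only [smul_mul_assoc, mul_smul_comm, one_mul, mul_one, sub_sub_sub_cancel_right]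
  have himpos : ∀ α ∈ s, ∀ β ∈ s, α + β ≠ 0 := by
    intro α hα β hβ h0
    have h1 : (α X₁).im + (β X₁).im = 0 := by
      rw [← Complex.add_im, ← LinearMap.add_apply, h0]; simp
    linarith [((hs α).1 hα).2, ((hs β).1 hβ).2]
  have hle' : CLie.sub 𝔭 ≤ LinearMap.ker
      ((LinearMap.mulLeft ℂ T - LinearMap.mulRight ℂ T) ∘ₗ c) := by
    refine hp.sub_p_le h𝔱 hle fun β hβ ξ hξ => ?_
    rw [LinearMap.mem_ker, LinearMap.comp_apply, LinearMap.sub_apply, LinearMap.mulLeft_apply,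
      LinearMap.mulRight_apply, hcomm ξ (h𝔱.rootSub_le_of_mem_rootsIn hβ hξ), hξ X, map_smul,
      sub_eq_zero]
    rcases lt_or_gt_of_ne (hreg β (rootsIn_subset_top hβ)) with hneg | hpos
    · have hβ' := hp.neg_mem_rootsIn_p h𝔱 hle hβ
      have hβs : -β ∈ s := (hs _).2 ⟨hβ', by simpa using hneg⟩
      obtain ⟨h1, h2, h3⟩ := hef _ hβ'
      rw [neg_neg] at h2
      have hfne : f (-β) ≠ 0 := fun h0 => by simp [h0] at h3
      obtain ⟨z, rfl⟩ := h𝔱.exists_smul_eq_of_mem_rootSub (rootsIn_subset_top hβ) h2 hξ hfne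
      rw [Finset.sum_eq_single (-β)]
      · rw [hzero β β _ _ h2 _ hξ, map_smul, map_smul, smul_eq_mul, mul_left_comm, h3]
        · simp
        · intro h0
          exact himpos _ hβs _ hβs (by rw [← neg_add, h0, neg_zero])
      · intro α hα hne
        obtain ⟨k1, k2, -⟩ := hef _ (hsp α hα)
        rw [hzero _ _ _ _ k1 _ hξ, hzero _ _ _ _ k2 _ hξ]
        · simp
        · intro h0
          exact himpos _ hα _ hβs (by rw [← neg_eq_zero, neg_add, neg_neg, h0])
        · exact fun h0 => hne (eq_neg_of_add_eq_zero_left h0)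
      · exact fun hn => absurd hβs hn
    · have hβs : β ∈ s := (hs _).2 ⟨hβ, hpos⟩
      obtain ⟨h1, h2, h3⟩ := hef _ hβ
      have hene : e β ≠ 0 := fun h0 => by simp [h0] at h3
      obtain ⟨z, rfl⟩ := h𝔱.exists_smul_eq_of_mem_rootSub (rootsIn_subset_top hβ) h1 hξ hene
      rw [Finset.sum_eq_single β]
      · rw [hzero β β (himpos _ hβs _ hβs) _ h1 _ hξ, map_smul, map_smul,
          LieModule.traceForm_comm ℂ _ _ (f β), smul_eq_mul, mul_left_comm, h3]
        simp
      · intro α hα hne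
        obtain ⟨k1, k2, -⟩ := hef _ (hsp α hα)
        rw [hzero _ _ (himpos _ hα _ hβs) _ k1 _ hξ, hzero _ _ _ _ k2 _ hξ]
        · simp
        · exact fun h0 => hne (neg_add_eq_zero.1 h0)
      · exact fun hn => absurd hβs hn
  refine h.eq_zero_of_commute ?_ fun x hx => ?_
  · rw [hT, map_sub, h.trace_sub hX, map_sum, zero_sub, neg_eq_zero]
    refine Finset.sum_eq_zero fun α hα => ?_
    rw [map_smul, h.trace_mul (he α hα) (hf α hα) (hef α (hsp α hα)).2.2, smul_zero]
  · have := hle' (CLie.of_mem_sub.2 hx)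
    rwa [LinearMap.mem_ker, LinearMap.comp_apply, LinearMap.sub_apply, LinearMap.mulLeft_apply,
      LinearMap.mulRight_apply, sub_eq_zero] at this

/-- The vacuum vector. -/
theorem exists_vacuum : ∃ v : S, v ≠ 0 ∧
    (∀ X : 𝔱, D (CLie.of (X : L)) v = halfSum 𝔱 𝔭 X₁ X • v) ∧
    ∀ W : Submodule ℂ S, v ∈ W → (∀ α ∈ rootsIn 𝔱 𝔭, 0 < (α X₁).im → ∀ ξ ∈ rootSub 𝔱 (-α),
      ∀ x ∈ W, c ξ x ∈ W) → W = ⊤ := by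
  classical
  have := h.nontrivial
  obtain ⟨e, f, hef⟩ := h𝔱.exists_normalized (U := 𝔭)
  have hfin : {α ∈ rootsIn 𝔱 𝔭 | 0 < (α X₁).im}.Finite :=
    h𝔱.finite_rootsIn.subset fun α hα => rootsIn_subset_top hα.1
  set s := hfin.toFinset with hs'
  have hs : ∀ α, α ∈ s ↔ α ∈ rootsIn 𝔱 𝔭 ∧ 0 < (α X₁).im := fun α => hfin.mem_toFinset
  have hD := h.cartan_apply hp h𝔱 hle hreg hef hs
  have hsp : ∀ α ∈ s, α ∈ rootsIn 𝔱 𝔭 := fun α hα => ((hs α).1 hα).1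
  have he : ∀ α ∈ s, e α ∈ CLie.sub 𝔭 := fun α hα =>
    h𝔱.rootSub_le_of_mem_rootsIn (hsp α hα) (hef α (hsp α hα)).1
  have hf : ∀ α ∈ s, f α ∈ CLie.sub 𝔭 := fun α hα =>
    h𝔱.rootSub_le_of_mem_rootsIn (hp.neg_mem_rootsIn_p h𝔱 hle (hsp α hα)) (hef α (hsp α hα)).2.1
  have himpos : ∀ α ∈ s, ∀ β ∈ s, α + β ≠ 0 := by
    intro α hα β hβ h0
    have h1 : (α X₁).im + (β X₁).im = 0 := by
      rw [← Complex.add_im, ← LinearMap.add_apply, h0]; simp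
    linarith [((hs α).1 hα).2, ((hs β).1 hβ).2]
  have haa : ∀ i ∈ s, ∀ j ∈ s, c (e i) * c (e j) + c (e j) * c (e i) = 0 := fun i hi j hj => by
    rw [h.cliff_sub (he i hi) (he j hj), killingForm_eq_zero_of_mem_rootSub (hef i (hsp i hi)).1
      (hef j (hsp j hj)).1 (himpos i hi j hj), mul_zero, zero_smul]
  have hab : ∀ i ∈ s, ∀ j ∈ s, c (e i) * c (f j) + c (f j) * c (e i) = if i = j then 1 else 0 := by
    intro i hi j hj
    rw [h.cliff_sub (he i hi) (hf j hj)]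
    split_ifs with hij
    · rw [← hij, (hef i (hsp i hi)).2.2, one_smul]
    · rw [killingForm_eq_zero_of_mem_rootSub (hef i (hsp i hi)).1 (hef j (hsp j hj)).2.1
        (fun h0 => hij (by rwa [← sub_eq_add_neg, sub_eq_zero] at h0)), mul_zero, zero_smul]
  obtain ⟨v, hv, h0⟩ := exists_forall_apply_eq_zero (fun α => c (e α)) s haa
  refine ⟨v, hv, fun X => ?_, fun W hvW hW => ?_⟩
  -- As `c (e α) v = 0`, the anticommutation relation gives `c (e α) c (f α) v = v`, and each root
  -- contributes `α(X) (1 - 1/2)`.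
  · rw [hD, halfSum, finsum_mem_eq_finite_toFinset_sum _ hfin, ← hs', LinearMap.smul_apply,
      LinearMap.sum_apply, LinearMap.sum_apply, smul_assoc, Finset.sum_smul, Finset.smul_sum]
    refine Finset.sum_congr rfl fun α hα => ?_
    have h1 := LinearMap.congr_fun (hab α hα α hα) v
    rw [if_pos rfl, LinearMap.add_apply, Module.End.mul_apply, Module.End.mul_apply, h0 α hα,
      map_zero, add_zero, Module.End.one_apply] at h1
    rw [LinearMap.smul_apply, LinearMap.sub_apply, Module.End.mul_apply, h1, LinearMap.smul_apply,
      Module.End.one_apply, smul_comm]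
    congr 1
    nth_rewrite 1 [← one_smul ℂ v]
    rw [← sub_smul]
    norm_num
  · refine eq_top_of_forall_creation_mem (fun α => c (e α)) (fun α => c (f α)) s hab
      (fun W' h1 h2 => h.irred W' fun x hx u hu => ?_) hv h0 hvW
      (fun α hα x hx => hW α (hsp α hα) ((hs α).1 hα).2 _ (hef α (hsp α hα)).2.1 x hx)
    -- The elements whose Clifford action preserves `W'`; every root vector of `𝔭` is a multiple of
    -- some `e α` or `f α`.
    let N : Submodule ℂ (CLie L) :=
      { carrier := {ξ | ∀ u ∈ W', c ξ u ∈ W'}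
        add_mem' := fun k1 k2 u hu => by
          rw [map_add]; exact add_mem (k1 u hu) (k2 u hu)
        zero_mem' := fun u _ => by rw [map_zero]; exact zero_mem _
        smul_mem' := fun z ξ k u hu => by rw [map_smul]; exact Submodule.smul_mem _ _ (k u hu) }
    have hN : CLie.sub 𝔭 ≤ N := by
      refine hp.sub_p_le h𝔱 hle fun β hβ ξ hξ => ?_
      rcases lt_or_gt_of_ne (hreg β (rootsIn_subset_top hβ)) with hneg | hpos
      · have hβ' := hp.neg_mem_rootsIn_p h𝔱 hle hβ
        have hβs : -β ∈ s := (hs _).2 ⟨hβ', by simpa using hneg⟩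
        obtain ⟨-, k2, k3⟩ := hef _ hβ'
        rw [neg_neg] at k2
        obtain ⟨z, rfl⟩ := h𝔱.exists_smul_eq_of_mem_rootSub (rootsIn_subset_top hβ) k2 hξ
          (fun h0 => by simp [h0] at k3)
        exact Submodule.smul_mem _ _ fun u hu => h2 _ hβs u hu
      · obtain ⟨k1, -, k3⟩ := hef _ hβ
        obtain ⟨z, rfl⟩ := h𝔱.exists_smul_eq_of_mem_rootSub (rootsIn_subset_top hβ) k1 hξ
          (fun h0 => by simp [h0] at k3)
        exact Submodule.smul_mem _ _ fun u hu => h1 _ ((hs _).2 ⟨hβ, hpos⟩) u hu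
    exact hN (CLie.of_mem_sub.2 hx) u hu

end IsSpinModule

end HighestWeight

/-! ### The irreducible module generated by the vacuum -/

section HighestWeightModule

variable {L : Type*} [LieRing L] [LieAlgebra ℝ L] {S : Type*} [AddCommGroup S] [Module ℂ S]

/-- The space of vectors of weight `μ` in a module. -/
def weightSub (𝔱 : Submodule ℝ L) (D : CLie L →ₗ[ℂ] Module.End ℂ S) (μ : ComplexDual 𝔱) :
    Submodule ℂ S :=
  ⨅ X : 𝔱, (D (CLie.of (X : L))).eigenspace (μ X)

theorem mem_weightSub {𝔱 : Submodule ℝ L} {D : CLie L →ₗ[ℂ] Module.End ℂ S} {μ : ComplexDual 𝔱}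
    {x : S} : x ∈ weightSub 𝔱 D μ ↔ ∀ X : 𝔱, D (CLie.of (X : L)) x = μ X • x := by
  simp [weightSub, Submodule.mem_iInf]

variable [Module.Finite ℝ L] [LieAlgebra.IsKilling ℝ L]

namespace IsSpinModule

variable {𝔱 𝔥 𝔭 : Submodule ℝ L} {c D : CLie L →ₗ[ℂ] Module.End ℂ S}
  (h : IsSpinModule 𝔥 𝔭 c D) (hp : IsSymmetricPair 𝔥 𝔭) (h𝔱 : IsCompactCartan 𝔱) (hle : 𝔱 ≤ 𝔥)
  {X₁ : 𝔱} (hreg : ∀ α ∈ rootsIn 𝔱 ⊤, (α X₁).im ≠ 0)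
include h hp h𝔱 hle

omit [Module.Finite ℝ L] [LieAlgebra.IsKilling ℝ L] in
theorem iSupIndep_weightSub : iSupIndep (weightSub 𝔱 D) := by
  have h1 := Module.End.independent_iInf_maxGenEigenspace_of_forall_mapsTo
    (fun X : 𝔱 => D (CLie.of (X : L))) (fun X Y φ =>
      Module.End.mapsTo_maxGenEigenspace_of_comm (by
        have e := h.map_lie hp (CLie.of_mem_sub.2 (hle Y.2)) (CLie.of_mem_sub.2 (hle X.2))
        rw [← CLie.of_lie, h𝔱.comm _ Y.2 _ X.2, map_zero, map_zero] at e
        exact (sub_eq_zero.1 e.symm)) φ)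
  have h2 : iSupIndep fun χ : 𝔱 → ℂ => ⨅ X : 𝔱, (D (CLie.of (X : L))).eigenspace (χ X) :=
    h1.mono fun χ => iInf_mono fun X => Module.End.eigenspace_le_maxGenEigenspace
  exact h2.comp (f := fun μ : ComplexDual 𝔱 => (μ : 𝔱 → ℂ)) DFunLike.coe_injective

include hreg

/-- The weight space of the vacuum is a line, and there are no higher eigenvalues. -/
theorem exists_vacuum_eigenspace : ∃ v : S, v ≠ 0 ∧ v ∈ weightSub 𝔱 D (halfSum 𝔱 𝔭 X₁) ∧
    (∀ x, D (CLie.of (X₁ : L)) x = halfSum 𝔱 𝔭 X₁ X₁ • x → ∃ k : ℂ, k • v = x) ∧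
    ∀ z : ℂ, (halfSum 𝔱 𝔭 X₁ X₁).im < z.im → ∀ x, D (CLie.of (X₁ : L)) x = z • x → x = 0 := by
  obtain ⟨v, hv, hδ, htop⟩ := h.exists_vacuum hp h𝔱 hle hreg
  set A := D (CLie.of (X₁ : L)) with hA
  set l := halfSum 𝔱 𝔭 X₁ X₁ with hl
  -- A creation operator of weight `-α` lowers the imaginary part of an eigenvalue by `Im α(X₁) >
  -- 0`, so it maps both the vacuum and `M` into `M`. Hence the vacuum line and `M` together fill
  -- `S`.
  let M : Submodule ℂ S := ⨆ z : {z : ℂ // z.im < l.im}, A.eigenspace z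
  have hW : Submodule.span ℂ {v} ⊔ M = ⊤ := by
    refine htop _ (Submodule.mem_sup_left (Submodule.mem_span_singleton_self v))
      fun α hα hpos ξ hξ x hx => ?_
    have hξp := h𝔱.rootSub_le_of_mem_rootsIn (hp.neg_mem_rootsIn_p h𝔱 hle hα) hξ
    have hstep : ∀ z x, A x = z • x → A (c ξ x) = (z - α X₁) • c ξ x := fun z x hx => by
      rw [sub_eq_add_neg]
      exact h.apply_eigenspace (CLie.of_mem_sub.2 (hle X₁.2)) hξp (hξ X₁) hx
    have hM : ∀ z : ℂ, z.im ≤ l.im → ∀ x, A x = z • x → c ξ x ∈ M := fun z hz x hx => by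
      refine Submodule.mem_iSup_of_mem ⟨z - α X₁, ?_⟩
        (Module.End.mem_eigenspace_iff.2 (hstep z x hx))
      rw [Complex.sub_im]
      linarith
    refine Submodule.mem_sup_right ?_
    have hle' : Submodule.span ℂ {v} ⊔ M ≤ M.comap (c ξ) := by
      refine sup_le ((Submodule.span_singleton_le_iff_mem _ _).2 (hM l le_rfl v (hδ X₁)))
        (iSup_le fun z x hx => hM z z.2.le x (Module.End.mem_eigenspace_iff.1 hx))
    exact hle' hx
  have hind := Module.End.eigenspaces_iSupIndep A
  have hdis : ∀ z : ℂ, ¬z.im < l.im → ∀ x ∈ A.eigenspace z, x ∈ M → x = 0 := fun z hz x hx hxM =>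
    Submodule.disjoint_def.1 (hind z) x hx ((iSup_le fun w => le_iSup₂_of_le (w : ℂ)
      (fun e : (w : ℂ) = z => hz (e ▸ w.2)) le_rfl :
        M ≤ ⨆ (w : ℂ) (_ : w ≠ z), A.eigenspace w) hxM)
  refine ⟨v, hv, mem_weightSub.2 hδ, fun x hx => ?_, fun z hz x hx => ?_⟩
  · obtain ⟨y, hy, w, hw, rfl⟩ := Submodule.mem_sup.1 (hW ▸ Submodule.mem_top : x ∈ _)
    obtain ⟨k, rfl⟩ := Submodule.mem_span_singleton.1 hy
    refine ⟨k, ?_⟩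
    rw [map_add, map_smul, hδ X₁, smul_add, smul_comm, add_right_inj] at hx
    rw [hdis l (lt_irrefl _) w (Module.End.mem_eigenspace_iff.2 hx) hw, add_zero]
  · obtain ⟨y, hy, w, hw, rfl⟩ := Submodule.mem_sup.1 (hW ▸ Submodule.mem_top : x ∈ _)
    obtain ⟨k, rfl⟩ := Submodule.mem_span_singleton.1 hy
    have hle' : Submodule.span ℂ {v} ⊔ M ≤ ⨆ (w : ℂ) (_ : w ≠ z), A.eigenspace w := by
      refine sup_le ((Submodule.span_singleton_le_iff_mem _ _).2
        (le_iSup₂_of_le (f := fun (w : ℂ) (_ : w ≠ z) => A.eigenspace w) l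
          (fun e => hz.ne (e ▸ rfl)) le_rfl (Module.End.mem_eigenspace_iff.2 (hδ X₁))))
        (iSup_le fun w => le_iSup₂_of_le (w : ℂ)
          (fun e => (e ▸ w.2 : z.im < l.im).not_gt hz) le_rfl)
    exact Submodule.disjoint_def.1 (hind z) _ (Module.End.mem_eigenspace_iff.2 hx)
      (hle' (hW ▸ Submodule.mem_top))

/-- The irreducible submodule generated by the vacuum. -/
theorem exists_highestWeight : ∃ N : Submodule ℂ S,
    (∀ x ∈ 𝔥, ∀ u ∈ N, D (CLie.of x) u ∈ N) ∧
    (∃ v ∈ N, v ≠ 0 ∧ v ∈ weightSub 𝔱 D (halfSum 𝔱 𝔭 X₁)) ∧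
    (∀ W ≤ N, (∀ x ∈ 𝔥, ∀ u ∈ W, D (CLie.of x) u ∈ W) → W = ⊥ ∨ W = N) ∧
    ∀ ν, ∀ u ∈ N, u ≠ 0 → u ∈ weightSub 𝔱 D ν →
      halfSum 𝔱 𝔭 X₁ - ν ∈ AddSubmonoid.closure {α ∈ rootsIn 𝔱 𝔥 | 0 < (α X₁).im} := by
  obtain ⟨v, hv, hδ, hline, hhigh⟩ := h.exists_vacuum_eigenspace hp h𝔱 hle hreg
  set δ := halfSum 𝔱 𝔭 X₁ with hδd
  -- `N` is generated from the vacuum by `𝔱` and the lowering root vectors of `𝔥` only. This makes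
  -- its weights easy to bound; stability under raising is proved separately.
  let C : Set (Submodule ℂ S) := {W | v ∈ W ∧ ∀ γ : ComplexDual 𝔱, (γ = 0 ∨ (γ X₁).im < 0) →
    ∀ ξ ∈ rootSub 𝔱 γ, ξ ∈ CLie.sub 𝔥 → ∀ x ∈ W, D ξ x ∈ W}
  set N : Submodule ℂ S := sInf C with hN
  have hNle : ∀ W ∈ C, N ≤ W := fun W hW => sInf_le hW
  have hvN : v ∈ N := Submodule.mem_sInf.2 fun W hW => hW.1
  have hNst : ∀ γ : ComplexDual 𝔱, (γ = 0 ∨ (γ X₁).im < 0) →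
      ∀ ξ ∈ rootSub 𝔱 γ, ξ ∈ CLie.sub 𝔥 → ∀ x ∈ N, D ξ x ∈ N := fun γ hγ ξ hξ hξh x hx =>
    Submodule.mem_sInf.2 fun W hW => hW.2 γ hγ ξ hξ hξh x (Submodule.mem_sInf.1 hx W hW)
  have hstab : ∀ W : Submodule ℂ S, (∀ x ∈ 𝔥, ∀ u ∈ W, D (CLie.of x) u ∈ W) →
      ∀ ξ ∈ CLie.sub 𝔥, ∀ u ∈ W, D ξ u ∈ W := by
    intro W hW ξ hξ u hu
    rw [CLie.eq_re_add_im ξ, map_add, map_smul]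
    exact add_mem (hW _ hξ.1 u hu) (Submodule.smul_mem _ _ (hW _ hξ.2 u hu))
  have hmin : ∀ W : Submodule ℂ S, (∀ x ∈ 𝔥, ∀ u ∈ W, D (CLie.of x) u ∈ W) → v ∈ W → N ≤ W :=
    fun W hW hvW => hNle W ⟨hvW, fun γ _ ξ _ hξh x hx => hstab W hW ξ hξh x hx⟩
  -- raising operators
  have hraise : ∀ β ∈ rootsIn 𝔱 𝔥, 0 < (β X₁).im → ∀ ξ ∈ rootSub 𝔱 β, ∀ x ∈ N, D ξ x ∈ N := by
    let N' : Submodule ℂ S :=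
      { carrier := {x | x ∈ N ∧ ∀ β ∈ rootsIn 𝔱 𝔥, 0 < (β X₁).im → ∀ ξ ∈ rootSub 𝔱 β, D ξ x ∈ N}
        add_mem' := fun k1 k2 => ⟨add_mem k1.1 k2.1, fun β hβ hpos ξ hξ => by
          rw [map_add]; exact add_mem (k1.2 β hβ hpos ξ hξ) (k2.2 β hβ hpos ξ hξ)⟩
        zero_mem' := ⟨zero_mem _, fun β hβ hpos ξ hξ => by rw [map_zero]; exact zero_mem _⟩
        smul_mem' := fun z x k => ⟨Submodule.smul_mem _ _ k.1, fun β hβ hpos ξ hξ => by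
          rw [map_smul]; exact Submodule.smul_mem _ _ (k.2 β hβ hpos ξ hξ)⟩ }
    -- A raising vector kills the vacuum because no eigenvalue lies above it. Past a lowering vector
    -- or an element of `𝔱`, it leaves a bracket that is again raising, lowering or in `𝔱_ℂ`.
    have hN' : N ≤ N' := by
      refine hNle N' ⟨⟨hvN, fun β hβ hpos ξ hξ => ?_⟩, fun γ hγ η hη hηh x hx =>
        ⟨hNst γ hγ η hη hηh x hx.1, fun β hβ hpos ξ hξ => ?_⟩⟩
      · have h1 := h.apply_eigenspace' hp (CLie.of_mem_sub.2 (hle X₁.2))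
          (h𝔱.rootSub_le_of_mem_rootsIn hβ hξ) (hξ X₁) (mem_weightSub.1 hδ X₁)
        rw [hhigh _ (by rw [Complex.add_im]; linarith) _ h1]
        exact zero_mem _
      · have hξh := h𝔱.rootSub_le_of_mem_rootsIn hβ hξ
        have e := LinearMap.congr_fun (h.map_lie hp hξh hηh) x
        rw [LinearMap.sub_apply, Module.End.mul_apply, Module.End.mul_apply,
          eq_sub_iff_add_eq] at e
        rw [← e]
        refine add_mem ?_ (hNst γ hγ η hη hηh _ (hx.2 β hβ hpos ξ hξ))
        have hbr := lie_mem_rootSub hξ hη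
        have hbrh := CLie.lie_mem_sub hp.lie_mem hξh hηh
        by_cases hz : ⁅ξ, η⁆ = 0
        · rw [hz, map_zero]; exact zero_mem _
        by_cases h0 : β + γ = 0
        · exact hNst _ (Or.inl h0) _ hbr hbrh x hx.1
        · have hroot : β + γ ∈ rootsIn 𝔱 𝔥 := mem_rootsIn_iff.2 ⟨h0, _, hbrh, hz, hbr⟩
          rcases lt_or_gt_of_ne (hreg _ (rootsIn_subset_top hroot)) with hneg | hpos'
          · exact hNst _ (Or.inr hneg) _ hbr hbrh x hx.1
          · exact hx.2 _ hroot hpos' _ hbr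
    exact fun β hβ hpos ξ hξ x hx => (hN' hx).2 β hβ hpos ξ hξ
  have hNh : ∀ x ∈ 𝔥, ∀ u ∈ N, D (CLie.of x) u ∈ N := by
    let K : Submodule ℂ (CLie L) :=
      { carrier := {ξ | ∀ u ∈ N, D ξ u ∈ N}
        add_mem' := fun k1 k2 u hu => by
          rw [map_add]; exact add_mem (k1 u hu) (k2 u hu)
        zero_mem' := fun u _ => by rw [map_zero]; exact zero_mem _
        smul_mem' := fun z ξ k u hu => by rw [map_smul]; exact Submodule.smul_mem _ _ (k u hu) }
    have hK : CLie.sub 𝔥 ≤ K := by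
      refine hp.sub_h_le h𝔱 hle (fun ξ hξ u hu => ?_) fun β hβ ξ hξ u hu => ?_
      · exact hNst 0 (Or.inl rfl) ξ (by rwa [h𝔱.rootSub_zero]) ⟨hle hξ.1, hle hξ.2⟩ u hu
      · rcases lt_or_gt_of_ne (hreg β (rootsIn_subset_top hβ)) with hneg | hpos
        · exact hNst β (Or.inr hneg) ξ hξ (h𝔱.rootSub_le_of_mem_rootsIn hβ hξ) u hu
        · exact hraise β hβ hpos ξ hξ u hu
    exact fun x hx => hK (CLie.of_mem_sub.2 hx)
  refine ⟨N, hNh, ⟨v, hvN, hv, hδ⟩, fun W hWN hW => ?_, fun ν u hu hne hν => ?_⟩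
  -- The components of the vacuum in `W` and in an invariant complement `W'` have the same
  -- eigenvalue under `X₁`, whose eigenspace is a line. So the vacuum lies in `W'`, which forces `W
  -- = ⊥`, or in `W`, which forces `W = N`.
  · obtain ⟨W', hW', hcompl⟩ := h.compl W hW
    obtain ⟨w, hw, w', hw', hsum⟩ := Submodule.mem_sup.1
      (hcompl.sup_eq_top ▸ Submodule.mem_top : v ∈ W ⊔ W')
    have hX₁ := hle X₁.2
    have e := mem_weightSub.1 hδ X₁
    rw [← hsum, map_add, smul_add] at e
    have e' : D (CLie.of (X₁ : L)) w - δ X₁ • w = δ X₁ • w' - D (CLie.of (X₁ : L)) w' := by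
      rw [sub_eq_sub_iff_add_eq_add, e, add_comm]
    have hz := Submodule.disjoint_def.1 hcompl.disjoint _
      (sub_mem (hW _ hX₁ w hw) (Submodule.smul_mem _ (δ X₁) hw))
      (by rw [e']; exact sub_mem (Submodule.smul_mem _ _ hw') (hW' _ hX₁ w' hw'))
    have e1 := sub_eq_zero.1 hz
    rw [hz] at e'
    have e2 := (sub_eq_zero.1 e'.symm).symm
    obtain ⟨k, hk⟩ := hline w e1
    obtain ⟨k', hk'⟩ := hline w' e2
    by_cases hk0 : k = 0
    · have hvW' : v ∈ W' := by
        rw [← hsum, ← hk, hk0, zero_smul, zero_add]; exact hw'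
      left
      rw [eq_bot_iff, ← hcompl.disjoint.eq_bot]
      exact le_inf le_rfl (hWN.trans (hmin W' hW' hvW'))
    · right
      refine le_antisymm hWN (hmin W hW ?_)
      rw [← inv_smul_smul₀ hk0 v, hk]
      exact Submodule.smul_mem _ _ hw
  · set Q := AddSubmonoid.closure {α ∈ rootsIn 𝔱 𝔥 | 0 < (α X₁).im} with hQ
    by_contra hcon
    -- The sum of these weight spaces contains the vacuum and is stable under the generators of `N`;
    -- independence of weight spaces then excludes any other weight.
    have hM : N ≤ ⨆ μ : {μ : ComplexDual 𝔱 // δ - μ ∈ Q}, weightSub 𝔱 D μ := by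
      refine hNle _ ⟨Submodule.mem_iSup_of_mem ⟨δ, by rw [sub_self]; exact zero_mem _⟩ hδ,
        fun γ hγ ξ hξ hξh => ?_⟩
      by_cases hξ0 : ξ = 0
      · intro x _
        rw [hξ0, map_zero]
        exact zero_mem _
      have hγQ : -γ ∈ Q := by
        rcases hγ with rfl | hneg
        · rw [neg_zero]; exact zero_mem _
        · have h0 : γ ≠ 0 := fun h0 => by simp [h0] at hneg
          refine AddSubmonoid.subset_closure ⟨hp.neg_mem_rootsIn_h h𝔱 hle
            (mem_rootsIn_iff.2 ⟨h0, ξ, hξh, hξ0, hξ⟩), by simpa using hneg⟩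
      have hle' : (⨆ μ : {μ : ComplexDual 𝔱 // δ - μ ∈ Q}, weightSub 𝔱 D μ) ≤
          (⨆ μ : {μ : ComplexDual 𝔱 // δ - μ ∈ Q}, weightSub 𝔱 D μ).comap (D ξ) := by
        refine iSup_le fun μ x hx => Submodule.mem_iSup_of_mem
          ⟨(μ : ComplexDual 𝔱) + γ, ?_⟩ (mem_weightSub.2 fun X => ?_)
        · rw [← sub_sub, sub_eq_add_neg]
          exact add_mem μ.2 hγQ
        · exact h.apply_eigenspace' hp (CLie.of_mem_sub.2 (hle X.2)) hξh (hξ X)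
            (mem_weightSub.1 hx X)
      exact fun x hx => hle' hx
    have hle' : (⨆ μ : {μ : ComplexDual 𝔱 // δ - μ ∈ Q}, weightSub 𝔱 D μ) ≤
        ⨆ (μ : ComplexDual 𝔱) (_ : μ ≠ ν), weightSub 𝔱 D μ :=
      iSup_le fun μ => le_iSup₂_of_le (μ : ComplexDual 𝔱)
        (fun e : (μ : ComplexDual 𝔱) = ν => hcon (e ▸ μ.2)) le_rfl
    exact hne (Submodule.disjoint_def.1 (h.iSupIndep_weightSub hp h𝔱 hle ν) u hν (hle' (hM hu)))

end IsSpinModule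

end HighestWeightModule

/-! ### Weyl chambers and the set `W₁` -/

section WeylChambers

variable {L : Type*} [LieRing L] [LieAlgebra ℝ L] {𝔱 𝔥 𝔭 : Submodule ℝ L}

/-- The Weyl group acts dually on the real space `𝔱`: roots are imaginary there, so the coefficient
`2 α(X) / α(u)` of a reflection is real. -/
theorem IsCompactCartan.exists_weyl_apply_eq (h𝔱 : IsCompactCartan 𝔱)
    {w : ComplexDual 𝔱 ≃ₗ[ℂ] ComplexDual 𝔱} (hw : w ∈ lieWeylGroup 𝔱) (X : 𝔱) :
    ∃ Y : 𝔱, ∀ μ : ComplexDual 𝔱, w μ X = μ Y := by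
  have hrefl : ∀ α ∈ rootsIn 𝔱 ⊤, ∀ s : ComplexDual 𝔱 ≃ₗ[ℂ] ComplexDual 𝔱,
      IsRootReflection α s → ∀ X : 𝔱, ∃ Y : 𝔱, ∀ μ : ComplexDual 𝔱, s μ X = μ Y := by
    rintro α hα s ⟨u, hu, -, hs⟩ X
    have h1 : ∀ Z : 𝔱, α Z = Complex.I * ((α Z).im : ℂ) := fun Z => by
      apply Complex.ext <;> simp [h𝔱.re_eq_zero hα]
    have hu' : (α u).im ≠ 0 := fun h0 => hu (by rw [h1, h0]; simp)
    have hu'' : ((α u).im : ℂ) ≠ 0 := Complex.ofReal_ne_zero.2 hu'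
    refine ⟨X - (2 * (α X).im / (α u).im) • u, fun μ => ?_⟩
    have e1 := h1 X
    have e2 := h1 u
    rw [hs, LinearMap.sub_apply, LinearMap.smul_apply, map_sub, map_smul, Complex.real_smul,
      smul_eq_mul]
    generalize (α X).im = a at *
    generalize (α u).im = b at *
    rw [e1, e2]
    push_cast
    field_simp
  have hinv : ∀ α ∈ rootsIn 𝔱 ⊤, ∀ s : ComplexDual 𝔱 ≃ₗ[ℂ] ComplexDual 𝔱,
      IsRootReflection α s → s⁻¹ = s := by
    rintro α - s ⟨u, hu, -, hs⟩
    refine inv_eq_of_mul_eq_one_left (LinearEquiv.ext fun μ => ?_)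
    change s (s μ) = μ
    rw [hs μ, map_sub, map_smul, hs α, hs μ, mul_div_assoc 2 (α u), div_self hu]
    module
  induction hw using Subgroup.closure_induction'' generalizing X with
  | mem s hs =>
    obtain ⟨α, hα, hs⟩ := hs
    exact hrefl α hα s hs X
  | inv_mem s hs =>
    obtain ⟨α, hα, hs⟩ := hs
    rw [hinv α hα s hs]
    exact hrefl α hα s hs X
  | one => exact ⟨X, fun μ => rfl⟩
  | mul a b _ _ ha hb =>
    obtain ⟨Y, hY⟩ := ha X
    obtain ⟨Z, hZ⟩ := hb Y
    exact ⟨Z, fun μ => (hY (b μ)).trans (hZ μ)⟩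

theorem eq_zero_or_pos_of_mem_closure {X₁ : 𝔱} {Q : Set (ComplexDual 𝔱)}
    (hQ : ∀ α ∈ Q, 0 < (α X₁).im) {q : ComplexDual 𝔱} (hq : q ∈ AddSubmonoid.closure Q) :
    q = 0 ∨ 0 < (q X₁).im := by
  induction hq using AddSubmonoid.closure_induction with
  | mem x hx => exact Or.inr (hQ x hx)
  | zero => exact Or.inl rfl
  | add x y _ _ hx hy =>
    rcases hx with rfl | hx
    · simpa using hy
    · rcases hy with rfl | hy
      · simpa using Or.inr hx
      · right
        rw [LinearMap.add_apply, Complex.add_im]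
        exact add_pos hx hy

/-- Antisymmetry of the dominance order, seen at `X₁`; it makes highest weights unique. -/
theorem eq_of_sub_mem_closure {X₁ : 𝔱} {Q : Set (ComplexDual 𝔱)}
    (hQ : ∀ α ∈ Q, 0 < (α X₁).im) {μ ν : ComplexDual 𝔱} (h1 : μ - ν ∈ AddSubmonoid.closure Q)
    (h2 : ν - μ ∈ AddSubmonoid.closure Q) : μ = ν := by
  rcases eq_zero_or_pos_of_mem_closure hQ h1 with h | h
  · exact sub_eq_zero.1 h
  · rcases eq_zero_or_pos_of_mem_closure hQ h2 with h' | h'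
    · exact (sub_eq_zero.1 h').symm
    · rw [LinearMap.sub_apply, Complex.sub_im] at h h'
      linarith

variable [Module.Finite ℝ L] [LieAlgebra.IsKilling ℝ L] (h𝔱 : IsCompactCartan 𝔱)
include h𝔱

theorem IsCompactCartan.exists_image_eq {P : Set (ComplexDual 𝔱)} (hP : IsPositiveSystem 𝔱 P)
    {w : ComplexDual 𝔱 ≃ₗ[ℂ] ComplexDual 𝔱} (hw : w ∈ lieWeylGroup 𝔱) :
    ∃ Y : 𝔱, (∀ α ∈ rootsIn 𝔱 ⊤, (α Y).im ≠ 0) ∧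
      w '' P = {α ∈ rootsIn 𝔱 ⊤ | 0 < (α Y).im} := by
  obtain ⟨X₁, hreg, rfl⟩ := hP
  have hw' := inv_mem hw
  obtain ⟨Y, hY⟩ := h𝔱.exists_weyl_apply_eq hw' X₁
  have hww : ∀ α, w (w⁻¹ α) = α := fun α => w.apply_symm_apply α
  have hww' : ∀ α, w⁻¹ (w α) = α := fun α => w.symm_apply_apply α
  refine ⟨Y, fun α hα => by rw [← hY]; exact hreg _ (h𝔱.weyl_apply_mem_rootsIn hw' hα), ?_⟩
  ext α
  constructor
  · rintro ⟨β, ⟨hβ, hpos⟩, rfl⟩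
    refine ⟨h𝔱.weyl_apply_mem_rootsIn hw hβ, ?_⟩
    rwa [← hY, hww']
  · rintro ⟨hα, hpos⟩
    refine ⟨w⁻¹ α, ⟨h𝔱.weyl_apply_mem_rootsIn hw' hα, ?_⟩, hww α⟩
    rwa [hY]

/-- The half sums are compared at one of the two elements. After the common roots cancel, those
positive only there contribute a positive sum, and those positive only at the other element a
nonpositive one. -/
theorem IsCompactCartan.setOf_eq_of_halfSum_eq {X Y : 𝔱}
    (hX : ∀ α ∈ rootsIn 𝔱 ⊤, (α X).im ≠ 0) (hY : ∀ α ∈ rootsIn 𝔱 ⊤, (α Y).im ≠ 0)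
    (heq : halfSum 𝔱 𝔭 X = halfSum 𝔱 𝔭 Y) :
    {α ∈ rootsIn 𝔱 𝔭 | 0 < (α X).im} = {α ∈ rootsIn 𝔱 𝔭 | 0 < (α Y).im} := by
  classical
  have hfin : ∀ Z : 𝔱, {α ∈ rootsIn 𝔱 𝔭 | 0 < (α Z).im}.Finite := fun Z =>
    h𝔱.finite_rootsIn.subset fun α hα => rootsIn_subset_top hα.1
  have key : ∀ Z Z' : 𝔱, (∀ α ∈ rootsIn 𝔱 ⊤, (α Z).im ≠ 0) → halfSum 𝔱 𝔭 Z = halfSum 𝔱 𝔭 Z' →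
      {α ∈ rootsIn 𝔱 𝔭 | 0 < (α Z).im} ⊆ {α ∈ rootsIn 𝔱 𝔭 | 0 < (α Z').im} := by
    intro Z Z' hZ he α hα
    set s := (hfin Z).toFinset with hs
    set s' := (hfin Z').toFinset with hs'
    have hms : ∀ β, β ∈ s ↔ β ∈ rootsIn 𝔱 𝔭 ∧ 0 < (β Z).im := fun β => (hfin Z).mem_toFinset
    have hms' : ∀ β, β ∈ s' ↔ β ∈ rootsIn 𝔱 𝔭 ∧ 0 < (β Z').im := fun β => (hfin Z').mem_toFinset
    rw [halfSum, halfSum, finsum_mem_eq_finite_toFinset_sum _ (hfin Z),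
      finsum_mem_eq_finite_toFinset_sum _ (hfin Z')] at he
    have he' := smul_right_injective _ (by norm_num : (1 / 2 : ℂ) ≠ 0) he
    have h1 : ∑ β ∈ s, (β Z).im = ∑ β ∈ s', (β Z).im := by
      have := congrArg (fun μ : ComplexDual 𝔱 => (μ Z).im) he'
      simpa [LinearMap.sum_apply, Complex.im_sum] using this
    rw [← Finset.sum_inter_add_sum_sdiff s s', ← Finset.sum_inter_add_sum_sdiff s' s,
      Finset.inter_comm, add_right_inj] at h1
    by_contra hcon
    have hα' : α ∈ s \ s' := by
      rw [Finset.mem_sdiff, hms, hms']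
      exact ⟨hα, hcon⟩
    have h2 : 0 < ∑ β ∈ s \ s', (β Z).im :=
      Finset.sum_pos (fun β hβ => ((hms β).1 (Finset.mem_sdiff.1 hβ).1).2) ⟨α, hα'⟩
    have h3 : ∑ β ∈ s' \ s, (β Z).im ≤ 0 := by
      refine Finset.sum_nonpos fun β hβ => ?_
      obtain ⟨k1, k2⟩ := Finset.mem_sdiff.1 hβ
      rw [hms, not_and, not_lt] at k2
      exact k2 ((hms' β).1 k1).1
    linarith
  exact (key X Y hX heq).antisymm (key Y X hY heq.symm)

variable (hp : IsSymmetricPair 𝔥 𝔭) (hle : 𝔱 ≤ 𝔥)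
include hp hle

/-- For `w ∈ W₁` the positive system `w Δ⁺` is defined by an element `Y`, with the same positive
roots of `𝔥`. -/
theorem IsCompactCartan.exists_of_mem_weylW1 {P : Set (ComplexDual 𝔱)}
    (hP : IsPositiveSystem 𝔱 P) {w : ComplexDual 𝔱 ≃ₗ[ℂ] ComplexDual 𝔱}
    (hw : w ∈ weylW1 𝔱 𝔥 P) :
    ∃ Y : 𝔱, (∀ α ∈ rootsIn 𝔱 ⊤, (α Y).im ≠ 0) ∧
      w '' P = {α ∈ rootsIn 𝔱 ⊤ | 0 < (α Y).im} ∧ deltaP 𝔱 𝔭 P w = halfSum 𝔱 𝔭 Y ∧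
      P ∩ rootsIn 𝔱 𝔥 = {α ∈ rootsIn 𝔱 𝔥 | 0 < (α Y).im} := by
  obtain ⟨Y, hY, himg⟩ := h𝔱.exists_image_eq hP hw.1
  refine ⟨Y, hY, himg, ?_, ?_⟩
  · have : w '' P ∩ rootsIn 𝔱 𝔭 = {α ∈ rootsIn 𝔱 𝔭 | 0 < (α Y).im} := by
      rw [himg]
      ext α
      exact ⟨fun h => ⟨h.2, h.1.2⟩, fun h => ⟨⟨rootsIn_subset_top h.1, h.2⟩, h.1⟩⟩
    rw [deltaP, this, halfSum]
  · have h2 := hw.2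
    rw [himg] at h2
    ext α
    refine ⟨fun h => ⟨h.2, (h2 h).2⟩, fun h => ⟨?_, h.1⟩⟩
    -- If a root of `𝔥` positive at `Y` were not in `P`, its negative would be in `P ∩ Δ_𝔥 ⊆ w P`
    -- and hence also positive at `Y`.
    obtain ⟨X₁, hreg, rfl⟩ := hP
    refine ⟨rootsIn_subset_top h.1, (lt_or_gt_of_ne (hreg α (rootsIn_subset_top h.1))).resolve_left
      fun hneg => ?_⟩
    have hn := hp.neg_mem_rootsIn_h h𝔱 hle h.1
    have h3 := (h2 ⟨⟨rootsIn_subset_top hn, by simpa using hneg⟩, hn⟩).2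
    have h4 := h.2
    simp only [LinearMap.neg_apply, Complex.neg_im] at h3
    linarith

/-- The roots of `w P` in `𝔭` are determined by the half sum, and those in `𝔥` are always `P ∩ Δ_𝔥`.
Thus `w⁻¹ w'` preserves `P` and is trivial. -/
theorem IsCompactCartan.eq_of_deltaP_eq {P : Set (ComplexDual 𝔱)} (hP : IsPositiveSystem 𝔱 P)
    {w w' : ComplexDual 𝔱 ≃ₗ[ℂ] ComplexDual 𝔱} (hw : w ∈ weylW1 𝔱 𝔥 P)
    (hw' : w' ∈ weylW1 𝔱 𝔥 P) (heq : deltaP 𝔱 𝔭 P w = deltaP 𝔱 𝔭 P w') : w = w' := by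
  obtain ⟨Y, hY, himg, hδ, hQ⟩ := h𝔱.exists_of_mem_weylW1 hp hle hP hw
  obtain ⟨Y', hY', himg', hδ', hQ'⟩ := h𝔱.exists_of_mem_weylW1 hp hle hP hw'
  have hpp := h𝔱.setOf_eq_of_halfSum_eq hY hY' (hδ.symm.trans (heq.trans hδ'))
  have hhh := hQ.symm.trans hQ'
  have himg2 : w' '' P ⊆ w '' P := by
    rw [himg, himg']
    rintro α ⟨hα, hpos⟩
    refine ⟨hα, ?_⟩
    rcases hp.mem_or_mem h𝔱 hle hα with h | h
    · exact (hhh.symm ▸ (⟨h, hpos⟩ : α ∈ {α ∈ rootsIn 𝔱 𝔥 | 0 < (α Y').im}) :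
        α ∈ {α ∈ rootsIn 𝔱 𝔥 | 0 < (α Y).im}).2
    · exact (hpp.symm ▸ (⟨h, hpos⟩ : α ∈ {α ∈ rootsIn 𝔱 𝔭 | 0 < (α Y').im}) :
        α ∈ {α ∈ rootsIn 𝔱 𝔭 | 0 < (α Y).im}).2
  have hone : w⁻¹ * w' = 1 := by
    refine h𝔱.weyl_eq_one hP (mul_mem (inv_mem hw.1) hw'.1) fun α hα => ?_
    obtain ⟨β, hβ, e⟩ := himg2 ⟨α, hα, rfl⟩
    have h1 : (w⁻¹ * w') α = β := by
      change w.symm (w' α) = β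
      rw [← e, w.symm_apply_apply]
    rwa [h1]
  exact (inv_mul_eq_one.1 hone)

end WeylChambers

/-! ### Invariant Hermitian forms on Clifford modules -/

section HermitianForms

variable {S : Type*} [AddCommGroup S] [Module ℂ S]

/-- Positive definite Hermitian forms, conjugate linear in the first variable. -/
structure IsHermitianForm (k : S → S → ℂ) : Prop where
  add_left : ∀ x y z, k (x + y) z = k x z + k y z
  smul_left : ∀ (c : ℂ) x y, k (c • x) y = starRingEnd ℂ c * k x y
  conj_symm : ∀ x y, starRingEnd ℂ (k y x) = k x y
  pos : ∀ x, x ≠ 0 → 0 < (k x x).re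

namespace IsHermitianForm

variable {k : S → S → ℂ} (hk : IsHermitianForm k)
include hk

theorem zero_left (x : S) : k 0 x = 0 := by simpa using hk.smul_left 0 0 x

theorem add_right (x y z : S) : k x (y + z) = k x y + k x z := by
  rw [← hk.conj_symm, hk.add_left, map_add, hk.conj_symm, hk.conj_symm]

theorem smul_right (c : ℂ) (x y : S) : k x (c • y) = c * k x y := by
  rw [← hk.conj_symm, hk.smul_left, map_mul, hk.conj_symm, Complex.conj_conj]

theorem nonneg (x : S) : 0 ≤ (k x x).re := by
  by_cases hx : x = 0
  · rw [hx, hk.zero_left, Complex.zero_re]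
  · exact (hk.pos x hx).le

/-- The orthogonal complement of a submodule, as a plain statement. -/
theorem exists_isCompl [Module.Finite ℂ S] (W : Submodule ℂ S) :
    ∃ W' : Submodule ℂ S, IsCompl W W' ∧ ∀ y, y ∈ W' ↔ ∀ x ∈ W, k x y = 0 := by
  let core : InnerProductSpace.Core ℂ S :=
    { inner := k
      conj_inner_symm := hk.conj_symm
      re_inner_nonneg := hk.nonneg
      add_left := hk.add_left
      smul_left := fun x y r => hk.smul_left r x y
      definite := fun x hx => by
        by_contra hne
        have := hk.pos x hne
        rw [show k x x = 0 from hx] at this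
        exact lt_irrefl _ this }
  let _ : NormedAddCommGroup S := core.toNormedAddCommGroup
  let _ : InnerProductSpace ℂ S := InnerProductSpace.ofCore core.toCore
  have : FiniteDimensional ℂ W := inferInstance
  exact ⟨Wᗮ, Submodule.isCompl_orthogonal W, fun y => Submodule.mem_orthogonal W y⟩

end IsHermitianForm

variable (S) in
theorem exists_isHermitianForm [Module.Finite ℂ S] : ∃ k : S → S → ℂ, IsHermitianForm k := by
  let b := Module.finBasis ℂ S
  refine ⟨fun x y => ∑ i, starRingEnd ℂ (b.repr x i) * b.repr y i, ?_, ?_, ?_, ?_⟩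
  · intro x y z
    simp [add_mul, Finset.sum_add_distrib]
  · intro c x y
    simp [Finset.mul_sum, mul_assoc]
  · intro x y
    simp [map_sum, mul_comm]
  · intro x hx
    have h1 : ∀ i, (starRingEnd ℂ (b.repr x i) * b.repr x i).re = Complex.normSq (b.repr x i) := by
      intro i
      rw [mul_comm, Complex.mul_conj, Complex.ofReal_re]
    rw [Complex.re_sum]
    simp only [h1]
    obtain ⟨i, hi⟩ : ∃ i, b.repr x i ≠ 0 := by
      by_contra! hcon
      exact hx (b.repr.map_eq_zero_iff.1 (Finsupp.ext hcon))
    exact Finset.sum_pos' (fun j _ => Complex.normSq_nonneg _)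
      ⟨i, Finset.mem_univ _, Complex.normSq_pos.2 hi⟩

/-- Anticommuting operators with negative squares are skew for some Hermitian form. -/
theorem exists_isHermitianForm_skew [Module.Finite ℂ S] {ι : Type*} (s : Finset ι)
    {E : ι → Module.End ℂ S} {q : ι → ℝ} (hq : ∀ i ∈ s, q i < 0)
    (hsq : ∀ i ∈ s, E i * E i = (q i : ℂ) • 1)
    (hanti : ∀ i ∈ s, ∀ j ∈ s, i ≠ j → E i * E j = -(E j * E i)) :
    ∃ k : S → S → ℂ, IsHermitianForm k ∧ ∀ i ∈ s, ∀ x y, k (E i x) y = -k x (E i y) := by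
  classical
  -- Skewness is equivalent to being unitary up to the scale `-q i`, as `E i * E i = q i`; the
  -- latter property can be reached by averaging.
  suffices h : ∃ k : S → S → ℂ, IsHermitianForm k ∧
      ∀ i ∈ s, ∀ x y, k (E i x) (E i y) = ((-q i : ℝ) : ℂ) * k x y by
    obtain ⟨k, hk, hE⟩ := h
    refine ⟨k, hk, fun i hi x y => ?_⟩
    have h1 := hE i hi x (E i y)
    rw [← Module.End.mul_apply, hsq i hi, LinearMap.smul_apply, Module.End.one_apply,
      hk.smul_right, Complex.ofReal_neg, neg_mul, ← mul_neg] at h1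
    exact mul_left_cancel₀ (Complex.ofReal_ne_zero.2 (hq i hi).ne) h1
  induction s using Finset.induction_on with
  | empty =>
    obtain ⟨k, hk⟩ := exists_isHermitianForm S
    exact ⟨k, hk, by simp⟩
  | insert j s hj ih =>
    obtain ⟨k, hk, hE⟩ := ih (fun i hi => hq i (Finset.mem_insert_of_mem hi))
      (fun i hi => hsq i (Finset.mem_insert_of_mem hi))
      (fun i hi l hl => hanti i (Finset.mem_insert_of_mem hi) l (Finset.mem_insert_of_mem hl))
    have hjm := Finset.mem_insert_self j s
    -- An average over `1` and `E j`, weighted by `-q j > 0`. Anticommutation changes only signs,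
    -- which cancel in pairs, so the earlier invariances survive.
    refine ⟨fun x y => ((-q j : ℝ) : ℂ) * k x y + k (E j x) (E j y), ⟨?_, ?_, ?_, ?_⟩, ?_⟩
    · intro x y z
      simp only [map_add, hk.add_left]
      ring
    · intro c x y
      simp only [map_smul, hk.smul_left]
      ring
    · intro x y
      simp only [map_add, map_mul, hk.conj_symm, Complex.conj_ofReal]
    · intro x hx
      rw [Complex.add_re, Complex.re_ofReal_mul]
      have h1 := mul_pos (neg_pos.2 (hq j hjm)) (hk.pos x hx)
      have h2 := hk.nonneg (E j x)
      linarith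
    · intro i hi x y
      rcases Finset.mem_insert.1 hi with rfl | hi'
      · have h1 : ∀ z, E i (E i z) = (q i : ℂ) • z := fun z => by
          rw [← Module.End.mul_apply, hsq i hjm]; rfl
        simp only [h1, hk.smul_left, hk.smul_right, Complex.conj_ofReal]
        push_cast
        ring
      · have h1 : ∀ z, E j (E i z) = -E i (E j z) := fun z => by
          rw [← Module.End.mul_apply, hanti j hjm i hi (fun e => hj (e ▸ hi'))]; rfl
        have h2 : ∀ u w, k (-u) (-w) = k u w := fun u w => by
          rw [← neg_one_smul ℂ u, ← neg_one_smul ℂ w, hk.smul_left, hk.smul_right]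
          simp
        simp only [h1, h2, hE i hi']
        ring

end HermitianForms

/-! ### Complex representations of real algebras -/

section CliffordModules

variable {S : Type*} [AddCommGroup S] [Module ℂ S]

/-- The complex linear extension of a real linear map. -/
def CLie.lift {L : Type*} [LieRing L] [LieAlgebra ℝ L] {E : Type*} [AddCommGroup E] [Module ℂ E]
    (g : L →+ E) (hg : ∀ (r : ℝ) x, g (r • x) = (r : ℂ) • g x) : CLie L →ₗ[ℂ] E where
  toFun ξ := g (re ξ) + Complex.I • g (im ξ)
  map_add' ξ η := by
    simp only [map_add, smul_add]
    abel
  map_smul' z ξ := by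
    simp only [re_smul, im_smul, map_add, map_sub, hg, RingHom.id_apply]
    conv_rhs => rw [← Complex.re_add_im z]
    have e : ((z.re : ℂ) + z.im * Complex.I) * Complex.I = z.re * Complex.I - z.im := by
      rw [add_mul, mul_assoc, Complex.I_mul_I, mul_neg_one, sub_eq_add_neg]
    simp only [smul_add, smul_smul, e]
    simp only [add_smul, sub_smul, mul_comm Complex.I]
    abel

@[simp] theorem CLie.lift_of {L : Type*} [LieRing L] [LieAlgebra ℝ L] {E : Type*} [AddCommGroup E]
    [Module ℂ E] (g : L →+ E) (hg : ∀ (r : ℝ) x, g (r • x) = (r : ℂ) • g x) (x : L) :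
    CLie.lift g hg (CLie.of x) = g x := by
  change g (re (of x)) + Complex.I • g (im (of x)) = g x
  rw [re_of, im_of, map_zero, smul_zero, add_zero]

section RealRep

variable {A : Type*} [Ring A] [Algebra ℝ A] (σ : (ℂ ⊗[ℝ] A) →ₐ[ℂ] Module.End ℂ S)

/-- The restriction of a representation of `ℂ ⊗ A` to `A`. -/
def realRep : A →+* Module.End ℂ S where
  toFun a := σ (1 ⊗ₜ[ℝ] a)
  map_one' := by rw [← Algebra.TensorProduct.one_def, map_one]
  map_mul' a b := by rw [← map_mul, Algebra.TensorProduct.tmul_mul_tmul, one_mul]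
  map_zero' := by rw [TensorProduct.tmul_zero, map_zero]
  map_add' a b := by rw [TensorProduct.tmul_add, map_add]

theorem realRep_smul (r : ℝ) (a : A) : realRep σ (r • a) = (r : ℂ) • realRep σ a := by
  change σ (1 ⊗ₜ[ℝ] (r • a)) = (r : ℂ) • σ (1 ⊗ₜ[ℝ] a)
  rw [← map_smul, TensorProduct.tmul_smul, TensorProduct.smul_tmul', TensorProduct.smul_tmul']
  simp

theorem eq_bot_or_eq_top_of_realRep (hσ : IsIrreducibleAlgRep σ) {W : Submodule ℂ S}
    (hW : ∀ a, ∀ v ∈ W, realRep σ a v ∈ W) : W = ⊥ ∨ W = ⊤ := by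
  refine hσ.2 W fun a v hv => ?_
  induction a using TensorProduct.induction_on with
  | zero => rw [map_zero]; exact zero_mem _
  | tmul z a =>
    have : z ⊗ₜ[ℝ] a = z • ((1 : ℂ) ⊗ₜ[ℝ] a) := by
      rw [TensorProduct.smul_tmul', smul_eq_mul, mul_one]
    rw [this, map_smul]
    exact Submodule.smul_mem _ _ (hW a v hv)
  | add x y hx hy =>
    rw [map_add]
    exact add_mem hx hy

/-- A nonzero vector generates the module, and its orbit is spanned by the images under a basis of
`A`. -/
theorem finite_of_isIrreducibleAlgRep [Module.Finite ℝ A] (hσ : IsIrreducibleAlgRep σ) :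
    Module.Finite ℂ S := by
  have := hσ.1
  obtain ⟨s, hs⟩ := exists_ne (0 : S)
  let b := Module.finBasis ℝ A
  let W : Submodule ℂ S := Submodule.span ℂ (range fun i => realRep σ (b i) s)
  have hW : ∀ a, realRep σ a s ∈ W := by
    intro a
    rw [← b.sum_repr a, map_sum, LinearMap.sum_apply]
    refine sum_mem fun i _ => ?_
    rw [realRep_smul]
    exact Submodule.smul_mem _ _ (Submodule.subset_span ⟨i, rfl⟩)
  have hst : ∀ a, ∀ v ∈ W, realRep σ a v ∈ W := by
    intro a v hv
    have : W ≤ W.comap (realRep σ a) := by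
      refine Submodule.span_le.2 ?_
      rintro _ ⟨i, rfl⟩
      change realRep σ a (realRep σ (b i) s) ∈ W
      rw [← Module.End.mul_apply, ← map_mul]
      exact hW _
    exact this hv
  have htop := (eq_bot_or_eq_top_of_realRep σ hσ hst).resolve_left fun h => hs (by
    have h1 := hW 1
    rw [h, map_one] at h1
    exact h1)
  exact ⟨htop ▸ Submodule.fg_span (finite_range _)⟩

end RealRep

end CliffordModules

/-! ### Spin modules from irreducible Clifford modules -/

section SpinModuleOfCliffordModule

variable {L : Type*} [LieRing L] [LieAlgebra ℝ L] {𝔥 𝔭 : Submodule ℝ L}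

theorem polar_killingQuad (x y : 𝔭) :
    QuadraticMap.polar (killingQuad 𝔭) x y = 2 * killingForm ℝ L x y := by
  change killingForm ℝ L (x + y) (x + y) - killingForm ℝ L x x - killingForm ℝ L y y = _
  have h := LieModule.traceForm_comm ℝ L L (y : L) (x : L)
  change killingForm ℝ L y x = killingForm ℝ L x y at h
  simp only [map_add, LinearMap.add_apply, h]
  ring

variable (𝔭) in
theorem exists_orthogonal_basis_killingQuad [Module.Finite ℝ L] :
    ∃ v : Module.Basis (Fin (Module.finrank ℝ 𝔭)) ℝ 𝔭,
      ∀ i j, i ≠ j → QuadraticMap.polar (killingQuad 𝔭) (v i) (v j) = 0 := by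
  have hs : LinearMap.IsSymm ((killingForm ℝ L).restrict 𝔭) :=
    ⟨fun x y => LieModule.traceForm_comm ℝ L L (x : L) (y : L)⟩
  have : Invertible (2 : ℝ) := invertibleOfNonzero two_ne_zero
  obtain ⟨v, hv⟩ := LinearMap.BilinForm.exists_orthogonal_basis hs
  refine ⟨v, fun i j hij => ?_⟩
  rw [polar_killingQuad]
  have h1 := hv hij
  change killingForm ℝ L (v i) (v j) = 0 at h1
  rw [h1, mul_zero]

namespace IsSymmetricPair

variable (hp : IsSymmetricPair 𝔥 𝔭)

/-- The projection onto `𝔭` along `𝔥`. -/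
def proj : L →ₗ[ℝ] 𝔭 := Submodule.projectionOnto 𝔭 𝔥 hp.isCompl.symm

theorem proj_apply (x : 𝔭) : hp.proj (x : L) = x := Submodule.projectionOnto_apply_left _ x

/-- The action of `𝔥` on `𝔭`. -/
def adOn : L →ₗ[ℝ] Module.End ℝ 𝔭 :=
  (LinearMap.llcomp ℝ 𝔭 L 𝔭 hp.proj) ∘ₗ (LinearMap.lcomp ℝ L 𝔭.subtype) ∘ₗ
    (LieAlgebra.ad ℝ L : L →ₗ[ℝ] Module.End ℝ L)

/-- The projection in `adOn` serves only to define it linearly on all of `L`; on `𝔥` it has no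
effect. -/
theorem adOn_apply {X : L} (hX : X ∈ 𝔥) (x : 𝔭) : (hp.adOn X x : L) = ⁅X, (x : L)⁆ := by
  have h1 : hp.adOn X x = hp.proj ((⟨⁅X, (x : L)⁆, hp.lie_mem' X hX x x.2⟩ : 𝔭) : L) := rfl
  rw [h1, hp.proj_apply]

theorem polar_adOn {X : L} (hX : X ∈ 𝔥) (x y : 𝔭) :
    QuadraticMap.polar (killingQuad 𝔭) (hp.adOn X x) y =
      -QuadraticMap.polar (killingQuad 𝔭) x (hp.adOn X y) := by
  rw [polar_killingQuad, polar_killingQuad, hp.adOn_apply hX, hp.adOn_apply hX,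
    killingForm_lie_left, mul_neg]

variable {S : Type*} [AddCommGroup S] [Module ℂ S]

/-- An irreducible representation of the Clifford algebra is a spin module. -/
theorem exists_isSpinModule (hneg : ∀ x : L, x ≠ 0 → killingForm ℝ L x x < 0)
    (σ : (ℂ ⊗[ℝ] CliffordAlgebra (killingQuad 𝔭)) →ₐ[ℂ] Module.End ℂ S)
    (hσ : IsIrreducibleAlgRep σ) {v : Module.Basis (Fin (Module.finrank ℝ 𝔭)) ℝ 𝔭}
    (hv : ∀ i j, i ≠ j → QuadraticMap.polar (killingQuad 𝔭) (v i) (v j) = 0) :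
    ∃ c D : CLie L →ₗ[ℂ] Module.End ℂ S, IsSpinModule 𝔥 𝔭 c D ∧
      ∀ X, D (CLie.of X) = realRep σ (spinOf v (hp.adOn X)) := by
  set φ := realRep σ with hφ
  have hφs : ∀ (r : ℝ) a, φ (r • a) = (r : ℂ) • φ a := realRep_smul σ
  have hfinA := cliffordAlgebra_finite v hv
  have hfin := finite_of_isIrreducibleAlgRep σ hσ
  have hQneg : ∀ i, killingQuad 𝔭 (v i) < 0 := fun i => hneg (v i) fun h0 =>
    v.ne_zero i (Subtype.ext h0)
  have hQ : ∀ i, killingQuad 𝔭 (v i) ≠ 0 := fun i => (hQneg i).ne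
  have hφa : ∀ r : ℝ, φ (algebraMap ℝ _ r) = (r : ℂ) • 1 := fun r => by
    rw [Algebra.algebraMap_eq_smul_one, hφs, map_one]
  have hcl : ∀ x y : 𝔭, φ (CliffordAlgebra.ι (killingQuad 𝔭) x) * φ (CliffordAlgebra.ι (killingQuad 𝔭) y) +
      φ (CliffordAlgebra.ι (killingQuad 𝔭) y) * φ (CliffordAlgebra.ι (killingQuad 𝔭) x) =
      ((QuadraticMap.polar (killingQuad 𝔭) x y : ℝ) : ℂ) • 1 := fun x y => by
    rw [← map_mul φ, ← map_mul φ, ← map_add, CliffordAlgebra.ι_mul_ι_add_swap, hφa]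
  let gc : L →+ Module.End ℂ S :=
    (φ : CliffordAlgebra (killingQuad 𝔭) →+ Module.End ℂ S).comp
      ((CliffordAlgebra.ι (killingQuad 𝔭)).comp hp.proj).toAddMonoidHom
  have hgc : ∀ (r : ℝ) x, gc (r • x) = (r : ℂ) • gc x := fun r x => by
    change φ (CliffordAlgebra.ι (killingQuad 𝔭) (hp.proj (r • x))) = _
    rw [map_smul, map_smul, hφs]
    rfl
  let gD : L →+ Module.End ℂ S :=
    (φ : CliffordAlgebra (killingQuad 𝔭) →+ Module.End ℂ S).comp ((spinOf v).comp hp.adOn).toAddMonoidHom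
  have hgD : ∀ (r : ℝ) x, gD (r • x) = (r : ℂ) • gD x := fun r x => by
    change φ (spinOf v (hp.adOn (r • x))) = _
    rw [map_smul, map_smul, hφs]
    rfl
  have hc : ∀ x : 𝔭, CLie.lift gc hgc (CLie.of (x : L)) = φ (CliffordAlgebra.ι (killingQuad 𝔭) x) := fun x => by
    rw [CLie.lift_of]
    change φ (CliffordAlgebra.ι (killingQuad 𝔭) (hp.proj (x : L))) = _
    rw [hp.proj_apply]
  have hD : ∀ X, CLie.lift gD hgD (CLie.of X) = φ (spinOf v (hp.adOn X)) := fun X => by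
    rw [CLie.lift_of]
    rfl
  have hDe : ∀ X, φ (spinOf v (hp.adOn X)) = ((-(1 / 4) : ℝ) : ℂ) • ∑ i, (((killingQuad 𝔭 (v i))⁻¹ : ℝ) : ℂ) •
      (φ (CliffordAlgebra.ι (killingQuad 𝔭) (v i)) * φ (CliffordAlgebra.ι (killingQuad 𝔭) (hp.adOn X (v i)))) := fun X => by
    rw [spinOf_apply, hφs, map_sum]
    simp only [hφs, map_mul]
  refine ⟨CLie.lift gc hgc, CLie.lift gD hgD, ⟨hfin, hσ.1, ?_, ?_, ?_, ?_, ?_⟩, hD⟩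
  · intro x hx y hy
    rw [hc ⟨x, hx⟩, hc ⟨y, hy⟩, hcl, polar_killingQuad]
    push_cast
    rfl
  · intro X hX y hy
    rw [hD, hc ⟨y, hy⟩, ← map_mul, ← map_mul, ← map_sub,
      spinOf_commutator v hv hQ (hp.polar_adOn hX), ← hc, hp.adOn_apply hX]
  · intro X hX
    rw [hD, hDe, map_smul, map_sum, Finset.sum_eq_zero, smul_zero]
    -- `v i` and `[X, v i]` are orthogonal, so their Clifford actions anticommute and the product
    -- has trace zero.
    intro i _
    have h1 := congrArg (LinearMap.trace ℂ S) (hcl (v i) (hp.adOn X (v i)))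
    rw [polar_apply_self (hp.polar_adOn hX), Complex.ofReal_zero, zero_smul, map_zero, map_add,
      LinearMap.trace_mul_comm ℂ (φ (CliffordAlgebra.ι (killingQuad 𝔭) (hp.adOn X (v i)))), ← two_smul ℂ,
      smul_eq_zero] at h1
    rw [map_smul, h1.resolve_left two_ne_zero, smul_zero]
  · intro W hW
    refine eq_bot_or_eq_top_of_realRep σ hσ fun a => ?_
    induction a using CliffordAlgebra.induction with
    | algebraMap r =>
      intro u hu
      rw [← hφ, hφa]
      exact Submodule.smul_mem _ _ hu
    | ι x =>
      intro u hu
      rw [← hφ, ← hc]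
      exact hW x x.2 u hu
    | mul a b ha hb =>
      intro u hu
      rw [map_mul]
      exact ha _ (hb u hu)
    | add a b ha hb =>
      intro u hu
      rw [map_add]
      exact add_mem (ha u hu) (hb u hu)
  · intro W hW
    -- Vectors of `𝔭` act by skew operators for `k`. A product of two anticommuting skew operators
    -- is skew, so `𝔥` acts by skew operators and orthogonal complements are invariant.
    obtain ⟨k, hk, hskew⟩ := exists_isHermitianForm_skew Finset.univ
      (E := fun i => φ (CliffordAlgebra.ι (killingQuad 𝔭) (v i))) (q := fun i => killingQuad 𝔭 (v i)) (fun i _ => hQneg i)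
      (fun i _ => by rw [← map_mul, CliffordAlgebra.ι_sq_scalar, hφa])
      (fun i _ j _ hij => by rw [← map_mul, ι_basis_anticommute v hv i j hij, map_neg, map_mul])
    have hsum_left : ∀ (x : Fin (Module.finrank ℝ 𝔭) → S) (y : S),
        k (∑ i, x i) y = ∑ i, k (x i) y := fun x y =>
      map_sum (⟨⟨fun u => k u y, hk.zero_left y⟩, fun a b => hk.add_left a b y⟩ : S →+ ℂ) x _
    have hsum_right : ∀ (x : Fin (Module.finrank ℝ 𝔭) → S) (y : S),
        k y (∑ i, x i) = ∑ i, k y (x i) := fun x y =>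
      map_sum (⟨⟨fun u => k y u, by simpa using hk.smul_right 0 y 0⟩,
        fun a b => hk.add_right y a b⟩ : S →+ ℂ) x _
    have hskew' : ∀ (x : 𝔭) u w, k (φ (CliffordAlgebra.ι (killingQuad 𝔭) x) u) w =
        -k u (φ (CliffordAlgebra.ι (killingQuad 𝔭) x) w) := by
      intro x u w
      have hx : φ (CliffordAlgebra.ι (killingQuad 𝔭) x) =
          ∑ i, ((v.repr x i : ℝ) : ℂ) • φ (CliffordAlgebra.ι (killingQuad 𝔭) (v i)) := by
        conv_lhs => rw [← v.sum_repr x, map_sum, map_sum]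
        simp only [map_smul, hφs]
      rw [hx, LinearMap.sum_apply, LinearMap.sum_apply, hsum_left, hsum_right,
        ← Finset.sum_neg_distrib]
      refine Finset.sum_congr rfl fun i _ => ?_
      rw [LinearMap.smul_apply, LinearMap.smul_apply, hk.smul_left, hk.smul_right,
        Complex.conj_ofReal, hskew i (Finset.mem_univ i), mul_neg]
    have hDskew : ∀ X ∈ 𝔥, ∀ u w, k (φ (spinOf v (hp.adOn X)) u) w =
        -k u (φ (spinOf v (hp.adOn X)) w) := by
      intro X hX u w
      rw [hDe, LinearMap.smul_apply, LinearMap.smul_apply, LinearMap.sum_apply,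
        LinearMap.sum_apply, hk.smul_left, hk.smul_right, hsum_left, hsum_right,
        Complex.conj_ofReal, ← mul_neg, ← Finset.sum_neg_distrib]
      congr 1
      refine Finset.sum_congr rfl fun i _ => ?_
      rw [LinearMap.smul_apply, LinearMap.smul_apply, hk.smul_left, hk.smul_right,
        Complex.conj_ofReal, ← mul_neg, Module.End.mul_apply, hskew', hskew', neg_neg]
      congr 1
      have h1 := LinearMap.congr_fun (hcl (v i) (hp.adOn X (v i))) w
      rw [polar_apply_self (hp.polar_adOn hX), Complex.ofReal_zero, zero_smul,
        LinearMap.add_apply, LinearMap.zero_apply, add_eq_zero_iff_eq_neg] at h1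
      have h2 : ∀ a b, k a (-b) = -k a b := fun a b => by
        rw [← neg_one_smul ℂ b, hk.smul_right, neg_one_mul]
      rw [h1, h2, neg_neg]
      rfl
    obtain ⟨W', hcompl, hW'⟩ := hk.exists_isCompl W
    refine ⟨W', fun X hX y hy => (hW' _).2 fun x hx => ?_, hcompl⟩
    have h1 := hDskew X hX x y
    rw [← hD, (hW' y).1 hy _ (hW X hX x hx), eq_comm, neg_eq_zero] at h1
    exact h1

end IsSymmetricPair

end SpinModuleOfCliffordModule

/-! ### The differential of the spin lift -/

section SpinLift

variable {n : ℕ} {G : Type*} [TopologicalSpace G] [ChartedSpace (EuclideanSpace ℝ (Fin n)) G]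
  [Group G] [LieGroup (𝓡 n) ∞ G] [T2Space G]

theorem hasDerivAt_apply_lieAd_lieExp_zero (X Y : LieAlg n G) (g : LieAlg n G →ₗ[ℝ] ℝ) :
    HasDerivAt (fun t : ℝ => g (lieAd n (lieExp (t • X)) Y)) (g ⁅X, Y⁆) 0 := by
  let g' : EuclideanSpace ℝ (Fin n) →ₗ[ℝ] ℝ := g
  exact (LinearMap.toContinuousLinearMap g').hasFDerivAt.comp_hasDerivAt (0 : ℝ)
    (hasDerivAt_lieAd_lieExp_zero X Y)

variable {𝔥 𝔭 : Submodule ℝ (LieAlg n G)} {H : Subgroup G} (hexp : ∀ X ∈ 𝔥, lieExp X ∈ H)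
  (hAd : ∀ h ∈ H, ∀ x ∈ 𝔭, lieAd n h x ∈ 𝔭) {ρ : H →* spinGroup (killingQuad 𝔭)}
  (hρ : IsSpinLift ρ)

/-- The one-parameter subgroup of the spin group given by an element of `𝔥`. -/
def spinCurve (ρ : H →* spinGroup (killingQuad 𝔭)) (hexp : ∀ X ∈ 𝔥, lieExp X ∈ H) (X : 𝔥) (t : ℝ) :
    CliffordAlgebra (killingQuad 𝔭) :=
  ρ ⟨lieExp (t • (X : LieAlg n G)), hexp _ (𝔥.smul_mem t X.2)⟩

theorem spinCurve_zero (X : 𝔥) : spinCurve ρ hexp X 0 = 1 := by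
  have h1 : (⟨lieExp ((0 : ℝ) • (X : LieAlg n G)), hexp _ (𝔥.smul_mem 0 X.2)⟩ : H) = 1 :=
    Subtype.ext (by simp [lieExp_zero])
  rw [spinCurve, h1, map_one]
  rfl

theorem spinCurve_add (X : 𝔥) (s t : ℝ) :
    spinCurve ρ hexp X (s + t) = spinCurve ρ hexp X s * spinCurve ρ hexp X t := by
  have h1 : (⟨lieExp ((s + t) • (X : LieAlg n G)), hexp _ (𝔥.smul_mem _ X.2)⟩ : H) =
      ⟨lieExp (s • (X : LieAlg n G)), hexp _ (𝔥.smul_mem _ X.2)⟩ *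
        ⟨lieExp (t • (X : LieAlg n G)), hexp _ (𝔥.smul_mem _ X.2)⟩ :=
    Subtype.ext (lieExp_add_smul _ s t)
  rw [spinCurve, h1, map_mul]
  rfl

omit [T2Space G] in
theorem involute_spinCurve (X : 𝔥) (t : ℝ) :
    CliffordAlgebra.involute (spinCurve ρ hexp X t) = spinCurve ρ hexp X t :=
  spinGroup.involute_eq (ρ _).2

/-- In the spin group `star` is the inverse, and on even elements it is reversion. Hence reversion
negates the generator of the curve. -/
theorem reverse_spinCurve (X : 𝔥) (t : ℝ) :
    CliffordAlgebra.reverse (spinCurve ρ hexp X t) = spinCurve ρ hexp X (-t) := by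
  have h1 : star (spinCurve ρ hexp X t) * spinCurve ρ hexp X t = 1 :=
    spinGroup.star_mul_self_of_mem (ρ _).2
  have h2 : spinCurve ρ hexp X t * spinCurve ρ hexp X (-t) = 1 := by
    rw [← spinCurve_add, add_neg_cancel, spinCurve_zero]
  rw [CliffordAlgebra.star_def, involute_spinCurve] at h1
  exact left_inv_eq_right_inv h1 h2

include hρ in
theorem continuous_spinCurve (X : 𝔥) : @Continuous ℝ (CliffordAlgebra (killingQuad 𝔭)) _
    (moduleTopology ℝ (CliffordAlgebra (killingQuad 𝔭))) (spinCurve ρ hexp X) :=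
  @Continuous.comp ℝ H (CliffordAlgebra (killingQuad 𝔭)) _ _
    (moduleTopology ℝ (CliffordAlgebra (killingQuad 𝔭))) _ _ hρ.1
    ((continuous_lieExp_smul (X : LieAlg n G)).subtype_mk _)

omit [T2Space G] in
include hρ in
theorem spinCurve_mul_ι (X : 𝔥) (t : ℝ) (x : 𝔭) :
    spinCurve ρ hexp X t * CliffordAlgebra.ι (killingQuad 𝔭) x =
      CliffordAlgebra.ι (killingQuad 𝔭) ⟨lieAd n (lieExp (t • (X : LieAlg n G))) x,
        hAd _ (hexp _ (𝔥.smul_mem t X.2)) x x.2⟩ * spinCurve ρ hexp X t := by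
  have h1 := hρ.2 ⟨lieExp (t • (X : LieAlg n G)), hexp _ (𝔥.smul_mem t X.2)⟩ x
    ⟨lieAd n (lieExp (t • (X : LieAlg n G))) x, hAd _ (hexp _ (𝔥.smul_mem t X.2)) x x.2⟩ rfl
  rw [← h1, mul_assoc _ _ (spinCurve ρ hexp X t)]
  have h2 : (((ρ ⟨lieExp (t • (X : LieAlg n G)), hexp _ (𝔥.smul_mem t X.2)⟩)⁻¹ :
      spinGroup (killingQuad 𝔭)) : CliffordAlgebra (killingQuad 𝔭)) * spinCurve ρ hexp X t = 1 :=
    spinGroup.star_mul_self_of_mem (ρ _).2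
  rw [h2, mul_one]
  rfl

include hAd hρ in
/-- The derivative of the spin lift. -/
theorem hasDerivAt_spinCurve [CompactSpace G] [LieAlgebra.IsSemisimple ℝ (LieAlg n G)]
    (hp : IsSymmetricPair 𝔥 𝔭) {v : Module.Basis (Fin (Module.finrank ℝ 𝔭)) ℝ 𝔭}
    (hv : ∀ i j, i ≠ j → QuadraticMap.polar (killingQuad 𝔭) (v i) (v j) = 0) (X : 𝔥)
    (φ : CliffordAlgebra (killingQuad 𝔭) →ₗ[ℝ] ℝ) (t : ℝ) :
    HasDerivAt (fun s => φ (spinCurve ρ hexp X s))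
      (φ (spinOf v (hp.adOn (X : LieAlg n G)) * spinCurve ρ hexp X t)) t := by
  have hfinA := cliffordAlgebra_finite v hv
  obtain ⟨D, hD⟩ := exists_generator (continuous_spinCurve hexp hρ X) (spinCurve_zero hexp X)
    (spinCurve_add hexp X)
  have hD0 : ∀ φ : CliffordAlgebra (killingQuad 𝔭) →ₗ[ℝ] ℝ,
      HasDerivAt (fun s => φ (spinCurve ρ hexp X s)) (φ D) 0 := fun φ => by
    have := hD φ 0
    rwa [spinCurve_zero, mul_one] at this
  have hQ : ∀ i, killingQuad 𝔭 (v i) ≠ 0 := fun i =>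
    (killingForm_lieAlg_neg (v i : LieAlg n G) fun h0 => v.ne_zero i (Subtype.ext h0)).ne
  have heven : CliffordAlgebra.involute D = D := by
    refine eq_of_forall_dual_eq fun φ => ?_
    have h1 := hD0 (φ ∘ₗ CliffordAlgebra.involute.toLinearMap)
    refine h1.unique ?_
    simp only [LinearMap.comp_apply, AlgHom.toLinearMap_apply, involute_spinCurve]
    exact hD0 φ
  have hrev : CliffordAlgebra.reverse D = -D := by
    refine eq_of_forall_dual_eq fun φ => ?_
    have h1 := hD0 (φ ∘ₗ CliffordAlgebra.reverse)
    refine h1.unique ?_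
    simp only [LinearMap.comp_apply, reverse_spinCurve]
    have h2 := (hasDerivAt_neg (0 : ℝ))
    have h3 : HasDerivAt (fun s => φ (spinCurve ρ hexp X s)) (φ D) (-(0 : ℝ)) := by
      rw [neg_zero]; exact hD0 φ
    have h4 := h3.comp 0 h2
    rw [map_neg, ← mul_neg_one]
    exact h4
  have hexpand : ∀ (g : 𝔭 →ₗ[ℝ] ℝ) (y : 𝔭), g y = ∑ i, v.repr y i * g (v i) := fun g y => by
    conv_lhs => rw [← v.sum_repr y, map_sum]
    simp only [map_smul, smul_eq_mul]
  have hcomm : ∀ x : 𝔭, D * CliffordAlgebra.ι (killingQuad 𝔭) x =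
      CliffordAlgebra.ι (killingQuad 𝔭) (hp.adOn (X : LieAlg n G) x) +
        CliffordAlgebra.ι (killingQuad 𝔭) x * D := by
    intro x
    refine eq_of_forall_dual_eq fun φ => ?_
    have h1 := hD0 (φ ∘ₗ LinearMap.mulRight ℝ (CliffordAlgebra.ι (killingQuad 𝔭) x))
    refine h1.unique ?_
    -- The relation `g(s) x = (Ad x) g(s)`, expanded in the basis so that only products of scalar
    -- functions are differentiated.
    have hfun : (fun s => (φ ∘ₗ LinearMap.mulRight ℝ (CliffordAlgebra.ι (killingQuad 𝔭) x))
        (spinCurve ρ hexp X s)) = fun s => ∑ i,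
          (v.coord i ∘ₗ hp.proj) (lieAd n (lieExp (s • (X : LieAlg n G))) (x : LieAlg n G)) *
          (φ ∘ₗ LinearMap.mulLeft ℝ (CliffordAlgebra.ι (killingQuad 𝔭) (v i)))
            (spinCurve ρ hexp X s) := by
      funext s
      rw [LinearMap.comp_apply, LinearMap.mulRight_apply, spinCurve_mul_ι hexp hAd hρ]
      set y : 𝔭 := ⟨lieAd n (lieExp (s • (X : LieAlg n G))) (x : LieAlg n G),
        hAd _ (hexp _ (𝔥.smul_mem s X.2)) x x.2⟩ with hy
      have hy' : ∀ i, (v.coord i ∘ₗ hp.proj)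
          (lieAd n (lieExp (s • (X : LieAlg n G))) (x : LieAlg n G)) = v.repr y i := fun i => by
        change v.repr (hp.proj (y : LieAlg n G)) i = _
        rw [hp.proj_apply]
      simp only [hy']
      exact hexpand (φ ∘ₗ LinearMap.mulRight ℝ (spinCurve ρ hexp X s) ∘ₗ
        CliffordAlgebra.ι (killingQuad 𝔭)) y
    rw [hfun]
    have hsum := HasDerivAt.fun_sum (u := Finset.univ) fun (i : Fin (Module.finrank ℝ 𝔭)) _ =>
      (hasDerivAt_apply_lieAd_lieExp_zero (X : LieAlg n G) (x : LieAlg n G)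
        (v.coord i ∘ₗ hp.proj)).fun_mul
        (hD0 (φ ∘ₗ LinearMap.mulLeft ℝ (CliffordAlgebra.ι (killingQuad 𝔭) (v i))))
    refine hsum.congr_deriv ?_
    have h5 : ∀ i, (v.coord i ∘ₗ hp.proj) ⁅(X : LieAlg n G), (x : LieAlg n G)⁆ =
        v.repr (hp.adOn (X : LieAlg n G) x) i := fun i => rfl
    have h6 : ∀ i, (v.coord i ∘ₗ hp.proj)
        (lieAd n (lieExp ((0 : ℝ) • (X : LieAlg n G))) (x : LieAlg n G)) = v.repr x i := fun i => by
      rw [zero_smul, lieExp_zero, lieAd_one_apply]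
      change v.repr (hp.proj (x : LieAlg n G)) i = _
      rw [hp.proj_apply]
    simp only [h5, h6, spinCurve_zero, LinearMap.comp_apply φ, LinearMap.mulLeft_apply, mul_one]
    rw [Finset.sum_add_distrib, map_add]
    congr 1
    · exact (hexpand (φ ∘ₗ CliffordAlgebra.ι (killingQuad 𝔭)) _).symm
    · exact (hexpand (φ ∘ₗ LinearMap.mulRight ℝ D ∘ₗ CliffordAlgebra.ι (killingQuad 𝔭)) _).symm
  -- The generator `D` and `spinOf` have the same commutators with vectors; both are even and
  -- negated by reversion, so no scalar ambiguity remains.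
  have hu := eq_zero_of_commute_ι v hv hQ (u := D - spinOf v (hp.adOn (X : LieAlg n G)))
    (by rw [map_sub, heven, involute_spinOf])
    (by rw [map_sub, hrev, reverse_spinOf v (hp.polar_adOn X.2)]; abel)
    (fun x => by
      have e := spinOf_commutator v hv hQ (hp.polar_adOn X.2) x
      rw [mul_sub, sub_mul, hcomm, ← e]
      abel)
  rw [← sub_eq_zero.1 hu]
  exact hD φ t

end SpinLift

/-! ### From the group representation to its differential and back -/

section SpinRep

variable {n : ℕ} {G : Type*} [TopologicalSpace G] [ChartedSpace (EuclideanSpace ℝ (Fin n)) G]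
  [Group G] [LieGroup (𝓡 n) ∞ G] {S : Type*} [AddCommGroup S] [Module ℂ S]

/-- `D` is the differential of the representation `π` of `H`: the curves `t ↦ π(exp tX) u` satisfy
the equation `y' = D(X) y`. -/
def IsDifferential {H : Subgroup G} (π : Representation ℂ H S)
    {𝔥 : Submodule ℝ (LieAlg n G)} (hexp : ∀ X ∈ 𝔥, lieExp X ∈ H)
    (D : 𝔥 → Module.End ℂ S) : Prop :=
  ∀ (X : 𝔥) (u : S) (φ : S →ₗ[ℝ] ℝ) (t : ℝ), HasDerivAt
    (fun s : ℝ => φ (π ⟨lieExp (s • (X : LieAlg n G)), hexp _ (𝔥.smul_mem s X.2)⟩ u))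
    (φ (D X (π ⟨lieExp (t • (X : LieAlg n G)), hexp _ (𝔥.smul_mem t X.2)⟩ u))) t

theorem isDifferential_spinorRep [T2Space G] [CompactSpace G]
    [LieAlgebra.IsSemisimple ℝ (LieAlg n G)]
    {𝔥 𝔭 : Submodule ℝ (LieAlg n G)} {H : Subgroup G} (hexp : ∀ X ∈ 𝔥, lieExp X ∈ H)
    (hAd : ∀ h ∈ H, ∀ x ∈ 𝔭, lieAd n h x ∈ 𝔭) {ρ : H →* spinGroup (killingQuad 𝔭)}
    (hρ : IsSpinLift ρ) (hp : IsSymmetricPair 𝔥 𝔭)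
    {v : Module.Basis (Fin (Module.finrank ℝ 𝔭)) ℝ 𝔭}
    (hv : ∀ i j, i ≠ j → QuadraticMap.polar (killingQuad 𝔭) (v i) (v j) = 0)
    (σ : (ℂ ⊗[ℝ] CliffordAlgebra (killingQuad 𝔭)) →ₐ[ℂ] Module.End ℂ S) :
    IsDifferential (spinorRep σ ρ) hexp
      fun X => realRep σ (spinOf v (hp.adOn (X : LieAlg n G))) := by
  intro X u φ t
  let φ' : CliffordAlgebra (killingQuad 𝔭) →ₗ[ℝ] ℝ :=
    { toFun := fun a => φ (realRep σ a u)
      map_add' := fun a b => by rw [map_add, LinearMap.add_apply, map_add]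
      map_smul' := fun r a => by
        rw [realRep_smul, LinearMap.smul_apply, Complex.coe_smul, map_smul]
        rfl }
  have h := hasDerivAt_spinCurve hexp hAd hρ hp hv X φ' t
  have e : φ' (spinOf v (hp.adOn (X : LieAlg n G)) * spinCurve ρ hexp X t) =
      φ (realRep σ (spinOf v (hp.adOn (X : LieAlg n G)))
        (realRep σ (spinCurve ρ hexp X t) u)) := by
    change φ (realRep σ _ u) = _
    rw [map_mul]
    rfl
  rw [e] at h
  exact h

theorem apply_lieExp_zero_smul [T2Space G] {H : Subgroup G} (π : Representation ℂ H S)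
    {𝔥 : Submodule ℝ (LieAlg n G)} (hexp : ∀ X ∈ 𝔥, lieExp X ∈ H) (X : 𝔥) (u : S) :
    π ⟨lieExp ((0 : ℝ) • (X : LieAlg n G)), hexp _ (𝔥.smul_mem 0 X.2)⟩ u = u := by
  have h1 : (⟨lieExp ((0 : ℝ) • (X : LieAlg n G)), hexp _ (𝔥.smul_mem 0 X.2)⟩ : H) = 1 :=
    Subtype.ext (by simp [lieExp_zero])
  rw [h1, map_one]
  rfl

namespace IsDifferential

variable [T2Space G] {H : Subgroup G} {π : Representation ℂ H S} {𝔥 : Submodule ℝ (LieAlg n G)}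
  {hexp : ∀ X ∈ 𝔥, lieExp X ∈ H} {D : 𝔥 → Module.End ℂ S} (hD : IsDifferential π hexp D)
include hD

theorem apply_mem_of_stable [Module.Finite ℂ S] {W : Submodule ℂ S}
    (hW : ∀ X, ∀ u ∈ W, D X u ∈ W) (X : 𝔥) {u : S} (hu : u ∈ W) :
    π ⟨lieExp (X : LieAlg n G), hexp _ X.2⟩ u ∈ W := by
  have : Module.Finite ℝ S := Module.Finite.trans ℂ S
  have h := mem_of_hasDerivAt_dual (M := S) (B := (D X).restrictScalars ℝ)
    (y := fun s => π ⟨lieExp (s • (X : LieAlg n G)), hexp _ (𝔥.smul_mem s X.2)⟩ u)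
    (fun φ t => hD X u φ t) (U := W.restrictScalars ℝ) (fun x hx => hW X x hx)
    (by rw [apply_lieExp_zero_smul]; exact hu) 1
  simpa using h

/-- `H` is generated by exponentials, and along `exp tX` the orbit of a vector of `W` solves a
linear equation that preserves `W`. -/
theorem stable_of_stable [Module.Finite ℂ S] (hH : H = analyticSubgroup 𝔥) {W : Submodule ℂ S}
    (hW : ∀ X, ∀ u ∈ W, D X u ∈ W) (h : H) {u : S} (hu : u ∈ W) : π h u ∈ W := by
  obtain ⟨g, hg⟩ := h
  have hg' : g ∈ Subgroup.closure (lieExp '' (𝔥 : Set (LieAlg n G))) := by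
    rw [hH] at hg; exact hg
  have key : ∀ g ∈ Subgroup.closure (lieExp '' (𝔥 : Set (LieAlg n G))), ∃ hg : g ∈ H,
      ∀ u ∈ W, π ⟨g, hg⟩ u ∈ W := by
    intro g hg
    induction hg using Subgroup.closure_induction'' with
    | mem x hx =>
      obtain ⟨X, hX, rfl⟩ := hx
      exact ⟨hexp X hX, fun u hu => hD.apply_mem_of_stable hW ⟨X, hX⟩ hu⟩
    | inv_mem x hx =>
      obtain ⟨X, hX, rfl⟩ := hx
      refine ⟨inv_mem (hexp X hX), fun u hu => ?_⟩
      have h1 := hD.apply_mem_of_stable hW ⟨-X, 𝔥.neg_mem hX⟩ hu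
      simpa only [lieExp_neg] using h1
    | one => exact ⟨one_mem _, fun u hu => by
        rw [show (⟨1, one_mem H⟩ : H) = 1 from rfl, map_one]; exact hu⟩
    | mul x y _ _ hx hy =>
      obtain ⟨hx, hx'⟩ := hx
      obtain ⟨hy, hy'⟩ := hy
      refine ⟨mul_mem hx hy, fun u hu => ?_⟩
      rw [show (⟨x * y, mul_mem hx hy⟩ : H) = ⟨x, hx⟩ * ⟨y, hy⟩ from rfl, map_mul]
      exact hx' _ (hy' u hu)
  exact (key g hg').2 u hu

theorem apply_mem (W : Submodule ℂ S) (hW : ∀ h, ∀ u ∈ W, π h u ∈ W) (X : 𝔥) {u : S}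
    (hu : u ∈ W) : D X u ∈ W := by
  rw [← Submodule.Quotient.mk_eq_zero]
  refine eq_of_forall_dual_eq fun φ => ?_
  have h1 := hD X u (φ ∘ₗ W.mkQ.restrictScalars ℝ) 0
  rw [apply_lieExp_zero_smul π hexp X u] at h1
  have h2 : (fun s : ℝ => (φ ∘ₗ W.mkQ.restrictScalars ℝ)
      (π ⟨lieExp (s • (X : LieAlg n G)), hexp _ (𝔥.smul_mem s X.2)⟩ u)) = fun _ => 0 := by
    funext s
    change φ (Submodule.Quotient.mk _) = 0
    rw [(Submodule.Quotient.mk_eq_zero W).2 (hW _ u hu), map_zero]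
  rw [h2] at h1
  rw [map_zero]
  exact h1.unique (hasDerivAt_const _ _)

omit hD [T2Space G] in
theorem _root_.hasDerivAt_exp_smul_dual (z : ℂ) (u : S) (φ : S →ₗ[ℝ] ℝ) (t : ℝ) :
    HasDerivAt (fun s : ℝ => φ (Complex.exp (s * z) • u)) (φ (z • Complex.exp (t * z) • u)) t := by
  let l : ℂ →ₗ[ℝ] ℝ := φ ∘ₗ (LinearMap.toSpanSingleton ℂ S u).restrictScalars ℝ
  have h1 : HasDerivAt (fun s : ℝ => Complex.exp (s * z)) (Complex.exp (t * z) * z) t := by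
    have h2 : HasDerivAt (fun s : ℝ => (s : ℂ) * z) z t := by
      simpa using (Complex.ofRealCLM.hasDerivAt (x := t)).mul_const z
    exact h2.cexp
  have h3 := (LinearMap.toContinuousLinearMap l).hasFDerivAt.comp_hasDerivAt t h1
  rw [smul_smul, mul_comm z]
  exact h3

theorem apply_eq_exp_smul [Module.Finite ℂ S] {X : 𝔥} {z : ℂ} {u : S} (hu : D X u = z • u) :
    π ⟨lieExp (X : LieAlg n G), hexp _ X.2⟩ u = Complex.exp z • u := by
  have : Module.Finite ℝ S := Module.Finite.trans ℂ S
  have h := eq_zero_of_hasDerivAt_dual (M := S) (B := (D X).restrictScalars ℝ)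
    (y := fun s => π ⟨lieExp (s • (X : LieAlg n G)), hexp _ (𝔥.smul_mem s X.2)⟩ u -
      Complex.exp (s * z) • u) (fun φ t => by
        have h1 := (hD X u φ t).fun_sub (hasDerivAt_exp_smul_dual z u φ t)
        have h2 : D X (Complex.exp (t * z) • u) = z • Complex.exp (t * z) • u := by
          rw [map_smul, hu, smul_comm]
        rw [← h2] at h1
        simp only [map_sub]
        exact h1)
    (by rw [apply_lieExp_zero_smul]; simp) 1
  rw [sub_eq_zero] at h
  simpa using h

/-- All `t` are needed, since `exp z` alone determines `z` only modulo `2πi`; the derivative at `0`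
recovers it. -/
theorem eq_smul_of_forall {X : 𝔥} {z : ℂ} {u : S}
    (hu : ∀ t : ℝ, π ⟨lieExp (t • (X : LieAlg n G)), hexp _ (𝔥.smul_mem t X.2)⟩ u =
      Complex.exp (t * z) • u) : D X u = z • u := by
  refine eq_of_forall_dual_eq fun φ => ?_
  have h1 := hD X u φ 0
  rw [apply_lieExp_zero_smul π hexp X u] at h1
  simp only [hu] at h1
  have h2 := hasDerivAt_exp_smul_dual z u φ 0
  have h3 := h1.unique h2
  simpa using h3

end IsDifferential

end SpinRep

/-! ### The symmetric pair of an involution -/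

section Involution

variable {L : Type*} [LieRing L] [LieAlgebra ℝ L]

theorem mem_autEigenspace {θ : L ≃ₗ⁅ℝ⁆ L} {c : ℝ} {x : L} :
    x ∈ autEigenspace θ c ↔ θ x = c • x := Module.End.mem_eigenspace_iff

/-- The projections are `(1 ± θ) / 2`. Orthogonality follows from `B(θx, θy) = B(x, y)`, whose left
side is `-B(x, y)` for `x ∈ 𝔥`, `y ∈ 𝔭`. -/
theorem isSymmetricPair_autEigenspace [Module.Finite ℝ L] {θ : L ≃ₗ⁅ℝ⁆ L}
    (hθ : ∀ x, θ (θ x) = x) :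
    IsSymmetricPair (autEigenspace θ 1) (autEigenspace θ (-1)) where
  isCompl := by
    refine IsCompl.of_eq ?_ ?_
    · rw [eq_bot_iff]
      rintro x ⟨h1, h2⟩
      have h1' := mem_autEigenspace.1 h1
      have h2' := mem_autEigenspace.1 h2
      rw [h1', one_smul, neg_one_smul, eq_neg_iff_add_eq_zero, ← two_smul ℝ, smul_eq_zero] at h2'
      exact h2'.resolve_left two_ne_zero
    · rw [eq_top_iff]
      intro x _
      refine Submodule.mem_sup.2 ⟨(1 / 2 : ℝ) • (x + θ x), ?_, (1 / 2 : ℝ) • (x - θ x), ?_, ?_⟩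
      · rw [mem_autEigenspace, map_smul, map_add, hθ, one_smul, add_comm]
      · rw [mem_autEigenspace, map_smul, map_sub, hθ, smul_comm, neg_one_smul, neg_sub]
      · module
  lie_mem x hx y hy := by
    rw [mem_autEigenspace] at *
    rw [LieEquiv.map_lie, hx, hy, one_smul, one_smul, one_smul]
  lie_mem' x hx y hy := by
    rw [mem_autEigenspace] at *
    rw [LieEquiv.map_lie, hx, hy, one_smul, lie_smul]
  killingForm_eq_zero x hx y hy := by
    rw [mem_autEigenspace] at *
    have h := LieAlgebra.killingForm_of_equiv_apply θ x y
    rw [hx, hy, one_smul, map_smul, smul_eq_mul] at h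
    linarith

end Involution

/-! ### Irreducible subrepresentations and their weights -/

section Subrepresentations

theorem isIrreducible_of_forall_le {S : Type*} [AddCommGroup S] [Module ℂ S] {H : Type*}
    [Group H] {π : Representation ℂ H S} (τ : Subrepresentation π) (hτ : ∃ u ∈ τ.toSubmodule, u ≠ 0)
    (h : ∀ W ≤ τ.toSubmodule, (∀ g, ∀ u ∈ W, π g u ∈ W) → W = ⊥ ∨ W = τ.toSubmodule) :
    τ.toRepresentation.IsIrreducible := by
  obtain ⟨u, hu, hne⟩ := hτ
  have hnt : (⊥ : Subrepresentation τ.toRepresentation) ≠ ⊤ := fun e => by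
    have h1 : (⟨u, hu⟩ : τ.toSubmodule) ∈
        (⊥ : Subrepresentation τ.toRepresentation).toSubmodule := by
      rw [e]; exact Submodule.mem_top
    have h2 : (⟨u, hu⟩ : τ.toSubmodule) ∈ (⊥ : Submodule ℂ τ.toSubmodule) := h1
    exact hne (congrArg Subtype.val ((Submodule.mem_bot ℂ).1 h2))
  refine @IsSimpleOrder.mk _ _ _ ⟨⊥, ⊤, hnt⟩ fun U => ?_
  have h1 := h (U.toSubmodule.map τ.toSubmodule.subtype) (Submodule.map_subtype_le _ _) (by
    rintro g _ ⟨x, hx, rfl⟩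
    exact ⟨_, U.apply_mem_toSubmodule g hx, rfl⟩)
  refine h1.imp (fun e => ?_) fun e => ?_
  · refine Subrepresentation.toSubmodule_injective ?_
    change U.toSubmodule = ⊥
    exact Submodule.map_injective_of_injective τ.toSubmodule.injective_subtype
      (e.trans (Submodule.map_bot _).symm)
  · refine Subrepresentation.toSubmodule_injective ?_
    change U.toSubmodule = ⊤
    exact Submodule.map_injective_of_injective τ.toSubmodule.injective_subtype
      (e.trans (Submodule.map_subtype_top _).symm)

variable {n : ℕ} {G : Type*} [TopologicalSpace G] [ChartedSpace (EuclideanSpace ℝ (Fin n)) G]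
  [Group G] [LieGroup (𝓡 n) ∞ G]

theorem IsWeightOf.map {V V' : Type*} [AddCommGroup V] [Module ℂ V] [AddCommGroup V'] [Module ℂ V']
    {H : Subgroup G} {𝔱 : Submodule ℝ (LieAlg n G)} {π : Representation ℂ H V}
    {π' : Representation ℂ H V'} (e : π.Equiv π') {μ : ComplexDual 𝔱} (hμ : IsWeightOf π μ) :
    IsWeightOf π' μ := by
  obtain ⟨v, hv, h⟩ := hμ
  refine ⟨e.toLinearEquiv v, fun h0 => hv ((LinearEquiv.map_eq_zero_iff _).1 h0),
    fun X g hg => ?_⟩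
  have h1 : e.toLinearEquiv (π g v) = π' g (e.toLinearEquiv v) :=
    LinearMap.congr_fun (e.isIntertwining' g) v
  rw [← h1, h X g hg, map_smul]

variable [T2Space G] {S : Type*} [AddCommGroup S] [Module ℂ S]

/-- Passes from weights of the group to simultaneous eigenvectors of `𝔱`: the group condition at all
multiples `t • X` differentiates to the infinitesimal one, which integrates back. -/
theorem IsDifferential.isWeightOf_iff [Module.Finite ℂ S] {H : Subgroup G}
    {π : Representation ℂ H S} {𝔥 𝔱 : Submodule ℝ (LieAlg n G)} {hexp : ∀ X ∈ 𝔥, lieExp X ∈ H}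
    {D : CLie (LieAlg n G) →ₗ[ℂ] Module.End ℂ S}
    (hD : IsDifferential π hexp fun X => D (CLie.of (X : LieAlg n G))) (hle : 𝔱 ≤ 𝔥)
    (τ : Subrepresentation π) (μ : ComplexDual 𝔱) :
    IsWeightOf τ.toRepresentation μ ↔ ∃ u ∈ τ.toSubmodule, u ≠ 0 ∧ u ∈ weightSub 𝔱 D μ := by
  constructor
  · rintro ⟨v, hv, h⟩
    refine ⟨v, v.2, fun h0 => hv (Subtype.ext h0), mem_weightSub.2 fun X => ?_⟩
    refine hD.eq_smul_of_forall (X := ⟨X, hle X.2⟩) fun t => ?_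
    have h1 := congrArg Subtype.val
      (h (t • X) ⟨lieExp (t • (X : LieAlg n G)), hexp _ (𝔥.smul_mem t (hle X.2))⟩ rfl)
    rw [map_smul, Complex.real_smul] at h1
    exact h1
  · rintro ⟨u, hu, hne, h⟩
    refine ⟨⟨u, hu⟩, fun h0 => hne (congrArg Subtype.val h0), fun X g hg => Subtype.ext ?_⟩
    have h1 := hD.apply_eq_exp_smul (X := ⟨X, hle X.2⟩) (mem_weightSub.1 h X)
    have h2 : g = ⟨lieExp (X : LieAlg n G), hexp _ (hle X.2)⟩ := Subtype.ext hg
    rw [h2]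
    exact h1

end Subrepresentations

end

/-! ### The theorem -/

theorem mainTheorem10 {n : ℕ} {G : Type*} [TopologicalSpace G]
    [ChartedSpace (EuclideanSpace ℝ (Fin n)) G] [Group G] [LieGroup (𝓡 n) ∞ G]
    [T2Space G] [CompactSpace G] [ConnectedSpace G]
    [LieAlgebra.IsSemisimple ℝ (LieAlg n G)]
    -- the involution and its eigenspaces
    (θ : LieAlg n G ≃ₗ⁅ℝ⁆ LieAlg n G) (hθ : ∀ X, θ (θ X) = X) (hθ_ne : ∃ X, θ X ≠ X)
    (𝔥 𝔭 : Submodule ℝ (LieAlg n G)) (h𝔥 : 𝔥 = autEigenspace θ 1) (h𝔭 : 𝔭 = autEigenspace θ (-1))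
    -- the analytic subgroup, and equality of ranks
    (H : Subgroup G) (hH : H = analyticSubgroup 𝔥)
    (T : Subgroup G) (hT : IsMaximalTorus T) (hTH : T ≤ H)
    -- the choice of positive roots
    (P : Set (ComplexDual (lieAlgebraOf n T))) (hP : IsPositiveSystem (lieAlgebraOf n T) P)
    -- the spinor representation `spinorRep σ ρ` of `H`
    (ρ : H →* spinGroup (killingQuad 𝔭)) (hρ : IsSpinLift ρ)
    {S : Type*} [AddCommGroup S] [Module ℂ S]
    (σ : (ℂ ⊗[ℝ] CliffordAlgebra (killingQuad 𝔭)) →ₐ[ℂ] Module.End ℂ S)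
    (hσ : IsIrreducibleAlgRep σ) :
    (∀ w ∈ weylW1 (lieAlgebraOf n T) 𝔥 P,
      ∃ τ : Subrepresentation (spinorRep σ ρ), τ.toRepresentation.IsIrreducible ∧
        IsHighestWeightOf τ.toRepresentation (P ∩ rootsIn (lieAlgebraOf n T) 𝔥)
          (deltaP (lieAlgebraOf n T) 𝔭 P w)) ∧
    (∀ w ∈ weylW1 (lieAlgebraOf n T) 𝔥 P, ∀ w' ∈ weylW1 (lieAlgebraOf n T) 𝔥 P, w ≠ w' →
      ∀ τ τ' : Subrepresentation (spinorRep σ ρ),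
        τ.toRepresentation.IsIrreducible → τ'.toRepresentation.IsIrreducible →
        IsHighestWeightOf τ.toRepresentation (P ∩ rootsIn (lieAlgebraOf n T) 𝔥)
          (deltaP (lieAlgebraOf n T) 𝔭 P w) →
        IsHighestWeightOf τ'.toRepresentation (P ∩ rootsIn (lieAlgebraOf n T) 𝔥)
          (deltaP (lieAlgebraOf n T) 𝔭 P w') →
        IsEmpty (τ.toRepresentation.Equiv τ'.toRepresentation)) := by
  have h𝔱 : IsCompactCartan (lieAlgebraOf n T) :=
    ⟨killingForm_lieAlg_neg, fun x hx y hy => lie_eq_zero_of_mem_lieAlgebraOf hT.prop hx hy,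
      fun x hx => hT.mem_lieAlgebraOf hx⟩
  have hkill := h𝔱.isKilling
  have hp : IsSymmetricPair 𝔥 𝔭 := by
    rw [h𝔥, h𝔭]; exact isSymmetricPair_autEigenspace hθ
  have hH' : H = analyticSubgroup (autEigenspace θ 1) := by rw [hH, h𝔥]
  have hle : lieAlgebraOf n T ≤ 𝔥 := by
    rw [h𝔥]; exact lieAlgebraOf_le_autEigenspace θ (hH' ▸ hTH)
  have hexp : ∀ X ∈ 𝔥, lieExp X ∈ H := fun X hX => by
    rw [hH]; exact Subgroup.subset_closure ⟨X, hX, rfl⟩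
  have hAd : ∀ h ∈ H, ∀ x ∈ 𝔭, lieAd n h x ∈ 𝔭 := fun h hh x hx => by
    rw [h𝔭, mem_autEigenspace] at hx ⊢
    rw [hH'] at hh
    rw [aut_lieAd_of_mem_analyticSubgroup θ hh, hx, map_smul]
  obtain ⟨v, hv⟩ := exists_orthogonal_basis_killingQuad 𝔭
  obtain ⟨c, D, hspin, hDσ⟩ := hp.exists_isSpinModule killingForm_lieAlg_neg σ hσ hv
  have hfin := hspin.finite
  have hD : IsDifferential (spinorRep σ ρ) hexp fun X => D (CLie.of (X : LieAlg n G)) := by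
    simp only [hDσ]
    exact isDifferential_spinorRep hexp hAd hρ hp hv σ
  refine ⟨fun w hw => ?_, fun w hw w' hw' hne τ τ' _ _ hτ hτ' => ⟨fun e => hne ?_⟩⟩
  -- `Y` represents the chamber of `w P`; the vacuum for `Y` has weight `deltaP`, and the roots of
  -- `𝔥` positive at `Y` are those in `P`.
  · obtain ⟨Y, hY, -, hδ, hQ⟩ := h𝔱.exists_of_mem_weylW1 hp hle hP hw
    obtain ⟨N, hN, ⟨u, huN, hu0, hu⟩, hirr, hwt⟩ := hspin.exists_highestWeight hp h𝔱 hle hY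
    let τ : Subrepresentation (spinorRep σ ρ) :=
      ⟨N, fun h x hx => hD.stable_of_stable hH (fun X y hy => hN X X.2 y hy) h hx⟩
    refine ⟨τ, isIrreducible_of_forall_le τ ⟨u, huN, hu0⟩ fun W hWN hW => hirr W hWN
      fun x hx y hy => hD.apply_mem W hW ⟨x, hx⟩ hy, ?_⟩
    rw [hδ, hQ]
    refine ⟨(hD.isWeightOf_iff hle τ _).2 ⟨u, huN, hu0, hu⟩, fun ν hν => ?_⟩
    obtain ⟨y, hyN, hy0, hy⟩ := (hD.isWeightOf_iff hle τ ν).1 hν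
    exact hwt ν y hyN hy0 hy
  -- An equivalence makes each highest weight a weight of the other representation, so each
  -- dominates the other and they coincide.
  · refine h𝔱.eq_of_deltaP_eq hp hle hP hw hw' ?_
    obtain ⟨X₀, -, rfl⟩ := hP
    exact eq_of_sub_mem_closure (X₁ := X₀) (fun α hα => hα.1.2) (hτ.2 _ (hτ'.1.map e.symm))
      (hτ'.2 _ (hτ.1.map e))
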